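/- **Conventions.** A (strict) double category has objects, horizontal 1-cells (1h-cells), vertical 1-cells (1v-cells) and square 2-cells, with strictly associative and unital compositions in both directions and the interchange law. We write $gf$ and $vu$ for composites of 1-cells ($f$, resp. $u$, first), $[a\,|\,b]$ for horizontal pasting ($a$ on the left), $\frac{a}{b}$ for vertical pasting ($a$ on top). Identity 2-cells are denoted by $\mathrm{Id}$. A 2-cell whose left and right sides are identities is written $f\Rightarrow g$ (top to bottom), and one whose top and bottom are identities is written $u\Rrightarrow v$ (left to right); invertibility of such 2-cells is meant with respect to vertical, resp. horizontal, composition. A *double pseudofunctor* $F:\mathbb A\to\mathbb B$ between strict double categories assigns objects, 1h-cells, 1v-cells and 2-cells to such (respecting boundaries), together with invertible 2-cells $F_{gf}:F(gf)\Rightarrow F(g)F(f)$, $F_A:F(\mathrm{id}_A)\Rightarrow \mathrm{id}_{F(A)}$ (for 1h-cells) and $F^{vu}:F(v)F(u)\Rrightarrow F(vu)$, $F^A:\mathrm{id}_{F(A)}\Rrightarrow F(\mathrm{id}_A)$ (for 1v-cells), which are natural with respect to 2-cells of $\mathbb A$ and satisfy the usual associativity and unit coherence laws in both directions. Double pseudofunctors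 compose, the composite being denoted by juxtaposition. A *horizontal pseudonatural transformation* $\alpha:F\Rightarrow G$ between double pseudofunctors $F,G:\mathbb A\to\mathbb B$ consists of a 1h-cell $\alpha(A):F(A)\to G(A)$ for each object $A$, a 2-cell $\alpha_u$ with top $\alpha(A)$, left $F(u)$, right $G(u)$, bottom $\alpha(A')$ for each 1v-cell $u:A\to A'$, and a 2-cell $\delta_{\alpha,f}:\alpha(B)F(f)\Rightarrow G(f)\alpha(A)$ for each 1h-cell $f:A\to B$, such that 1. for every 2-cell $a$ with top $f$, left $u$, right $v$, bottom $g$: $\dfrac{[F(a)\,|\,\alpha_v]}{\delta_{\alpha,g}}=\dfrac{\delta_{\alpha,f}}{[\alpha_u\,|\,G(a)]}$; 2. $[F^{vu}\,|\,\alpha_{vu}]=\big[\tfrac{\alpha_u}{\alpha_v}\,\big|\,G^{vu}\big]$ and $[F^A\,|\,\alpha_{\mathrm{id}_A}]=[\mathrm{Id}_{\alpha(A)}\,|\,G^A]$; 3. $\delta_{\alpha,gf}$ is the vertical pasting, from top to bottom, of $[F_{gf}\,|\,\mathrm{Id}_{\alpha(C)}]$, $[\mathrm{Id}_{F(f)}\,|\,\delta_{\alpha,g}]$,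 $[\delta_{\alpha,f}\,|\,\mathrm{Id}_{G(g)}]$, $[\mathrm{Id}_{\alpha(A)}\,|\,G_{gf}^{-1}]$ (for $f:A\to B$, $g:B\to C$), and the vertical pasting of $[F_A^{-1}\,|\,\mathrm{Id}_{\alpha(A)}]$, $\delta_{\alpha,\mathrm{id}_A}$, $[\mathrm{Id}_{\alpha(A)}\,|\,G_A]$ is $\mathrm{Id}_{\alpha(A)}$. A *vertical pseudonatural transformation* $\alpha:F\Rightarrow G$ is defined analogously, with the two directions exchanged: 1v-cells $\alpha(A):F(A)\to G(A)$; for each 1h-cell $f:A\to B$ a 2-cell $\alpha_f$ with top $F(f)$, left $\alpha(A)$, right $\alpha(B)$, bottom $G(f)$; for each 1v-cell $u:A\to A'$ a 2-cell $\delta_{\alpha,u}:\alpha(A')F(u)\Rrightarrow G(u)\alpha(A)$; and the transposed axioms. A *double pseudonatural transformation* $\alpha:F\Rightarrow G$ is a quadruple $(\alpha_0,\alpha_1,t^\alpha,r^\alpha)$ such that: * **(T1)** $\alpha_0:F\Rightarrow G$ is a vertical and $\alpha_1:F\Rightarrow G$ a horizontal pseudonatural transformation; * **(T2)** the 2-cell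 $\delta_{\alpha_1,f}$ is invertible whenever $f$ is a 1h-cell component $\gamma(X)$ of a horizontal pseudonatural transformation $\gamma$ between double pseudofunctors with values in $\mathbb A$, and $\delta_{\alpha_0,u}$ is invertible whenever $u$ is a 1v-cell component of a vertical pseudonatural transformation between such; * **(T3)** for every 1h-cell $f:A\to B$ and 1v-cell $u:A\to A'$ of $\mathbb A$ there are given 2-cells of $\mathbb B$: $t^\alpha_f$ with top $\alpha_1(B)F(f)$, left $\alpha_0(A)$, right $\mathrm{id}_{G(B)}$, bottom $G(f)$, and $r^\alpha_u$ with top $\alpha_1(A)$, left $\alpha_0(A')F(u)$, right $G(u)$, bottom $\mathrm{id}_{G(A')}$, satisfying * (T3-1) for every 2-cell $a$ with top $f$, left $u$, right $v$, bottom $g$: $$\frac{[F(a)\,|\,(\alpha_1)_v]}{t^\alpha_g}=\Big[\delta_{\alpha_0,u}\,\Big|\,\frac{t^\alpha_f}{G(a)}\Big],\qquad \Big[\frac{F(a)}{(\alpha_0)_g}\,\Big|\,r^\alpha_v\Big]=\frac{\delta_{\alpha_1,f}}{[r^\alpha_u\,|\,G(a)]};$$ * (T3-2) for composable $f,g$ and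 composable $u,v$: $$\frac{[\mathrm{Id}_{F(f)}\,|\,\delta_{\alpha_1,g}]}{[t^\alpha_f\,|\,\mathrm{Id}_{G(g)}]}=[(\alpha_0)_f\,|\,t^\alpha_g],\qquad \Big[\frac{\mathrm{Id}_{F(u)}}{\delta_{\alpha_0,v}}\,\Big|\,\frac{r^\alpha_u}{\mathrm{Id}_{G(v)}}\Big]=\frac{(\alpha_1)_u}{r^\alpha_v};$$ * (T3-3) for composable $f,g$ (with $g$ ending in $C$) and composable $u,v$ (with $v$ ending in $A''$): $t^\alpha_{gf}$ is the vertical pasting, from top to bottom, of $[F_{gf}\,|\,\mathrm{Id}_{\alpha_1(C)}]$, $[(\alpha_0)_f\,|\,t^\alpha_g]$ and $G_{gf}^{-1}$; and $r^\alpha_{vu}$ is the horizontal pasting, from left to right, of $\frac{(F^{vu})^{-1}}{\mathrm{Id}_{\alpha_0(A'')}}$, $\frac{(\alpha_1)_u}{r^\alpha_v}$ and $G^{vu}$. **Proposition.** Let $\alpha=(\alpha_0,\alpha_1,t^\alpha,r^\alpha):F\Rightarrow G:\mathbb A\to\mathbb B$ and $\beta=(\beta_0,\beta_1,t^\beta,r^\beta):F'\Rightarrow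 G':\mathbb B\to\mathbb C$ be double pseudonatural transformations between double pseudofunctors of strict double categories. Then the following data constitute a double pseudonatural transformation $\beta\circ\alpha:F'F\Rightarrow G'G:\mathbb A\to\mathbb C$; that is, they satisfy (T1), (T2) and (T3): * the horizontal transformation $\beta_1\circ\alpha_1$ with $(\beta_1\circ\alpha_1)(A)=\beta_1(G(A))\,F'(\alpha_1(A))$, $(\beta_1\circ\alpha_1)_u=[F'((\alpha_1)_u)\,|\,(\beta_1)_{G(u)}]$, and, for $f:A\to B$, $$\delta_{\beta_1\circ\alpha_1,f}=\frac{[\delta_{F'(\alpha_1),f}\,|\,\mathrm{Id}_{\beta_1(G(B))}]}{[\mathrm{Id}_{F'(\alpha_1(A))}\,|\,\delta_{\beta_1,G(f)}]};$$ here $\delta_{F'(\alpha_1),f}:F'(\alpha_1(B))F'F(f)\Rightarrow F'G(f)F'(\alpha_1(A))$ is the vertical pasting, from top to bottom, of $F'^{-1}_{\alpha_1(B),F(f)}$, of $[F'^{F(A)}\,|\,F'(\delta_{\alpha_1,f})\,|\,(F'^{G(B)})^{-1}]$, and of $F'_{G(f),\alpha_1(A)}$; * the vertical transformation $\beta_0\circ\alpha_0$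 with $(\beta_0\circ\alpha_0)(A)=\beta_0(G(A))\,F'(\alpha_0(A))$, $(\beta_0\circ\alpha_0)_f=\dfrac{F'((\alpha_0)_f)}{(\beta_0)_{G(f)}}$ and, for $u:A\to A'$, $$\delta_{\beta_0\circ\alpha_0,u}=\Big[\frac{\delta_{F'(\alpha_0),u}}{\mathrm{Id}_{\beta_0(G(A'))}}\,\Big|\,\frac{\mathrm{Id}_{F'(\alpha_0(A))}}{\delta_{\beta_0,G(u)}}\Big],$$ where $\delta_{F'(\alpha_0),u}$ is the horizontal pasting, from left to right, of $F'^{\,\alpha_0(A'),F(u)}$, of $F'(\delta_{\alpha_0,u})$ pasted with $F'^{-1}_{F(A)}$ on top and with $F'_{G(A')}$ at the bottom, and of $(F'^{\,G(u),\alpha_0(A)})^{-1}$; * for every 1h-cell $f:A\to B$ and 1v-cell $u:A\to A'$ of $\mathbb A$, the following 2-cells of $\mathbb C$, where $\big[\;\cdot\;\big/\;\cdot\;\big]$ also denotes vertical pasting from top to bottom: $$t^{\beta\circ\alpha}_f=\Big[\ \delta_{\beta_0,\alpha_0(A)}\ \Big|\ \Big(\,[(\beta_0)_{F(f)}\,|\,t^\beta_{\alpha_1(B)}]\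 \Big/\ G'^{-1}_{\alpha_1(B),F(f)}\ \Big/\ [\,G'(t^\alpha_f)\,|\,(G'^{\,G(B)})^{-1}]\,\Big)\Big],$$ $$r^{\beta\circ\alpha}_u=\ \delta_{\beta_1,\alpha_1(A)}\ \Big/\ \Big[\ \Big(\,(\beta_1)_{F(u)}\ \Big/\ r^\beta_{\alpha_0(A')}\,\Big)\ \Big|\ G'^{\,\alpha_0(A'),F(u)}\ \Big|\ \Big(\,G'(r^\alpha_u)\ \Big/\ G'_{G(A')}\,\Big)\ \Big].$$ -/

import Mathlib

set_option linter.checkUnivs false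

universe u v w x

/-- A strict double category: objects, horizontal 1-cells, vertical 1-cells and 2-cells (squares).
A 2-cell in `Sq f u v g` is a square with top `f`, left side `u`, right side `v` and bottom `g`.

Composition of 1-cells and of 2-cells is written in diagrammatic order (first left, then right;
first top, then bottom).  All associativity and unit laws are strict; for 2-cells, where the
boundaries on both sides agree only by virtue of the laws for 1-cells, the equality is a
heterogeneous one. -/
structure DoubleCat where
  Obj : Type u
  Hor : Obj → Obj → Type v
  Ver : Obj → Obj → Type w
  Sq : {A B A' B' : Obj} → Hor A B → Ver A A' → Ver B B' → Hor A' B' → Type x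
  /-- identity horizontal 1-cells -/
  h1 : (A : Obj) → Hor A A
  /-- composition of horizontal 1-cells -/
  hc : {A B C : Obj} → Hor A B → Hor B C → Hor A C
  h1_hc : ∀ {A B : Obj} (f : Hor A B), hc (h1 A) f = f
  hc_h1 : ∀ {A B : Obj} (f : Hor A B), hc f (h1 B) = f
  hc_assoc : ∀ {A B C D : Obj} (f : Hor A B) (g : Hor B C) (h : Hor C D),
    hc (hc f g) h = hc f (hc g h)
  /-- identity vertical 1-cells -/
  v1 : (A : Obj) → Ver A A
  /-- composition of vertical 1-cells -/
  vc : {A B C : Obj} → Ver A B → Ver B C → Ver A C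
  v1_vc : ∀ {A B : Obj} (u : Ver A B), vc (v1 A) u = u
  vc_v1 : ∀ {A B : Obj} (u : Ver A B), vc u (v1 B) = u
  vc_assoc : ∀ {A B C D : Obj} (u : Ver A B) (v : Ver B C) (w : Ver C D),
    vc (vc u v) w = vc u (vc v w)
  /-- the identity 2-cell of a vertical 1-cell for horizontal composition -/
  hId : {A A' : Obj} → (u : Ver A A') → Sq (h1 A) u u (h1 A')
  /-- horizontal composition of 2-cells -/
  hcomp : {A B C A' B' C' : Obj} → {f : Hor A B} → {f' : Hor B C} → {u : Ver A A'} →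
    {v : Ver B B'} → {w : Ver C C'} → {g : Hor A' B'} → {g' : Hor B' C'} →
    Sq f u v g → Sq f' v w g' → Sq (hc f f') u w (hc g g')
  /-- the identity 2-cell of a horizontal 1-cell for vertical composition -/
  vId : {A B : Obj} → (f : Hor A B) → Sq f (v1 A) (v1 B) f
  /-- vertical composition of 2-cells -/
  vcomp : {A B A' B' A'' B'' : Obj} → {f : Hor A B} → {g : Hor A' B'} → {h : Hor A'' B''} →
    {u : Ver A A'} → {v : Ver B B'} → {u' : Ver A' A''} → {v' : Ver B' B''} →
    Sq f u v g → Sq g u' v' h → Sq f (vc u u') (vc v v') h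
  hId_hcomp : ∀ {A B A' B' : Obj} {f : Hor A B} {u : Ver A A'} {v : Ver B B'} {g : Hor A' B'}
    (s : Sq f u v g), HEq (hcomp (hId u) s) s
  hcomp_hId : ∀ {A B A' B' : Obj} {f : Hor A B} {u : Ver A A'} {v : Ver B B'} {g : Hor A' B'}
    (s : Sq f u v g), HEq (hcomp s (hId v)) s
  hcomp_assoc : ∀ {A B C D A' B' C' D' : Obj} {f₁ : Hor A B} {f₂ : Hor B C} {f₃ : Hor C D}
    {u₀ : Ver A A'} {u₁ : Ver B B'} {u₂ : Ver C C'} {u₃ : Ver D D'}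
    {g₁ : Hor A' B'} {g₂ : Hor B' C'} {g₃ : Hor C' D'}
    (s : Sq f₁ u₀ u₁ g₁) (t : Sq f₂ u₁ u₂ g₂) (r : Sq f₃ u₂ u₃ g₃),
    HEq (hcomp (hcomp s t) r) (hcomp s (hcomp t r))
  vId_vcomp : ∀ {A B A' B' : Obj} {f : Hor A B} {u : Ver A A'} {v : Ver B B'} {g : Hor A' B'}
    (s : Sq f u v g), HEq (vcomp (vId f) s) s
  vcomp_vId : ∀ {A B A' B' : Obj} {f : Hor A B} {u : Ver A A'} {v : Ver B B'} {g : Hor A' B'}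
    (s : Sq f u v g), HEq (vcomp s (vId g)) s
  vcomp_assoc : ∀ {A B C D A' B' C' D' : Obj} {u₁ : Ver A B} {u₂ : Ver B C} {u₃ : Ver C D}
    {f₀ : Hor A A'} {f₁ : Hor B B'} {f₂ : Hor C C'} {f₃ : Hor D D'}
    {v₁ : Ver A' B'} {v₂ : Ver B' C'} {v₃ : Ver C' D'}
    (s : Sq f₀ u₁ v₁ f₁) (t : Sq f₁ u₂ v₂ f₂) (r : Sq f₂ u₃ v₃ f₃),
    HEq (vcomp (vcomp s t) r) (vcomp s (vcomp t r))
  vId_h1 : ∀ A : Obj, vId (h1 A) = hId (v1 A)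
  vId_hc : ∀ {A B C : Obj} (f : Hor A B) (g : Hor B C), vId (hc f g) = hcomp (vId f) (vId g)
  hId_vc : ∀ {A B C : Obj} (u : Ver A B) (v : Ver B C), hId (vc u v) = vcomp (hId u) (hId v)
  interchange : ∀ {A B C A' B' C' A'' B'' C'' : Obj}
    {f : Hor A B} {f' : Hor B C} {u : Ver A A'} {v : Ver B B'} {w : Ver C C'}
    {g : Hor A' B'} {g' : Hor B' C'} {u' : Ver A' A''} {v' : Ver B' B''} {w' : Ver C' C''}
    {k : Hor A'' B''} {k' : Hor B'' C''}
    (a : Sq f u v g) (b : Sq f' v w g') (c : Sq g u' v' k) (d : Sq g' v' w' k'),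
    vcomp (hcomp a b) (hcomp c d) = hcomp (vcomp a c) (vcomp b d)

namespace DoubleCat

/-- Horizontal pasting `s ▥ t` (`s` on the left of `t`): the composite `hcomp s t`, read with top
and bottom 1-cells that are equal to the composites of the tops and of the bottoms. -/
def hP {D : DoubleCat.{u, v, w, x}} {A B C A' B' C' : D.Obj} {f : D.Hor A B} {f' : D.Hor B C}
    {u : D.Ver A A'} {v : D.Ver B B'} {w : D.Ver C C'} {g : D.Hor A' B'} {g' : D.Hor B' C'}
    {p : D.Hor A C} {q : D.Hor A' C'}
    (s : D.Sq f u v g) (t : D.Sq f' v w g')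
    (top : D.hc f f' = p := by
      first | with_reducible rfl | simp only [DoubleCat.h1_hc, DoubleCat.hc_h1, DoubleCat.hc_assoc])
    (bot : D.hc g g' = q := by
      first | with_reducible rfl | simp only [DoubleCat.h1_hc, DoubleCat.hc_h1, DoubleCat.hc_assoc]) :
    D.Sq p u w q :=
  cast (by rw [top, bot]) (D.hcomp s t)

/-- Vertical pasting `s ▤ t` (`s` above `t`): the composite `vcomp s t`, read with left and right
1-cells that are equal to the composites of the left sides and of the right sides. -/
def vP {D : DoubleCat.{u, v, w, x}} {A B A' B' A'' B'' : D.Obj} {f : D.Hor A B} {g : D.Hor A' B'}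
    {h : D.Hor A'' B''} {u : D.Ver A A'} {v : D.Ver B B'} {u' : D.Ver A' A''} {v' : D.Ver B' B''}
    {p : D.Ver A A''} {q : D.Ver B B''}
    (s : D.Sq f u v g) (t : D.Sq g u' v' h)
    (left : D.vc u u' = p := by
      first | with_reducible rfl | simp only [DoubleCat.v1_vc, DoubleCat.vc_v1, DoubleCat.vc_assoc])
    (right : D.vc v v' = q := by
      first | with_reducible rfl | simp only [DoubleCat.v1_vc, DoubleCat.vc_v1, DoubleCat.vc_assoc]) :
    D.Sq f p q h :=
  cast (by rw [left, right]) (D.vcomp s t)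

end DoubleCat

infixl:70 " ▥ " => DoubleCat.hP
infixl:65 " ▤ " => DoubleCat.vP

namespace DoubleCat

/-- A vertically invertible 2-cell from `f` to `g` whose left and right sides are identities. -/
structure HorIso (D : DoubleCat.{u, v, w, x}) {A B : D.Obj} (f g : D.Hor A B) where
  hom : D.Sq f (D.v1 A) (D.v1 B) g
  inv : D.Sq g (D.v1 A) (D.v1 B) f
  hom_inv : hom ▤ inv = D.vId f
  inv_hom : inv ▤ hom = D.vId g

/-- A horizontally invertible 2-cell from `u` to `v` whose top and bottom sides are identities. -/
structure VerIso (D : DoubleCat.{u, v, w, x}) {A B : D.Obj} (u v : D.Ver A B) where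
  hom : D.Sq (D.h1 A) u v (D.h1 B)
  inv : D.Sq (D.h1 A) v u (D.h1 B)
  hom_inv : hom ▥ inv = D.hId u
  inv_hom : inv ▥ hom = D.hId v

end DoubleCat

/-- A double pseudofunctor between strict double categories: it preserves horizontal as well as
vertical composition and identities up to coherent invertible 2-cells. -/
structure DoublePsFunctor (𝒜 ℬ : DoubleCat.{u, v, w, x}) where
  obj : 𝒜.Obj → ℬ.Obj
  mapH : {A B : 𝒜.Obj} → 𝒜.Hor A B → ℬ.Hor (obj A) (obj B)
  mapV : {A B : 𝒜.Obj} → 𝒜.Ver A B → ℬ.Ver (obj A) (obj B)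
  mapSq : {A B A' B' : 𝒜.Obj} → {f : 𝒜.Hor A B} → {u : 𝒜.Ver A A'} → {v : 𝒜.Ver B B'} →
    {g : 𝒜.Hor A' B'} → 𝒜.Sq f u v g → ℬ.Sq (mapH f) (mapV u) (mapV v) (mapH g)
  /-- `F_{gf}` -/
  hComp : {A B C : 𝒜.Obj} → (f : 𝒜.Hor A B) → (g : 𝒜.Hor B C) →
    ℬ.HorIso (mapH (𝒜.hc f g)) (ℬ.hc (mapH f) (mapH g))
  /-- `F_A` -/
  hUnit : (A : 𝒜.Obj) → ℬ.HorIso (mapH (𝒜.h1 A)) (ℬ.h1 (obj A))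
  /-- `F^{vu}` -/
  vComp : {A B C : 𝒜.Obj} → (u : 𝒜.Ver A B) → (v : 𝒜.Ver B C) →
    ℬ.VerIso (ℬ.vc (mapV u) (mapV v)) (mapV (𝒜.vc u v))
  /-- `F^A` -/
  vUnit : (A : 𝒜.Obj) → ℬ.VerIso (ℬ.v1 (obj A)) (mapV (𝒜.v1 A))
  hComp_nat : ∀ {A B C A' B' C' : 𝒜.Obj} {f : 𝒜.Hor A B} {f' : 𝒜.Hor B C}
    {u : 𝒜.Ver A A'} {v : 𝒜.Ver B B'} {w : 𝒜.Ver C C'} {g : 𝒜.Hor A' B'} {g' : 𝒜.Hor B' C'}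
    (a : 𝒜.Sq f u v g) (b : 𝒜.Sq f' v w g'),
    ((hComp f f').hom ▤ (mapSq a ▥ mapSq b) : ℬ.Sq _ (mapV u) (mapV w) _) =
      mapSq (𝒜.hcomp a b) ▤ (hComp g g').hom
  hUnit_nat : ∀ {A A' : 𝒜.Obj} (u : 𝒜.Ver A A'),
    ((hUnit A).hom ▤ ℬ.hId (mapV u) : ℬ.Sq _ (mapV u) (mapV u) _) =
      mapSq (𝒜.hId u) ▤ (hUnit A').hom
  vComp_nat : ∀ {A B A' B' A'' B'' : 𝒜.Obj} {f : 𝒜.Hor A B} {g : 𝒜.Hor A' B'}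
    {h : 𝒜.Hor A'' B''} {u : 𝒜.Ver A A'} {v : 𝒜.Ver B B'} {u' : 𝒜.Ver A' A''}
    {v' : 𝒜.Ver B' B''} (a : 𝒜.Sq f u v g) (b : 𝒜.Sq g u' v' h),
    ((mapSq a ▤ mapSq b) ▥ (vComp v v').hom : ℬ.Sq (mapH f) _ _ (mapH h)) =
      (vComp u u').hom ▥ mapSq (𝒜.vcomp a b)
  vUnit_nat : ∀ {A B : 𝒜.Obj} (f : 𝒜.Hor A B),
    (ℬ.vId (mapH f) ▥ (vUnit B).hom : ℬ.Sq (mapH f) _ _ (mapH f)) =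
      (vUnit A).hom ▥ mapSq (𝒜.vId f)
  hComp_assoc : ∀ {A B C D : 𝒜.Obj} (f : 𝒜.Hor A B) (g : 𝒜.Hor B C) (h : 𝒜.Hor C D),
    HEq ((hComp f (𝒜.hc g h)).hom ▤ (ℬ.vId (mapH f) ▥ (hComp g h).hom) :
        ℬ.Sq _ (ℬ.v1 _) (ℬ.v1 _) (ℬ.hc (mapH f) (ℬ.hc (mapH g) (mapH h))))
      ((hComp (𝒜.hc f g) h).hom ▤ ((hComp f g).hom ▥ ℬ.vId (mapH h)) :
        ℬ.Sq _ (ℬ.v1 _) (ℬ.v1 _) (ℬ.hc (ℬ.hc (mapH f) (mapH g)) (mapH h)))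
  h1_hComp : ∀ {A B : 𝒜.Obj} (f : 𝒜.Hor A B),
    HEq ((hComp (𝒜.h1 A) f).hom ▤ ((hUnit A).hom ▥ ℬ.vId (mapH f)) :
        ℬ.Sq _ (ℬ.v1 _) (ℬ.v1 _) (mapH f))
      (ℬ.vId (mapH f))
  hComp_h1 : ∀ {A B : 𝒜.Obj} (f : 𝒜.Hor A B),
    HEq ((hComp f (𝒜.h1 B)).hom ▤ (ℬ.vId (mapH f) ▥ (hUnit B).hom) :
        ℬ.Sq _ (ℬ.v1 _) (ℬ.v1 _) (mapH f))
      (ℬ.vId (mapH f))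
  vComp_assoc : ∀ {A B C D : 𝒜.Obj} (u : 𝒜.Ver A B) (v : 𝒜.Ver B C) (w : 𝒜.Ver C D),
    HEq ((ℬ.hId (mapV u) ▤ (vComp v w).hom) ▥ (vComp u (𝒜.vc v w)).hom :
        ℬ.Sq (ℬ.h1 _) (ℬ.vc (mapV u) (ℬ.vc (mapV v) (mapV w))) _ (ℬ.h1 _))
      (((vComp u v).hom ▤ ℬ.hId (mapV w)) ▥ (vComp (𝒜.vc u v) w).hom :
        ℬ.Sq (ℬ.h1 _) (ℬ.vc (ℬ.vc (mapV u) (mapV v)) (mapV w)) _ (ℬ.h1 _))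
  v1_vComp : ∀ {A B : 𝒜.Obj} (u : 𝒜.Ver A B),
    HEq (((vUnit A).hom ▤ ℬ.hId (mapV u)) ▥ (vComp (𝒜.v1 A) u).hom :
        ℬ.Sq (ℬ.h1 _) (mapV u) _ (ℬ.h1 _))
      (ℬ.hId (mapV u))
  vComp_v1 : ∀ {A B : 𝒜.Obj} (u : 𝒜.Ver A B),
    HEq ((ℬ.hId (mapV u) ▤ (vUnit B).hom) ▥ (vComp u (𝒜.v1 B)).hom :
        ℬ.Sq (ℬ.h1 _) (mapV u) _ (ℬ.h1 _))
      (ℬ.hId (mapV u))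

namespace DoubleCat

/-- The transposed double category: horizontal and vertical directions are exchanged. -/
def transpose (D : DoubleCat.{u, v, w, x}) : DoubleCat.{u, w, v, x} where
  Obj := D.Obj
  Hor := D.Ver
  Ver := D.Hor
  Sq f u v g := D.Sq u f g v
  h1 := D.v1
  hc := D.vc
  h1_hc := D.v1_vc
  hc_h1 := D.vc_v1
  hc_assoc := D.vc_assoc
  v1 := D.h1
  vc := D.hc
  v1_vc := D.h1_hc
  vc_v1 := D.hc_h1
  vc_assoc := D.hc_assoc
  hId := D.vId
  hcomp := D.vcomp
  vId := D.hId
  vcomp := D.hcomp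
  hId_hcomp := D.vId_vcomp
  hcomp_hId := D.vcomp_vId
  hcomp_assoc := D.vcomp_assoc
  vId_vcomp := D.hId_hcomp
  vcomp_vId := D.hcomp_hId
  vcomp_assoc := D.hcomp_assoc
  vId_h1 A := (D.vId_h1 A).symm
  vId_hc := D.hId_vc
  hId_vc := D.vId_hc
  interchange a b c d := (D.interchange a c b d).symm

section Laws

variable {D : DoubleCat.{u, v, w, x}}

theorem hP_heq {A B C A' B' C' : D.Obj} {f : D.Hor A B} {f' : D.Hor B C}
    {u : D.Ver A A'} {v : D.Ver B B'} {w : D.Ver C C'} {g : D.Hor A' B'} {g' : D.Hor B' C'}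
    {p : D.Hor A C} {q : D.Hor A' C'} (s : D.Sq f u v g) (t : D.Sq f' v w g')
    (top : D.hc f f' = p) (bot : D.hc g g' = q) : HEq (hP s t top bot) (D.hcomp s t) :=
  cast_heq _ _

theorem hId_hP {A B A' B' : D.Obj} {f : D.Hor A B} {u : D.Ver A A'} {v : D.Ver B B'}
    {g : D.Hor A' B'} (s : D.Sq f u v g) (top : D.hc (D.h1 A) f = f)
    (bot : D.hc (D.h1 A') g = g) : hP (D.hId u) s top bot = s :=
  eq_of_heq ((hP_heq _ _ _ _).trans (D.hId_hcomp s))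

theorem hP_hId {A B A' B' : D.Obj} {f : D.Hor A B} {u : D.Ver A A'} {v : D.Ver B B'}
    {g : D.Hor A' B'} (s : D.Sq f u v g) (top : D.hc f (D.h1 B) = f)
    (bot : D.hc g (D.h1 B') = g) : hP s (D.hId v) top bot = s :=
  eq_of_heq ((hP_heq _ _ _ _).trans (D.hcomp_hId s))

theorem hP_assoc {A B C E A' B' C' E' : D.Obj} {f₁ : D.Hor A B} {f₂ : D.Hor B C} {f₃ : D.Hor C E}
    {u₀ : D.Ver A A'} {u₁ : D.Ver B B'} {u₂ : D.Ver C C'} {u₃ : D.Ver E E'}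
    {g₁ : D.Hor A' B'} {g₂ : D.Hor B' C'} {g₃ : D.Hor C' E'}
    {f₁₂ : D.Hor A C} {f₂₃ : D.Hor B E} {f : D.Hor A E}
    {g₁₂ : D.Hor A' C'} {g₂₃ : D.Hor B' E'} {g : D.Hor A' E'}
    (s : D.Sq f₁ u₀ u₁ g₁) (t : D.Sq f₂ u₁ u₂ g₂) (r : D.Sq f₃ u₂ u₃ g₃)
    (h1 : D.hc f₁ f₂ = f₁₂) (h2 : D.hc g₁ g₂ = g₁₂) (h3 : D.hc f₁₂ f₃ = f) (h4 : D.hc g₁₂ g₃ = g)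
    (h5 : D.hc f₂ f₃ = f₂₃) (h6 : D.hc g₂ g₃ = g₂₃) (h7 : D.hc f₁ f₂₃ = f)
    (h8 : D.hc g₁ g₂₃ = g) :
    hP (hP s t h1 h2) r h3 h4 = hP s (hP t r h5 h6) h7 h8 := by
  subst h1 h2 h5 h6 h3 h4
  exact eq_of_heq ((hP_heq _ _ _ _).trans ((D.hcomp_assoc s t r).trans (hP_heq _ _ _ _).symm))

theorem vId_hP {A B C : D.Obj} {f : D.Hor A B} {g : D.Hor B C} {k : D.Hor A C}
    (h1 : D.hc f g = k) (h2 : D.hc f g = k) : hP (D.vId f) (D.vId g) h1 h2 = D.vId k := by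
  subst h1
  exact (D.vId_hc f g).symm

theorem interchangeP {A B C A' B' C' A'' B'' C'' : D.Obj}
    {f : D.Hor A B} {f' : D.Hor B C} {u : D.Ver A A'} {v : D.Ver B B'} {w : D.Ver C C'}
    {g : D.Hor A' B'} {g' : D.Hor B' C'} {u' : D.Ver A' A''} {v' : D.Ver B' B''}
    {w' : D.Ver C' C''} {k : D.Hor A'' B''} {k' : D.Hor B'' C''}
    {ff : D.Hor A C} {gg : D.Hor A' C'} {kk : D.Hor A'' C''}
    {uu : D.Ver A A''} {vv : D.Ver B B''} {ww : D.Ver C C''}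
    (a : D.Sq f u v g) (b : D.Sq f' v w g') (c : D.Sq g u' v' k) (d : D.Sq g' v' w' k')
    (h1 : D.hc f f' = ff) (h2 : D.hc g g' = gg) (h3 : D.hc k k' = kk)
    (h4 : D.vc u u' = uu) (h5 : D.vc v v' = vv) (h6 : D.vc w w' = ww) :
    vP (hP a b h1 h2) (hP c d h2 h3) h4 h6 = hP (vP a c h4 h5) (vP b d h5 h6) h1 h3 := by
  subst h1 h2 h3 h4 h5 h6
  exact D.interchange a b c d

theorem vId_vP {A B A' B' : D.Obj} {f : D.Hor A B} {u : D.Ver A A'} {v : D.Ver B B'}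
    {g : D.Hor A' B'} (s : D.Sq f u v g) (left : D.vc (D.v1 A) u = u)
    (right : D.vc (D.v1 B) v = v) : vP (D.vId f) s left right = s :=
  hId_hP (D := D.transpose) s left right

end Laws

end DoubleCat

namespace DoubleCat

section Laws

variable {D : DoubleCat.{u, v, w, x}}

theorem vP_vId {A B A' B' : D.Obj} {f : D.Hor A B} {u : D.Ver A A'} {v : D.Ver B B'}
    {g : D.Hor A' B'} (s : D.Sq f u v g) (left : D.vc u (D.v1 A') = u)
    (right : D.vc v (D.v1 B') = v) : vP s (D.vId g) left right = s :=
  hP_hId (D := D.transpose) s left right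

theorem vP_assoc {A B C E A' B' C' E' : D.Obj} {f₁ : D.Ver A B} {f₂ : D.Ver B C} {f₃ : D.Ver C E}
    {u₀ : D.Hor A A'} {u₁ : D.Hor B B'} {u₂ : D.Hor C C'} {u₃ : D.Hor E E'}
    {g₁ : D.Ver A' B'} {g₂ : D.Ver B' C'} {g₃ : D.Ver C' E'}
    {f₁₂ : D.Ver A C} {f₂₃ : D.Ver B E} {f : D.Ver A E}
    {g₁₂ : D.Ver A' C'} {g₂₃ : D.Ver B' E'} {g : D.Ver A' E'}
    (s : D.Sq u₀ f₁ g₁ u₁) (t : D.Sq u₁ f₂ g₂ u₂) (r : D.Sq u₂ f₃ g₃ u₃)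
    (h1 : D.vc f₁ f₂ = f₁₂) (h2 : D.vc g₁ g₂ = g₁₂) (h3 : D.vc f₁₂ f₃ = f) (h4 : D.vc g₁₂ g₃ = g)
    (h5 : D.vc f₂ f₃ = f₂₃) (h6 : D.vc g₂ g₃ = g₂₃) (h7 : D.vc f₁ f₂₃ = f)
    (h8 : D.vc g₁ g₂₃ = g) :
    vP (vP s t h1 h2) r h3 h4 = vP s (vP t r h5 h6) h7 h8 :=
  hP_assoc (D := D.transpose) s t r h1 h2 h3 h4 h5 h6 h7 h8

theorem hId_vP {A B C : D.Obj} {f : D.Ver A B} {g : D.Ver B C} {k : D.Ver A C}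
    (h1 : D.vc f g = k) (h2 : D.vc f g = k) : vP (D.hId f) (D.hId g) h1 h2 = D.hId k :=
  vId_hP (D := D.transpose) h1 h2

end Laws

end DoubleCat

namespace DoublePsFunctor

open DoubleCat

variable {𝒜 ℬ 𝒞 : DoubleCat.{u, v, w, x}} (G : DoublePsFunctor 𝒜 ℬ)

/-- `F_{gf}`, with a name for the composite of `f` and `g`. -/
def hC {A B C : 𝒜.Obj} (f : 𝒜.Hor A B) (g : 𝒜.Hor B C) {k : 𝒜.Hor A C} (e : 𝒜.hc f g = k) :
    ℬ.HorIso (G.mapH k) (ℬ.hc (G.mapH f) (G.mapH g)) :=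
  e ▸ G.hComp f g

/-- `F^{vu}`, with a name for the composite of `u` and `v`. -/
def vC {A B C : 𝒜.Obj} (u : 𝒜.Ver A B) (v : 𝒜.Ver B C) {k : 𝒜.Ver A C} (e : 𝒜.vc u v = k) :
    ℬ.VerIso (ℬ.vc (G.mapV u) (G.mapV v)) (G.mapV k) :=
  e ▸ G.vComp u v

theorem hC_nat {A B C A' B' C' : 𝒜.Obj} {f : 𝒜.Hor A B} {f' : 𝒜.Hor B C}
    {u : 𝒜.Ver A A'} {v : 𝒜.Ver B B'} {w : 𝒜.Ver C C'} {g : 𝒜.Hor A' B'} {g' : 𝒜.Hor B' C'}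
    {k : 𝒜.Hor A C} {l : 𝒜.Hor A' C'}
    (a : 𝒜.Sq f u v g) (b : 𝒜.Sq f' v w g') (h1 : 𝒜.hc f f' = k) (h2 : 𝒜.hc g g' = l) :
    ((G.hC f f' h1).hom ▤ (G.mapSq a ▥ G.mapSq b) : ℬ.Sq _ (G.mapV u) (G.mapV w) _) =
      G.mapSq (hP a b h1 h2) ▤ (G.hC g g' h2).hom := by
  subst h1 h2
  exact G.hComp_nat a b

theorem vC_nat {A B A' B' A'' B'' : 𝒜.Obj} {f : 𝒜.Hor A B} {g : 𝒜.Hor A' B'}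
    {h : 𝒜.Hor A'' B''} {u : 𝒜.Ver A A'} {v : 𝒜.Ver B B'} {u' : 𝒜.Ver A' A''}
    {v' : 𝒜.Ver B' B''} {k : 𝒜.Ver A A''} {l : 𝒜.Ver B B''}
    (a : 𝒜.Sq f u v g) (b : 𝒜.Sq g u' v' h) (h1 : 𝒜.vc u u' = k) (h2 : 𝒜.vc v v' = l) :
    ((G.mapSq a ▤ G.mapSq b) ▥ (G.vC v v' h2).hom : ℬ.Sq (G.mapH f) _ _ (G.mapH h)) =
      (G.vC u u' h1).hom ▥ G.mapSq (vP a b h1 h2) := by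
  subst h1 h2
  exact G.vComp_nat a b

theorem h1_hC_heq {A B : 𝒜.Obj} (f : 𝒜.Hor A B) {k : 𝒜.Hor A B} (e : 𝒜.hc (𝒜.h1 A) f = k) :
    HEq ((G.hC (𝒜.h1 A) f e).hom ▤ ((G.hUnit A).hom ▥ ℬ.vId (G.mapH f)) :
        ℬ.Sq _ (ℬ.v1 _) (ℬ.v1 _) (G.mapH f)) (ℬ.vId (G.mapH f)) := by
  subst e; exact G.h1_hComp f

theorem hC_h1_heq {A B : 𝒜.Obj} (f : 𝒜.Hor A B) {k : 𝒜.Hor A B} (e : 𝒜.hc f (𝒜.h1 B) = k) :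
    HEq ((G.hC f (𝒜.h1 B) e).hom ▤ (ℬ.vId (G.mapH f) ▥ (G.hUnit B).hom) :
        ℬ.Sq _ (ℬ.v1 _) (ℬ.v1 _) (G.mapH f)) (ℬ.vId (G.mapH f)) := by
  subst e; exact G.hComp_h1 f

theorem v1_vC_heq {A B : 𝒜.Obj} (u : 𝒜.Ver A B) {k : 𝒜.Ver A B} (e : 𝒜.vc (𝒜.v1 A) u = k) :
    HEq (((G.vUnit A).hom ▤ ℬ.hId (G.mapV u)) ▥ (G.vC (𝒜.v1 A) u e).hom :
        ℬ.Sq (ℬ.h1 _) (G.mapV u) _ (ℬ.h1 _)) (ℬ.hId (G.mapV u)) := by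
  subst e; exact G.v1_vComp u

theorem vC_v1_heq {A B : 𝒜.Obj} (u : 𝒜.Ver A B) {k : 𝒜.Ver A B} (e : 𝒜.vc u (𝒜.v1 B) = k) :
    HEq ((ℬ.hId (G.mapV u) ▤ (G.vUnit B).hom) ▥ (G.vC u (𝒜.v1 B) e).hom :
        ℬ.Sq (ℬ.h1 _) (G.mapV u) _ (ℬ.h1 _)) (ℬ.hId (G.mapV u)) := by
  subst e; exact G.vComp_v1 u

theorem hC_assoc {A B C D : 𝒜.Obj} (f : 𝒜.Hor A B) (g : 𝒜.Hor B C) (h : 𝒜.Hor C D)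
    {fg : 𝒜.Hor A C} {gh : 𝒜.Hor B D} {k : 𝒜.Hor A D} (e1 : 𝒜.hc f g = fg) (e2 : 𝒜.hc g h = gh)
    (e3 : 𝒜.hc f gh = k) (e4 : 𝒜.hc fg h = k) :
    ((G.hC f gh e3).hom ▤ (ℬ.vId (G.mapH f) ▥ (G.hC g h e2).hom) :
        ℬ.Sq _ (ℬ.v1 _) (ℬ.v1 _) (ℬ.hc (G.mapH f) (ℬ.hc (G.mapH g) (G.mapH h)))) =
      (G.hC fg h e4).hom ▤ ((G.hC f g e1).hom ▥ ℬ.vId (G.mapH h)) := by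
  subst e1 e2 e3
  refine eq_of_heq ((G.hComp_assoc f g h).trans ?_)
  have key : ∀ (k : 𝒜.Hor A D) (e : 𝒜.hc (𝒜.hc f g) h = k) (l : ℬ.Hor (G.obj A) (G.obj D))
      (e' : ℬ.hc (ℬ.hc (G.mapH f) (G.mapH g)) (G.mapH h) = l),
      HEq ((G.hComp (𝒜.hc f g) h).hom ▤ ((G.hComp f g).hom ▥ ℬ.vId (G.mapH h)) :
        ℬ.Sq _ (ℬ.v1 _) (ℬ.v1 _) (ℬ.hc (ℬ.hc (G.mapH f) (G.mapH g)) (G.mapH h)))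
      ((G.hC (𝒜.hc f g) h e).hom ▤ (hP (G.hComp f g).hom (ℬ.vId (G.mapH h)) rfl e') :
        ℬ.Sq _ (ℬ.v1 _) (ℬ.v1 _) l) := by
    intro k e l e'
    subst e e'
    exact HEq.rfl
  exact key _ e4 _ _

theorem vC_assoc {A B C D : 𝒜.Obj} (u : 𝒜.Ver A B) (v : 𝒜.Ver B C) (w : 𝒜.Ver C D)
    {uv : 𝒜.Ver A C} {vw : 𝒜.Ver B D} {k : 𝒜.Ver A D} (e1 : 𝒜.vc u v = uv) (e2 : 𝒜.vc v w = vw)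
    (e3 : 𝒜.vc u vw = k) (e4 : 𝒜.vc uv w = k) :
    ((ℬ.hId (G.mapV u) ▤ (G.vC v w e2).hom) ▥ (G.vC u vw e3).hom :
        ℬ.Sq (ℬ.h1 _) (ℬ.vc (G.mapV u) (ℬ.vc (G.mapV v) (G.mapV w))) _ (ℬ.h1 _)) =
      ((G.vC u v e1).hom ▤ ℬ.hId (G.mapV w)) ▥ (G.vC uv w e4).hom := by
  subst e1 e2 e3
  refine eq_of_heq ((G.vComp_assoc u v w).trans ?_)
  have key : ∀ (k : 𝒜.Ver A D) (e : 𝒜.vc (𝒜.vc u v) w = k) (l : ℬ.Ver (G.obj A) (G.obj D))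
      (e' : ℬ.vc (ℬ.vc (G.mapV u) (G.mapV v)) (G.mapV w) = l),
      HEq (((G.vComp u v).hom ▤ ℬ.hId (G.mapV w)) ▥ (G.vComp (𝒜.vc u v) w).hom :
        ℬ.Sq (ℬ.h1 _) (ℬ.vc (ℬ.vc (G.mapV u) (G.mapV v)) (G.mapV w)) _ (ℬ.h1 _))
      (hP (vP (G.vComp u v).hom (ℬ.hId (G.mapV w)) e' rfl) (G.vC (𝒜.vc u v) w e).hom :
        ℬ.Sq (ℬ.h1 _) l _ (ℬ.h1 _)) := by
    intro k e l e'
    subst e e'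
    exact HEq.rfl
  exact key _ e4 _ _

/-- The effect of `F` on 2-cells whose left and right sides are identities. -/
def mapHorCell {A B : 𝒜.Obj} {f g : 𝒜.Hor A B} (s : 𝒜.Sq f (𝒜.v1 A) (𝒜.v1 B) g) :
    ℬ.Sq (G.mapH f) (ℬ.v1 (G.obj A)) (ℬ.v1 (G.obj B)) (G.mapH g) :=
  ((G.vUnit A).hom ▥ G.mapSq s : ℬ.Sq (G.mapH f) _ _ (G.mapH g)) ▥ (G.vUnit B).inv

/-- The effect of `F` on 2-cells whose top and bottom sides are identities. -/
def mapVerCell {A B : 𝒜.Obj} {u v : 𝒜.Ver A B} (s : 𝒜.Sq (𝒜.h1 A) u v (𝒜.h1 B)) :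
    ℬ.Sq (ℬ.h1 (G.obj A)) (G.mapV u) (G.mapV v) (ℬ.h1 (G.obj B)) :=
  ((G.hUnit A).inv ▤ G.mapSq s : ℬ.Sq _ (G.mapV u) (G.mapV v) _) ▤ (G.hUnit B).hom

end DoublePsFunctor

namespace DoublePsFunctor

open DoubleCat

variable {𝒜 ℬ 𝒞 : DoubleCat.{u, v, w, x}} (G : DoublePsFunctor 𝒜 ℬ)

theorem vUnit_inv_vP {A B : 𝒜.Obj} (u : 𝒜.Ver A B) (e : 𝒜.vc (𝒜.v1 A) u = u) :
    ((G.vUnit A).inv ▤ ℬ.hId (G.mapV u) : ℬ.Sq (ℬ.h1 _) _ (G.mapV u) _) =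
      (G.vC (𝒜.v1 A) u e).hom := by
  have h := eq_of_heq (G.v1_vC_heq u e)
  rw [← hP_hId ((G.vUnit A).inv ▤ ℬ.hId (G.mapV u)) (ℬ.hc_h1 _) (ℬ.hc_h1 _)]
  conv_lhs => arg 2; rw [← h]
  rw [← hP_assoc _ _ _ (ℬ.hc_h1 _) (ℬ.hc_h1 _) (ℬ.hc_h1 _) (ℬ.hc_h1 _),
    ← interchangeP _ _ _ _ (ℬ.hc_h1 _) (ℬ.hc_h1 _) (ℬ.hc_h1 _) rfl (ℬ.v1_vc _) rfl,
    VerIso.inv_hom, hP_hId, hId_vP, hId_hP]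

theorem vUnit_inv_vP' {A B : 𝒜.Obj} (u : 𝒜.Ver A B) (e : 𝒜.vc u (𝒜.v1 B) = u) :
    (ℬ.hId (G.mapV u) ▤ (G.vUnit B).inv : ℬ.Sq (ℬ.h1 _) _ (G.mapV u) _) =
      (G.vC u (𝒜.v1 B) e).hom := by
  have h := eq_of_heq (G.vC_v1_heq u e)
  rw [← hP_hId (ℬ.hId (G.mapV u) ▤ (G.vUnit B).inv) (ℬ.hc_h1 _) (ℬ.hc_h1 _)]
  conv_lhs => arg 2; rw [← h]
  rw [← hP_assoc _ _ _ (ℬ.hc_h1 _) (ℬ.hc_h1 _) (ℬ.hc_h1 _) (ℬ.hc_h1 _),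
    ← interchangeP _ _ _ _ (ℬ.hc_h1 _) (ℬ.hc_h1 _) (ℬ.hc_h1 _) rfl (ℬ.vc_v1 _) rfl,
    VerIso.inv_hom, hP_hId, hId_vP, hId_hP]

theorem mapSq_vP_top {A B A' B' : 𝒜.Obj} {f' f : 𝒜.Hor A B} {u : 𝒜.Ver A A'} {v : 𝒜.Ver B B'}
    {g : 𝒜.Hor A' B'} (a : 𝒜.Sq f' (𝒜.v1 A) (𝒜.v1 B) f) (s : 𝒜.Sq f u v g)
    (h1 : 𝒜.vc (𝒜.v1 A) u = u) (h2 : 𝒜.vc (𝒜.v1 B) v = v) :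
    G.mapSq (vP a s h1 h2) = (G.mapHorCell a ▤ G.mapSq s : ℬ.Sq _ (G.mapV u) (G.mapV v) _) := by
  have e1 : (G.mapHorCell a ▤ G.mapSq s : ℬ.Sq _ (G.mapV u) (G.mapV v) _) =
      ((((G.vUnit A).hom ▥ G.mapSq a : ℬ.Sq (G.mapH f') _ _ (G.mapH f)) ▥ (G.vUnit B).inv :
        ℬ.Sq (G.mapH f') _ _ (G.mapH f))) ▤
        ((ℬ.hId (G.mapV u) ▥ G.mapSq s : ℬ.Sq (G.mapH f) _ _ (G.mapH g)) ▥ ℬ.hId (G.mapV v) :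
        ℬ.Sq (G.mapH f) _ _ (G.mapH g)) := by
    rw [hP_hId, hId_hP]; rfl
  have h := eq_of_heq (G.v1_vC_heq u h1)
  rw [e1, interchangeP _ _ _ _ _ _ _ (ℬ.v1_vc _) rfl (ℬ.v1_vc _),
    interchangeP _ _ _ _ _ _ _ (ℬ.v1_vc _) rfl rfl, G.vUnit_inv_vP _ h2,
    hP_assoc _ _ _ _ _ _ _ (ℬ.hc_h1 _) (ℬ.hc_h1 _) (ℬ.h1_hc _) (ℬ.h1_hc _),
    G.vC_nat a s h1 h2, ← hP_assoc _ _ _ (ℬ.hc_h1 _) (ℬ.hc_h1 _) (ℬ.h1_hc _) (ℬ.h1_hc _), h,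
    hId_hP]

theorem mapSq_vP_bot {A B A' B' : 𝒜.Obj} {g' f : 𝒜.Hor A B} {u : 𝒜.Ver A' A} {v : 𝒜.Ver B' B}
    {g : 𝒜.Hor A' B'} (s : 𝒜.Sq g u v f) (a : 𝒜.Sq f (𝒜.v1 A) (𝒜.v1 B) g')
    (h1 : 𝒜.vc u (𝒜.v1 A) = u) (h2 : 𝒜.vc v (𝒜.v1 B) = v) :
    G.mapSq (vP s a h1 h2) = (G.mapSq s ▤ G.mapHorCell a : ℬ.Sq _ (G.mapV u) (G.mapV v) _) := by
  have e1 : (G.mapSq s ▤ G.mapHorCell a : ℬ.Sq _ (G.mapV u) (G.mapV v) _) =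
      ((ℬ.hId (G.mapV u) ▥ G.mapSq s : ℬ.Sq (G.mapH g) _ _ (G.mapH f)) ▥ ℬ.hId (G.mapV v) :
        ℬ.Sq (G.mapH g) _ _ (G.mapH f)) ▤
      ((((G.vUnit A).hom ▥ G.mapSq a : ℬ.Sq (G.mapH f) _ _ (G.mapH g')) ▥ (G.vUnit B).inv :
        ℬ.Sq (G.mapH f) _ _ (G.mapH g'))) := by
    rw [hP_hId, hId_hP]; rfl
  have h := eq_of_heq (G.vC_v1_heq u h1)
  rw [e1, interchangeP _ _ _ _ _ _ _ (ℬ.vc_v1 _) rfl (ℬ.vc_v1 _),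
    interchangeP _ _ _ _ _ _ _ (ℬ.vc_v1 _) rfl rfl, G.vUnit_inv_vP' _ h2,
    hP_assoc _ _ _ _ _ _ _ (ℬ.hc_h1 _) (ℬ.hc_h1 _) (ℬ.h1_hc _) (ℬ.h1_hc _),
    G.vC_nat s a h1 h2, ← hP_assoc _ _ _ (ℬ.hc_h1 _) (ℬ.hc_h1 _) (ℬ.h1_hc _) (ℬ.h1_hc _), h,
    hId_hP]

theorem hUnit_inv_hP {A B : 𝒜.Obj} (f : 𝒜.Hor A B) (e : 𝒜.hc (𝒜.h1 A) f = f) :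
    ((G.hUnit A).inv ▥ ℬ.vId (G.mapH f) : ℬ.Sq (G.mapH f) (ℬ.v1 _) (ℬ.v1 _) _) =
      (G.hC (𝒜.h1 A) f e).hom := by
  have h := eq_of_heq (G.h1_hC_heq f e)
  rw [← vId_vP ((G.hUnit A).inv ▥ ℬ.vId (G.mapH f)) (ℬ.vc_v1 _) (ℬ.vc_v1 _)]
  conv_lhs => arg 1; rw [← h]
  rw [vP_assoc _ _ _ _ _ _ _ (ℬ.vc_v1 _) (ℬ.vc_v1 _) (ℬ.vc_v1 _) (ℬ.vc_v1 _),
    interchangeP _ _ _ _ _ _ rfl (ℬ.vc_v1 _) (ℬ.vc_v1 _) (ℬ.vc_v1 _),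
    HorIso.hom_inv, vP_vId, vId_hP, vP_vId]

theorem hUnit_inv_hP' {A B : 𝒜.Obj} (f : 𝒜.Hor A B) (e : 𝒜.hc f (𝒜.h1 B) = f) :
    (ℬ.vId (G.mapH f) ▥ (G.hUnit B).inv : ℬ.Sq (G.mapH f) (ℬ.v1 _) (ℬ.v1 _) _) =
      (G.hC f (𝒜.h1 B) e).hom := by
  have h := eq_of_heq (G.hC_h1_heq f e)
  rw [← vId_vP (ℬ.vId (G.mapH f) ▥ (G.hUnit B).inv) (ℬ.vc_v1 _) (ℬ.vc_v1 _)]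
  conv_lhs => arg 1; rw [← h]
  rw [vP_assoc _ _ _ _ _ _ _ (ℬ.vc_v1 _) (ℬ.vc_v1 _) (ℬ.vc_v1 _) (ℬ.vc_v1 _),
    interchangeP _ _ _ _ _ _ rfl (ℬ.vc_v1 _) (ℬ.vc_v1 _) (ℬ.vc_v1 _),
    HorIso.hom_inv, vP_vId, vId_hP, vP_vId]

theorem mapSq_hP_left {A B A' B' : 𝒜.Obj} {f : 𝒜.Hor A B} {u' u : 𝒜.Ver A A'} {v : 𝒜.Ver B B'}
    {g : 𝒜.Hor A' B'} (a : 𝒜.Sq (𝒜.h1 A) u' u (𝒜.h1 A')) (s : 𝒜.Sq f u v g)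
    (h1 : 𝒜.hc (𝒜.h1 A) f = f) (h2 : 𝒜.hc (𝒜.h1 A') g = g) :
    G.mapSq (hP a s h1 h2) = (G.mapVerCell a ▥ G.mapSq s : ℬ.Sq (G.mapH f) _ _ (G.mapH g)) := by
  have e1 : (G.mapVerCell a ▥ G.mapSq s : ℬ.Sq (G.mapH f) _ _ (G.mapH g)) =
      (((G.hUnit A).inv ▤ G.mapSq a : ℬ.Sq _ (G.mapV u') (G.mapV u) _) ▤ (G.hUnit A').hom :
        ℬ.Sq _ (G.mapV u') (G.mapV u) _) ▥
        ((ℬ.vId (G.mapH f) ▤ G.mapSq s : ℬ.Sq _ (G.mapV u) (G.mapV v) _) ▤ ℬ.vId (G.mapH g) :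
        ℬ.Sq _ (G.mapV u) (G.mapV v) _) := by
    rw [vP_vId, vId_vP]; rfl
  have h := eq_of_heq (G.h1_hC_heq g h2)
  rw [e1, ← interchangeP _ _ _ _ _ rfl (ℬ.h1_hc _) _ _ _,
    ← interchangeP _ _ _ _ (ℬ.h1_hc _) rfl rfl _ _ _, G.hUnit_inv_hP _ h1,
    G.hC_nat a s h1 h2, vP_assoc _ _ _ _ _ _ _ (ℬ.vc_v1 _) (ℬ.vc_v1 _) (ℬ.vc_v1 _) (ℬ.vc_v1 _),
    h, vP_vId]

theorem mapSq_hP_right {A B A' B' : 𝒜.Obj} {f : 𝒜.Hor A B} {v' v : 𝒜.Ver B B'} {u : 𝒜.Ver A A'}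
    {g : 𝒜.Hor A' B'} (s : 𝒜.Sq f u v g) (a : 𝒜.Sq (𝒜.h1 B) v v' (𝒜.h1 B'))
    (h1 : 𝒜.hc f (𝒜.h1 B) = f) (h2 : 𝒜.hc g (𝒜.h1 B') = g) :
    G.mapSq (hP s a h1 h2) = (G.mapSq s ▥ G.mapVerCell a : ℬ.Sq (G.mapH f) _ _ (G.mapH g)) := by
  have e1 : (G.mapSq s ▥ G.mapVerCell a : ℬ.Sq (G.mapH f) _ _ (G.mapH g)) =
      ((ℬ.vId (G.mapH f) ▤ G.mapSq s : ℬ.Sq _ (G.mapV u) (G.mapV v) _) ▤ ℬ.vId (G.mapH g) :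
        ℬ.Sq _ (G.mapV u) (G.mapV v) _) ▥
      (((G.hUnit B).inv ▤ G.mapSq a : ℬ.Sq _ (G.mapV v) (G.mapV v') _) ▤ (G.hUnit B').hom :
        ℬ.Sq _ (G.mapV v) (G.mapV v') _) := by
    rw [vP_vId, vId_vP]; rfl
  have h := eq_of_heq (G.hC_h1_heq g h2)
  rw [e1, ← interchangeP _ _ _ _ _ rfl (ℬ.hc_h1 _) _ _ _,
    ← interchangeP _ _ _ _ (ℬ.hc_h1 _) rfl rfl _ _ _, G.hUnit_inv_hP' _ h1,
    G.hC_nat s a h1 h2, vP_assoc _ _ _ _ _ _ _ (ℬ.vc_v1 _) (ℬ.vc_v1 _) (ℬ.vc_v1 _) (ℬ.vc_v1 _),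
    h, vP_vId]

theorem hP_vP_of_v1 {D : DoubleCat.{u, v, w, x}} {A B A' B' : D.Obj} {f g : D.Hor A B}
    {h : D.Hor A' B'} {u' u : D.Ver A A'} {v : D.Ver B B'}
    (z : D.Sq (D.h1 A) u' u (D.h1 A')) (a : D.Sq f (D.v1 A) (D.v1 B) g) (s : D.Sq g u v h) :
    (z ▥ (a ▤ s : D.Sq f u v h) : D.Sq f u' v h) =
      (a ▤ (z ▥ s : D.Sq g u' v h) : D.Sq f u' v h) := by
  have e : (z ▥ (a ▤ s : D.Sq f u v h) : D.Sq f u' v h) =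
    ((D.vId (D.h1 A) ▤ z : D.Sq _ u' u _) ▥ (a ▤ s : D.Sq f u v h) : D.Sq f u' v h) := by
      rw [vId_vP]
  rw [e, ← interchangeP _ _ _ _ (D.h1_hc _) (D.h1_hc _) (D.h1_hc _) _ _ _]
  congr 1
  rw [D.vId_h1, hId_hP]

theorem vP_hP_of_v1 {D : DoubleCat.{u, v, w, x}} {A B A' B' : D.Obj} {f g : D.Hor A B}
    {h : D.Hor A' B'} {u : D.Ver A A'} {v v' : D.Ver B B'}
    (z : D.Sq (D.h1 B) v v' (D.h1 B')) (a : D.Sq f (D.v1 A) (D.v1 B) g) (s : D.Sq g u v h) :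
    ((a ▤ s : D.Sq f u v h) ▥ z : D.Sq f u v' h) =
      (a ▤ (s ▥ z : D.Sq g u v' h) : D.Sq f u v' h) := by
  have e : ((a ▤ s : D.Sq f u v h) ▥ z : D.Sq f u v' h) =
    ((a ▤ s : D.Sq f u v h) ▥ (D.vId (D.h1 B) ▤ z : D.Sq _ v v' _) : D.Sq f u v' h) := by
      rw [vId_vP]
  rw [e, ← interchangeP _ _ _ _ (D.hc_h1 _) (D.hc_h1 _) (D.hc_h1 _) _ _ _]
  congr 1
  rw [D.vId_h1, hP_hId]

theorem mapHorCell_vP {A B : 𝒜.Obj} {f g h : 𝒜.Hor A B} (a : 𝒜.Sq f (𝒜.v1 A) (𝒜.v1 B) g)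
    (b : 𝒜.Sq g (𝒜.v1 A) (𝒜.v1 B) h) :
    G.mapHorCell (a ▤ b) = G.mapHorCell a ▤ G.mapHorCell b := by
  rw [mapHorCell, mapSq_vP_top]
  erw [hP_vP_of_v1, vP_hP_of_v1]
  rfl

theorem mapHorCell_vId {A B : 𝒜.Obj} (f : 𝒜.Hor A B) :
    G.mapHorCell (𝒜.vId f) = ℬ.vId (G.mapH f) := by
  rw [mapHorCell, ← G.vUnit_nat, hP_assoc _ _ _ _ _ _ _ (ℬ.hc_h1 _) (ℬ.hc_h1 _) (ℬ.hc_h1 _)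
    (ℬ.hc_h1 _), VerIso.hom_inv, hP_hId]

theorem hP_vP_of_v1' {D : DoubleCat.{u, v, w, x}} {A B A' B' : D.Obj} {f g : D.Hor A' B'}
    {h : D.Hor A B} {u' u : D.Ver A A'} {v : D.Ver B B'}
    (z : D.Sq (D.h1 A) u' u (D.h1 A')) (s : D.Sq h u v f) (a : D.Sq f (D.v1 A') (D.v1 B') g) :
    (z ▥ (s ▤ a : D.Sq h u v g) : D.Sq h u' v g) =
      ((z ▥ s : D.Sq h u' v f) ▤ a : D.Sq h u' v g) := by
  have e : (z ▥ (s ▤ a : D.Sq h u v g) : D.Sq h u' v g) =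
    ((z ▤ D.vId (D.h1 A') : D.Sq _ u' u _) ▥ (s ▤ a : D.Sq h u v g) : D.Sq h u' v g) := by
      rw [vP_vId]
  rw [e, ← interchangeP _ _ _ _ (D.h1_hc _) (D.h1_hc _) (D.h1_hc _) _ _ _]
  congr 1
  rw [D.vId_h1, hId_hP]

theorem vP_hP_of_v1' {D : DoubleCat.{u, v, w, x}} {A B A' B' : D.Obj} {f g : D.Hor A' B'}
    {h : D.Hor A B} {u : D.Ver A A'} {v v' : D.Ver B B'}
    (z : D.Sq (D.h1 B) v v' (D.h1 B')) (s : D.Sq h u v f) (a : D.Sq f (D.v1 A') (D.v1 B') g) :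
    ((s ▤ a : D.Sq h u v g) ▥ z : D.Sq h u v' g) =
      ((s ▥ z : D.Sq h u v' f) ▤ a : D.Sq h u v' g) := by
  have e : ((s ▤ a : D.Sq h u v g) ▥ z : D.Sq h u v' g) =
    ((s ▤ a : D.Sq h u v g) ▥ (z ▤ D.vId (D.h1 B') : D.Sq _ v v' _) : D.Sq h u v' g) := by
      rw [vP_vId]
  rw [e, ← interchangeP _ _ _ _ (D.hc_h1 _) (D.hc_h1 _) (D.hc_h1 _) _ _ _]
  congr 1
  rw [D.vId_h1, hP_hId]

theorem vP_hP_of_h1 {D : DoubleCat.{u, v, w, x}} {A B A' B' : D.Obj} {f g : D.Ver A B}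
    {h : D.Ver A' B'} {u' u : D.Hor A A'} {v : D.Hor B B'}
    (z : D.Sq u' (D.v1 A) (D.v1 A') u) (a : D.Sq (D.h1 A) f g (D.h1 B)) (s : D.Sq u g h v) :
    (z ▤ (a ▥ s : D.Sq u f h v) : D.Sq u' f h v) =
      (a ▥ (z ▤ s : D.Sq u' g h v) : D.Sq u' f h v) :=
  hP_vP_of_v1 (D := D.transpose) z a s

theorem hP_vP_of_h1 {D : DoubleCat.{u, v, w, x}} {A B A' B' : D.Obj} {f g : D.Ver A B}
    {h : D.Ver A' B'} {u : D.Hor A A'} {v v' : D.Hor B B'}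
    (z : D.Sq v (D.v1 B) (D.v1 B') v') (a : D.Sq (D.h1 A) f g (D.h1 B)) (s : D.Sq u g h v) :
    ((a ▥ s : D.Sq u f h v) ▤ z : D.Sq u f h v') =
      (a ▥ (s ▤ z : D.Sq u g h v') : D.Sq u f h v') :=
  vP_hP_of_v1 (D := D.transpose) z a s

theorem vP_hP_of_h1' {D : DoubleCat.{u, v, w, x}} {A B A' B' : D.Obj} {f g : D.Ver A' B'}
    {h : D.Ver A B} {u' u : D.Hor A A'} {v : D.Hor B B'}
    (z : D.Sq u' (D.v1 A) (D.v1 A') u) (s : D.Sq u h f v) (a : D.Sq (D.h1 A') f g (D.h1 B')) :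
    (z ▤ (s ▥ a : D.Sq u h g v) : D.Sq u' h g v) =
      ((z ▤ s : D.Sq u' h f v) ▥ a : D.Sq u' h g v) :=
  hP_vP_of_v1' (D := D.transpose) z s a

theorem hP_vP_of_h1' {D : DoubleCat.{u, v, w, x}} {A B A' B' : D.Obj} {f g : D.Ver A' B'}
    {h : D.Ver A B} {u : D.Hor A A'} {v v' : D.Hor B B'}
    (z : D.Sq v (D.v1 B) (D.v1 B') v') (s : D.Sq u h f v) (a : D.Sq (D.h1 A') f g (D.h1 B')) :
    ((s ▥ a : D.Sq u h g v) ▤ z : D.Sq u h g v') =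
      ((s ▤ z : D.Sq u h f v') ▥ a : D.Sq u h g v') :=
  vP_hP_of_v1' (D := D.transpose) z s a

theorem mapHorCell_hP {A B C : 𝒜.Obj} {f g : 𝒜.Hor A B} {f' g' : 𝒜.Hor B C} {k l : 𝒜.Hor A C}
    (a : 𝒜.Sq f (𝒜.v1 A) (𝒜.v1 B) g) (b : 𝒜.Sq f' (𝒜.v1 B) (𝒜.v1 C) g')
    (h1 : 𝒜.hc f f' = k) (h2 : 𝒜.hc g g' = l) :
    ((G.hC f f' h1).hom ▤ (G.mapHorCell a ▥ G.mapHorCell b) : ℬ.Sq _ (ℬ.v1 _) (ℬ.v1 _) _) =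
      G.mapHorCell (hP a b h1 h2) ▤ (G.hC g g' h2).hom := by
  have e1 : (G.mapHorCell a ▥ G.mapHorCell b :
      ℬ.Sq (ℬ.hc (G.mapH f) (G.mapH f')) _ _ (ℬ.hc (G.mapH g) (G.mapH g'))) =
      ((G.vUnit A).hom ▥ (G.mapSq a ▥ G.mapSq b :
        ℬ.Sq (ℬ.hc (G.mapH f) (G.mapH f')) _ _ (ℬ.hc (G.mapH g) (G.mapH g'))) :
        ℬ.Sq (ℬ.hc (G.mapH f) (G.mapH f')) _ _ (ℬ.hc (G.mapH g) (G.mapH g'))) ▥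
        (G.vUnit C).inv := by
    rw [mapHorCell, mapHorCell, hP_assoc _ _ _ _ _ _ _ (ℬ.h1_hc _) (ℬ.h1_hc _) rfl rfl,
      ← hP_assoc (G.vUnit B).inv _ _ (ℬ.h1_hc _) (ℬ.h1_hc _) (ℬ.hc_h1 _) (ℬ.hc_h1 _) _ _ _ _,
      ← hP_assoc (G.vUnit B).inv _ _ (ℬ.h1_hc _) (ℬ.h1_hc _) (ℬ.h1_hc _) (ℬ.h1_hc _) _ _ _ _,
      VerIso.inv_hom, hId_hP,
      ← hP_assoc _ _ _ rfl rfl (by rw [ℬ.hc_h1]) (by rw [ℬ.hc_h1]) _ _ _ _,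
      hP_assoc (G.vUnit A).hom _ _ _ _ _ _ rfl rfl (ℬ.h1_hc _) (ℬ.h1_hc _)]
  rw [e1, ← vP_hP_of_v1, ← hP_vP_of_v1, G.hC_nat a b h1 h2, hP_vP_of_v1', vP_hP_of_v1']
  rfl

theorem mapVerCell_hP {A B : 𝒜.Obj} {u v w : 𝒜.Ver A B} (a : 𝒜.Sq (𝒜.h1 A) u v (𝒜.h1 B))
    (b : 𝒜.Sq (𝒜.h1 A) v w (𝒜.h1 B)) :
    G.mapVerCell (a ▥ b) = G.mapVerCell a ▥ G.mapVerCell b := by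
  rw [mapVerCell, mapSq_hP_left]
  erw [vP_hP_of_h1, hP_vP_of_h1]
  rfl

theorem mapVerCell_hId {A B : 𝒜.Obj} (u : 𝒜.Ver A B) :
    G.mapVerCell (𝒜.hId u) = ℬ.hId (G.mapV u) := by
  rw [mapVerCell, vP_assoc _ _ _ _ _ _ _ (ℬ.vc_v1 _) (ℬ.vc_v1 _) (ℬ.v1_vc _) (ℬ.v1_vc _),
    ← G.hUnit_nat, ← vP_assoc _ _ _ (ℬ.vc_v1 _) (ℬ.vc_v1 _) (ℬ.v1_vc _)
    (ℬ.v1_vc _), HorIso.inv_hom, vId_vP]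

theorem mapVerCell_vP {A B C : 𝒜.Obj} {f g : 𝒜.Ver A B} {f' g' : 𝒜.Ver B C} {k l : 𝒜.Ver A C}
    (a : 𝒜.Sq (𝒜.h1 A) f g (𝒜.h1 B)) (b : 𝒜.Sq (𝒜.h1 B) f' g' (𝒜.h1 C))
    (h1 : 𝒜.vc f f' = k) (h2 : 𝒜.vc g g' = l) :
    ((G.mapVerCell a ▤ G.mapVerCell b) ▥ (G.vC g g' h2).hom : ℬ.Sq (ℬ.h1 _) _ _ (ℬ.h1 _)) =
      (G.vC f f' h1).hom ▥ G.mapVerCell (vP a b h1 h2) := by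
  have e1 : (G.mapVerCell a ▤ G.mapVerCell b :
      ℬ.Sq _ (ℬ.vc (G.mapV f) (G.mapV f')) (ℬ.vc (G.mapV g) (G.mapV g')) _) =
      ((G.hUnit A).inv ▤ (G.mapSq a ▤ G.mapSq b :
        ℬ.Sq _ (ℬ.vc (G.mapV f) (G.mapV f')) (ℬ.vc (G.mapV g) (G.mapV g')) _) :
        ℬ.Sq _ (ℬ.vc (G.mapV f) (G.mapV f')) (ℬ.vc (G.mapV g) (G.mapV g')) _) ▤
        (G.hUnit C).hom := by
    rw [mapVerCell, mapVerCell, vP_assoc _ _ _ _ _ _ _ (ℬ.v1_vc _) (ℬ.v1_vc _) rfl rfl,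
      ← vP_assoc (G.hUnit B).hom _ _ (ℬ.v1_vc _) (ℬ.v1_vc _) (ℬ.vc_v1 _) (ℬ.vc_v1 _) _ _ _ _,
      ← vP_assoc (G.hUnit B).hom _ _ (ℬ.v1_vc _) (ℬ.v1_vc _) (ℬ.v1_vc _) (ℬ.v1_vc _) _ _ _ _,
      HorIso.hom_inv, vId_vP,
      ← vP_assoc _ _ _ rfl rfl (by rw [ℬ.vc_v1]) (by rw [ℬ.vc_v1]) _ _ _ _,
      vP_assoc (G.hUnit A).inv _ _ _ _ _ _ rfl rfl (ℬ.v1_vc _) (ℬ.v1_vc _)]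
  rw [e1]
  rw [← hP_vP_of_h1', ← vP_hP_of_h1', G.vC_nat a b h1 h2, vP_hP_of_h1, hP_vP_of_h1]
  rfl

/-- The image of a vertically invertible 2-cell. -/
def mapHorIso {A B : 𝒜.Obj} {f g : 𝒜.Hor A B} (s : 𝒜.HorIso f g) :
    ℬ.HorIso (G.mapH f) (G.mapH g) where
  hom := G.mapHorCell s.hom
  inv := G.mapHorCell s.inv
  hom_inv := by rw [← mapHorCell_vP, s.hom_inv, mapHorCell_vId]
  inv_hom := by rw [← mapHorCell_vP, s.inv_hom, mapHorCell_vId]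

/-- The image of a horizontally invertible 2-cell. -/
def mapVerIso {A B : 𝒜.Obj} {u v : 𝒜.Ver A B} (s : 𝒜.VerIso u v) :
    ℬ.VerIso (G.mapV u) (G.mapV v) where
  hom := G.mapVerCell s.hom
  inv := G.mapVerCell s.inv
  hom_inv := by rw [← mapVerCell_hP, s.hom_inv, mapVerCell_hId]
  inv_hom := by rw [← mapVerCell_hP, s.inv_hom, mapVerCell_hId]

end DoublePsFunctor

namespace DoubleCat

/-- Composition of vertically invertible 2-cells. -/
def HorIso.trans {D : DoubleCat.{u, v, w, x}} {A B : D.Obj} {f g h : D.Hor A B}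
    (s : D.HorIso f g) (t : D.HorIso g h) : D.HorIso f h where
  hom := s.hom ▤ t.hom
  inv := t.inv ▤ s.inv
  hom_inv := by
    rw [vP_assoc _ _ _ _ _ _ _ (D.vc_v1 _) (D.vc_v1 _) (D.vc_v1 _) (D.vc_v1 _),
      ← vP_assoc t.hom _ _ (D.vc_v1 _) (D.vc_v1 _) (D.vc_v1 _) (D.vc_v1 _), t.hom_inv, vId_vP,
      s.hom_inv]
  inv_hom := by
    rw [vP_assoc _ _ _ _ _ _ _ (D.vc_v1 _) (D.vc_v1 _) (D.vc_v1 _) (D.vc_v1 _),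
      ← vP_assoc s.inv _ _ (D.vc_v1 _) (D.vc_v1 _) (D.vc_v1 _) (D.vc_v1 _), s.inv_hom, vId_vP,
      t.inv_hom]

/-- Composition of horizontally invertible 2-cells. -/
def VerIso.trans {D : DoubleCat.{u, v, w, x}} {A B : D.Obj} {f g h : D.Ver A B}
    (s : D.VerIso f g) (t : D.VerIso g h) : D.VerIso f h where
  hom := s.hom ▥ t.hom
  inv := t.inv ▥ s.inv
  hom_inv := by
    rw [hP_assoc _ _ _ _ _ _ _ (D.hc_h1 _) (D.hc_h1 _) (D.hc_h1 _) (D.hc_h1 _),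
      ← hP_assoc t.hom _ _ (D.hc_h1 _) (D.hc_h1 _) (D.hc_h1 _) (D.hc_h1 _), t.hom_inv, hId_hP,
      s.hom_inv]
  inv_hom := by
    rw [hP_assoc _ _ _ _ _ _ _ (D.hc_h1 _) (D.hc_h1 _) (D.hc_h1 _) (D.hc_h1 _),
      ← hP_assoc s.inv _ _ (D.hc_h1 _) (D.hc_h1 _) (D.hc_h1 _) (D.hc_h1 _), s.inv_hom, hId_hP,
      t.inv_hom]

end DoubleCat

namespace DoublePsFunctor

open DoubleCat

variable {𝒜 ℬ 𝒞 : DoubleCat.{u, v, w, x}} (F : DoublePsFunctor 𝒜 ℬ) (G : DoublePsFunctor ℬ 𝒞)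

/-- `(GF)_{gf}` -/
def compH {A B C : 𝒜.Obj} (f : 𝒜.Hor A B) (g : 𝒜.Hor B C) {k : 𝒜.Hor A C} (e : 𝒜.hc f g = k) :
    𝒞.HorIso (G.mapH (F.mapH k)) (𝒞.hc (G.mapH (F.mapH f)) (G.mapH (F.mapH g))) :=
  (G.mapHorIso (F.hC f g e)).trans (G.hComp (F.mapH f) (F.mapH g))

/-- `(GF)^{vu}` -/
def compV {A B C : 𝒜.Obj} (u : 𝒜.Ver A B) (v : 𝒜.Ver B C) {k : 𝒜.Ver A C} (e : 𝒜.vc u v = k) :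
    𝒞.VerIso (𝒞.vc (G.mapV (F.mapV u)) (G.mapV (F.mapV v))) (G.mapV (F.mapV k)) :=
  (G.vComp (F.mapV u) (F.mapV v)).trans (G.mapVerIso (F.vC u v e))

theorem compH_left {A B C D : 𝒜.Obj} (f : 𝒜.Hor A B) (g : 𝒜.Hor B C) (h : 𝒜.Hor C D)
    {gh : 𝒜.Hor B D} {k : 𝒜.Hor A D} (e2 : 𝒜.hc g h = gh) (e3 : 𝒜.hc f gh = k) :
    ((compH F G f gh e3).hom ▤ (𝒞.vId (G.mapH (F.mapH f)) ▥ (compH F G g h e2).hom) :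
        𝒞.Sq _ (𝒞.v1 _) (𝒞.v1 _) (𝒞.hc _ (𝒞.hc _ _))) =
      G.mapHorCell ((F.hC f gh e3).hom ▤ (ℬ.vId (F.mapH f) ▥ (F.hC g h e2).hom)) ▤
        ((G.hC (F.mapH f) (ℬ.hc (F.mapH g) (F.mapH h)) rfl).hom ▤
          (𝒞.vId (G.mapH (F.mapH f)) ▥ (G.hC (F.mapH g) (F.mapH h) rfl).hom) :
          𝒞.Sq _ (𝒞.v1 _) (𝒞.v1 _) (𝒞.hc _ (𝒞.hc _ _))) := by
  have e := G.mapHorCell_hP (ℬ.vId (F.mapH f)) (F.hC g h e2).hom rfl rfl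
  rw [G.mapHorCell_vId] at e
  have e' : (𝒞.vId (G.mapH (F.mapH f)) ▥ (compH F G g h e2).hom :
      𝒞.Sq _ (𝒞.v1 _) (𝒞.v1 _) (𝒞.hc _ (𝒞.hc _ _))) =
      (𝒞.vId (G.mapH (F.mapH f)) ▥ G.mapHorCell (F.hC g h e2).hom :
        𝒞.Sq _ (𝒞.v1 _) (𝒞.v1 _) (𝒞.hc _ _)) ▤
      (𝒞.vId (G.mapH (F.mapH f)) ▥ (G.hC (F.mapH g) (F.mapH h) rfl).hom) := by
    rw [interchangeP _ _ _ _ _ _ _ _ (𝒞.v1_vc _), vId_vP]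
    rfl
  rw [e', mapHorCell_vP, vP_assoc (G.mapHorCell _) _ _ _ _ _ _ (𝒞.v1_vc _) (𝒞.v1_vc _),
    ← vP_assoc (G.mapHorCell (_ ▥ _)) _ _ (𝒞.v1_vc _) (𝒞.v1_vc _) (𝒞.v1_vc _) (𝒞.v1_vc _), ← e]
  change vP (vP (G.mapHorCell _) (G.hC _ _ rfl).hom) _ = _
  rw [vP_assoc (G.mapHorCell _) _ _ _ _ _ _ (𝒞.v1_vc _) (𝒞.v1_vc _) (𝒞.v1_vc _) (𝒞.v1_vc _),
    ← vP_assoc (G.hC _ _ rfl).hom _ _ (𝒞.v1_vc _) (𝒞.v1_vc _) (𝒞.v1_vc _) (𝒞.v1_vc _)]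

theorem compH_right {A B C D : 𝒜.Obj} (f : 𝒜.Hor A B) (g : 𝒜.Hor B C) (h : 𝒜.Hor C D)
    {fg : 𝒜.Hor A C} {k : 𝒜.Hor A D} (e1 : 𝒜.hc f g = fg) (e4 : 𝒜.hc fg h = k) :
    ((compH F G fg h e4).hom ▤ ((compH F G f g e1).hom ▥ 𝒞.vId (G.mapH (F.mapH h))) :
        𝒞.Sq _ (𝒞.v1 _) (𝒞.v1 _)
          (𝒞.hc (G.mapH (F.mapH f)) (𝒞.hc (G.mapH (F.mapH g)) (G.mapH (F.mapH h))))) =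
      G.mapHorCell ((F.hC fg h e4).hom ▤ ((F.hC f g e1).hom ▥ ℬ.vId (F.mapH h)) :
        ℬ.Sq _ (ℬ.v1 _) (ℬ.v1 _)
          (ℬ.hc (F.mapH f) (ℬ.hc (F.mapH g) (F.mapH h)))) ▤
        ((G.hC (ℬ.hc (F.mapH f) (F.mapH g)) (F.mapH h) (ℬ.hc_assoc _ _ _)).hom ▤
          ((G.hC (F.mapH f) (F.mapH g) rfl).hom ▥ 𝒞.vId (G.mapH (F.mapH h))) :
          𝒞.Sq _ (𝒞.v1 _) (𝒞.v1 _)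
          (𝒞.hc (G.mapH (F.mapH f)) (𝒞.hc (G.mapH (F.mapH g)) (G.mapH (F.mapH h))))) := by
  have e := G.mapHorCell_hP (F.hC f g e1).hom (ℬ.vId (F.mapH h)) rfl (ℬ.hc_assoc _ _ _)
  rw [G.mapHorCell_vId] at e
  have e' : ((compH F G f g e1).hom ▥ 𝒞.vId (G.mapH (F.mapH h)) :
      𝒞.Sq _ (𝒞.v1 _) (𝒞.v1 _)
          (𝒞.hc (G.mapH (F.mapH f)) (𝒞.hc (G.mapH (F.mapH g)) (G.mapH (F.mapH h))))) =
      (G.mapHorCell (F.hC f g e1).hom ▥ 𝒞.vId (G.mapH (F.mapH h)) :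
        𝒞.Sq _ (𝒞.v1 _) (𝒞.v1 _) (𝒞.hc _ _)) ▤
      ((G.hC (F.mapH f) (F.mapH g) rfl).hom ▥ 𝒞.vId (G.mapH (F.mapH h))) := by
    rw [interchangeP _ _ _ _ _ _ _ _ (𝒞.v1_vc _), vId_vP]
    rfl
  rw [e', mapHorCell_vP, vP_assoc (G.mapHorCell _) _ _ _ _ _ _ (𝒞.v1_vc _) (𝒞.v1_vc _),
    ← vP_assoc (G.mapHorCell (_ ▥ _)) _ _ (𝒞.v1_vc _) (𝒞.v1_vc _) (𝒞.v1_vc _) (𝒞.v1_vc _), ← e]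
  change vP (vP (G.mapHorCell _) (G.hC _ _ rfl).hom) _ = _
  rw [vP_assoc (G.mapHorCell _) _ _ _ _ _ _ (𝒞.v1_vc _) (𝒞.v1_vc _) (𝒞.v1_vc _) (𝒞.v1_vc _),
    ← vP_assoc (G.hC _ _ rfl).hom _ _ (𝒞.v1_vc _) (𝒞.v1_vc _) (𝒞.v1_vc _) (𝒞.v1_vc _)]

theorem compV_left {A B C D : 𝒜.Obj} (u : 𝒜.Ver A B) (v : 𝒜.Ver B C) (w : 𝒜.Ver C D)
    {vw : 𝒜.Ver B D} {k : 𝒜.Ver A D} (e2 : 𝒜.vc v w = vw) (e3 : 𝒜.vc u vw = k) :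
    ((𝒞.hId (G.mapV (F.mapV u)) ▤ (compV F G v w e2).hom) ▥ (compV F G u vw e3).hom :
        𝒞.Sq (𝒞.h1 _) (𝒞.vc _ (𝒞.vc _ _)) _ (𝒞.h1 _)) =
      ((𝒞.hId (G.mapV (F.mapV u)) ▤ (G.vC (F.mapV v) (F.mapV w) rfl).hom) ▥
          (G.vC (F.mapV u) (ℬ.vc (F.mapV v) (F.mapV w)) rfl).hom :
          𝒞.Sq (𝒞.h1 _) (𝒞.vc _ (𝒞.vc _ _)) _ (𝒞.h1 _)) ▥
        G.mapVerCell ((ℬ.hId (F.mapV u) ▤ (F.vC v w e2).hom) ▥ (F.vC u vw e3).hom) := by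
  have e := G.mapVerCell_vP (ℬ.hId (F.mapV u)) (F.vC v w e2).hom rfl rfl
  rw [G.mapVerCell_hId] at e
  have e' : (𝒞.hId (G.mapV (F.mapV u)) ▤ (compV F G v w e2).hom :
      𝒞.Sq (𝒞.h1 _) (𝒞.vc _ (𝒞.vc _ _)) _ (𝒞.h1 _)) =
      (𝒞.hId (G.mapV (F.mapV u)) ▤ (G.vC (F.mapV v) (F.mapV w) rfl).hom :
        𝒞.Sq (𝒞.h1 _) _ (𝒞.vc _ _) (𝒞.h1 _)) ▥
      (𝒞.hId (G.mapV (F.mapV u)) ▤ G.mapVerCell (F.vC v w e2).hom) := by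
    rw [← interchangeP _ _ _ _ (𝒞.h1_hc _) (𝒞.h1_hc _), hId_hP]
    rfl
  rw [e', mapVerCell_hP, ← hP_assoc _ _ (G.mapVerCell _) (𝒞.h1_hc _) (𝒞.h1_hc _) (𝒞.h1_hc _)
    (𝒞.h1_hc _),
    hP_assoc _ _ (G.mapVerCell (_ ▤ _)) _ _ _ _ (𝒞.h1_hc _) (𝒞.h1_hc _) (𝒞.h1_hc _) (𝒞.h1_hc _),
    ← e]
  change hP _ (hP (G.vC _ _ rfl).hom (G.mapVerCell _)) = _
  rw [← hP_assoc _ _ (G.mapVerCell _) (𝒞.h1_hc _) (𝒞.h1_hc _) (𝒞.h1_hc _) (𝒞.h1_hc _),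
    hP_assoc _ _ (G.vC _ _ rfl).hom _ _ _ _ (𝒞.h1_hc _) (𝒞.h1_hc _) (𝒞.h1_hc _) (𝒞.h1_hc _)]

theorem compV_right {A B C D : 𝒜.Obj} (u : 𝒜.Ver A B) (v : 𝒜.Ver B C) (w : 𝒜.Ver C D)
    {uv : 𝒜.Ver A C} {k : 𝒜.Ver A D} (e1 : 𝒜.vc u v = uv) (e4 : 𝒜.vc uv w = k) :
    (((compV F G u v e1).hom ▤ 𝒞.hId (G.mapV (F.mapV w))) ▥ (compV F G uv w e4).hom :
        𝒞.Sq (𝒞.h1 _) (𝒞.vc (G.mapV (F.mapV u)) (𝒞.vc (G.mapV (F.mapV v)) (G.mapV (F.mapV w)))) _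
          (𝒞.h1 _)) =
      (((G.vC (F.mapV u) (F.mapV v) rfl).hom ▤ 𝒞.hId (G.mapV (F.mapV w))) ▥
          (G.vC (ℬ.vc (F.mapV u) (F.mapV v)) (F.mapV w) (ℬ.vc_assoc _ _ _)).hom :
        𝒞.Sq (𝒞.h1 _) (𝒞.vc (G.mapV (F.mapV u)) (𝒞.vc (G.mapV (F.mapV v)) (G.mapV (F.mapV w)))) _
          (𝒞.h1 _)) ▥
        G.mapVerCell (((F.vC u v e1).hom ▤ ℬ.hId (F.mapV w)) ▥ (F.vC uv w e4).hom :
          ℬ.Sq (ℬ.h1 _) (ℬ.vc (F.mapV u) (ℬ.vc (F.mapV v) (F.mapV w))) _ (ℬ.h1 _)) := by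
  have e := G.mapVerCell_vP (F.vC u v e1).hom (ℬ.hId (F.mapV w)) (ℬ.vc_assoc _ _ _) rfl
  rw [G.mapVerCell_hId] at e
  have e' : ((compV F G u v e1).hom ▤ 𝒞.hId (G.mapV (F.mapV w)) :
        𝒞.Sq (𝒞.h1 _) (𝒞.vc (G.mapV (F.mapV u)) (𝒞.vc (G.mapV (F.mapV v)) (G.mapV (F.mapV w)))) _
          (𝒞.h1 _)) =
      ((G.vC (F.mapV u) (F.mapV v) rfl).hom ▤ 𝒞.hId (G.mapV (F.mapV w)) :
        𝒞.Sq (𝒞.h1 _) _ (𝒞.vc _ _) (𝒞.h1 _)) ▥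
      (G.mapVerCell (F.vC u v e1).hom ▤ 𝒞.hId (G.mapV (F.mapV w))) := by
    rw [← interchangeP _ _ _ _ (𝒞.h1_hc _) (𝒞.h1_hc _), hId_hP]
    rfl
  rw [e', mapVerCell_hP, ← hP_assoc _ _ (G.mapVerCell _) (𝒞.h1_hc _) (𝒞.h1_hc _) (𝒞.h1_hc _)
    (𝒞.h1_hc _),
    hP_assoc _ _ (G.mapVerCell (_ ▤ _)) _ _ _ _ (𝒞.h1_hc _) (𝒞.h1_hc _) (𝒞.h1_hc _) (𝒞.h1_hc _),
    ← e]
  change hP _ (hP (G.vC _ _ rfl).hom (G.mapVerCell _)) = _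
  rw [← hP_assoc _ _ (G.mapVerCell _) (𝒞.h1_hc _) (𝒞.h1_hc _) (𝒞.h1_hc _) (𝒞.h1_hc _),
    hP_assoc _ _ (G.vC _ _ rfl).hom _ _ _ _ (𝒞.h1_hc _) (𝒞.h1_hc _) (𝒞.h1_hc _) (𝒞.h1_hc _)]

end DoublePsFunctor

namespace DoublePsFunctor

open DoubleCat

variable {𝒜 ℬ 𝒞 : DoubleCat.{u, v, w, x}} (F : DoublePsFunctor 𝒜 ℬ) (G : DoublePsFunctor ℬ 𝒞)

theorem h1_compH {A B : 𝒜.Obj} (f : 𝒜.Hor A B) (e : 𝒜.hc (𝒜.h1 A) f = f) :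
    ((compH F G (𝒜.h1 A) f e).hom ▤ (((G.mapHorIso (F.hUnit A)).trans
        (G.hUnit (F.obj A))).hom ▥ 𝒞.vId (G.mapH (F.mapH f))) :
        𝒞.Sq _ (𝒞.v1 _) (𝒞.v1 _) (G.mapH (F.mapH f))) = 𝒞.vId (G.mapH (F.mapH f)) := by
  have h := G.mapHorCell_hP (F.hUnit A).hom (ℬ.vId (F.mapH f)) rfl (ℬ.h1_hc _)
  rw [G.mapHorCell_vId] at h
  have e' : (((G.mapHorIso (F.hUnit A)).trans (G.hUnit (F.obj A))).hom ▥
      𝒞.vId (G.mapH (F.mapH f)) : 𝒞.Sq _ (𝒞.v1 _) (𝒞.v1 _) (G.mapH (F.mapH f))) =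
      (G.mapHorCell (F.hUnit A).hom ▥ 𝒞.vId (G.mapH (F.mapH f)) :
        𝒞.Sq _ (𝒞.v1 _) (𝒞.v1 _) (𝒞.hc _ _)) ▤
      ((G.hUnit (F.obj A)).hom ▥ 𝒞.vId (G.mapH (F.mapH f))) := by
    rw [interchangeP _ _ _ _ _ _ _ (𝒞.v1_vc _) (𝒞.v1_vc _), vId_vP]
    rfl
  rw [e', ← vP_assoc _ _ (_ ▥ _) (𝒞.v1_vc _) (𝒞.v1_vc _) (𝒞.v1_vc _) (𝒞.v1_vc _)]
  change vP (vP (vP (G.mapHorCell _) (G.hC _ _ rfl).hom) _) _ = _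
  rw [vP_assoc (G.mapHorCell _) _ _ _ _ _ _ (𝒞.v1_vc _) (𝒞.v1_vc _) (𝒞.v1_vc _) (𝒞.v1_vc _), h,
    vP_assoc (G.mapHorCell _) _ _ _ _ _ _ (𝒞.v1_vc _) (𝒞.v1_vc _) (𝒞.v1_vc _) (𝒞.v1_vc _),
    vP_assoc (G.mapHorCell (_ ▥ _)) _ _ _ _ _ _ (𝒞.v1_vc _) (𝒞.v1_vc _) (𝒞.v1_vc _) (𝒞.v1_vc _),
    eq_of_heq (G.h1_hC_heq (F.mapH f) (ℬ.h1_hc _)), vP_vId, ← mapHorCell_vP,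
    eq_of_heq (F.h1_hC_heq f e), mapHorCell_vId]

theorem compH_h1 {A B : 𝒜.Obj} (f : 𝒜.Hor A B) (e : 𝒜.hc f (𝒜.h1 B) = f) :
    ((compH F G f (𝒜.h1 B) e).hom ▤ (𝒞.vId (G.mapH (F.mapH f)) ▥
        ((G.mapHorIso (F.hUnit B)).trans (G.hUnit (F.obj B))).hom) :
        𝒞.Sq _ (𝒞.v1 _) (𝒞.v1 _) (G.mapH (F.mapH f))) = 𝒞.vId (G.mapH (F.mapH f)) := by
  have h := G.mapHorCell_hP (ℬ.vId (F.mapH f)) (F.hUnit B).hom rfl (ℬ.hc_h1 _)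
  rw [G.mapHorCell_vId] at h
  have e' : (𝒞.vId (G.mapH (F.mapH f)) ▥
      ((G.mapHorIso (F.hUnit B)).trans (G.hUnit (F.obj B))).hom :
        𝒞.Sq _ (𝒞.v1 _) (𝒞.v1 _) (G.mapH (F.mapH f))) =
      (𝒞.vId (G.mapH (F.mapH f)) ▥ G.mapHorCell (F.hUnit B).hom :
        𝒞.Sq _ (𝒞.v1 _) (𝒞.v1 _) (𝒞.hc _ _)) ▤
      (𝒞.vId (G.mapH (F.mapH f)) ▥ (G.hUnit (F.obj B)).hom) := by
    rw [interchangeP _ _ _ _ _ _ _ (𝒞.v1_vc _) (𝒞.v1_vc _), vId_vP]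
    rfl
  rw [e', ← vP_assoc _ _ (_ ▥ _) (𝒞.v1_vc _) (𝒞.v1_vc _) (𝒞.v1_vc _) (𝒞.v1_vc _)]
  change vP (vP (vP (G.mapHorCell _) (G.hC _ _ rfl).hom) _) _ = _
  rw [vP_assoc (G.mapHorCell _) _ _ _ _ _ _ (𝒞.v1_vc _) (𝒞.v1_vc _) (𝒞.v1_vc _) (𝒞.v1_vc _), h,
    vP_assoc (G.mapHorCell _) _ _ _ _ _ _ (𝒞.v1_vc _) (𝒞.v1_vc _) (𝒞.v1_vc _) (𝒞.v1_vc _),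
    vP_assoc (G.mapHorCell (_ ▥ _)) _ _ _ _ _ _ (𝒞.v1_vc _) (𝒞.v1_vc _) (𝒞.v1_vc _) (𝒞.v1_vc _),
    eq_of_heq (G.hC_h1_heq (F.mapH f) (ℬ.hc_h1 _)), vP_vId, ← mapHorCell_vP,
    eq_of_heq (F.hC_h1_heq f e), mapHorCell_vId]

theorem v1_compV {A B : 𝒜.Obj} (u : 𝒜.Ver A B) (e : 𝒜.vc (𝒜.v1 A) u = u) :
    ((((G.vUnit (F.obj A)).trans (G.mapVerIso (F.vUnit A))).hom ▤
        𝒞.hId (G.mapV (F.mapV u))) ▥ (compV F G (𝒜.v1 A) u e).hom :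
        𝒞.Sq (𝒞.h1 _) (G.mapV (F.mapV u)) _ (𝒞.h1 _)) = 𝒞.hId (G.mapV (F.mapV u)) := by
  have h := G.mapVerCell_vP (F.vUnit A).hom (ℬ.hId (F.mapV u)) (ℬ.v1_vc _) rfl
  rw [G.mapVerCell_hId] at h
  have e' : (((G.vUnit (F.obj A)).trans (G.mapVerIso (F.vUnit A))).hom ▤
      𝒞.hId (G.mapV (F.mapV u)) : 𝒞.Sq (𝒞.h1 _) (G.mapV (F.mapV u)) _ (𝒞.h1 _)) =
      ((G.vUnit (F.obj A)).hom ▤ 𝒞.hId (G.mapV (F.mapV u)) :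
        𝒞.Sq (𝒞.h1 _) (G.mapV (F.mapV u)) (𝒞.vc _ _) (𝒞.h1 _)) ▥
      (G.mapVerCell (F.vUnit A).hom ▤ 𝒞.hId (G.mapV (F.mapV u))) := by
    rw [← interchangeP _ _ _ _ (𝒞.h1_hc _) (𝒞.h1_hc _), hId_hP]
    rfl
  rw [e', hP_assoc (_ ▤ _) _ _ _ _ _ _ (𝒞.h1_hc _) (𝒞.h1_hc _) (𝒞.h1_hc _) (𝒞.h1_hc _)]
  change hP _ (hP _ (hP (G.vC _ _ rfl).hom (G.mapVerCell _))) = _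
  rw [← hP_assoc _ _ (G.mapVerCell _) (𝒞.h1_hc _) (𝒞.h1_hc _) (𝒞.h1_hc _) (𝒞.h1_hc _), h,
    ← hP_assoc _ _ (G.mapVerCell _) (𝒞.h1_hc _) (𝒞.h1_hc _) (𝒞.h1_hc _) (𝒞.h1_hc _),
    ← hP_assoc _ _ (G.mapVerCell (_ ▤ _)) (𝒞.h1_hc _) (𝒞.h1_hc _) (𝒞.h1_hc _) (𝒞.h1_hc _),
    eq_of_heq (G.v1_vC_heq (F.mapV u) (ℬ.v1_vc _)), hId_hP, ← mapVerCell_hP,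
    eq_of_heq (F.v1_vC_heq u e), mapVerCell_hId]

theorem compV_v1 {A B : 𝒜.Obj} (u : 𝒜.Ver A B) (e : 𝒜.vc u (𝒜.v1 B) = u) :
    ((𝒞.hId (G.mapV (F.mapV u)) ▤ ((G.vUnit (F.obj B)).trans (G.mapVerIso (F.vUnit B))).hom) ▥
        (compV F G u (𝒜.v1 B) e).hom :
        𝒞.Sq (𝒞.h1 _) (G.mapV (F.mapV u)) _ (𝒞.h1 _)) = 𝒞.hId (G.mapV (F.mapV u)) := by
  have h := G.mapVerCell_vP (ℬ.hId (F.mapV u)) (F.vUnit B).hom (ℬ.vc_v1 _) rfl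
  rw [G.mapVerCell_hId] at h
  have e' : (𝒞.hId (G.mapV (F.mapV u)) ▤
      ((G.vUnit (F.obj B)).trans (G.mapVerIso (F.vUnit B))).hom :
        𝒞.Sq (𝒞.h1 _) (G.mapV (F.mapV u)) _ (𝒞.h1 _)) =
      (𝒞.hId (G.mapV (F.mapV u)) ▤ (G.vUnit (F.obj B)).hom :
        𝒞.Sq (𝒞.h1 _) (G.mapV (F.mapV u)) (𝒞.vc _ _) (𝒞.h1 _)) ▥
      (𝒞.hId (G.mapV (F.mapV u)) ▤ G.mapVerCell (F.vUnit B).hom) := by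
    rw [← interchangeP _ _ _ _ (𝒞.h1_hc _) (𝒞.h1_hc _), hId_hP]
    rfl
  rw [e', hP_assoc (_ ▤ _) _ _ _ _ _ _ (𝒞.h1_hc _) (𝒞.h1_hc _) (𝒞.h1_hc _) (𝒞.h1_hc _)]
  change hP _ (hP _ (hP (G.vC _ _ rfl).hom (G.mapVerCell _))) = _
  rw [← hP_assoc _ _ (G.mapVerCell _) (𝒞.h1_hc _) (𝒞.h1_hc _) (𝒞.h1_hc _) (𝒞.h1_hc _), h,
    ← hP_assoc _ _ (G.mapVerCell _) (𝒞.h1_hc _) (𝒞.h1_hc _) (𝒞.h1_hc _) (𝒞.h1_hc _),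
    ← hP_assoc _ _ (G.mapVerCell (_ ▤ _)) (𝒞.h1_hc _) (𝒞.h1_hc _) (𝒞.h1_hc _) (𝒞.h1_hc _),
    eq_of_heq (G.vC_v1_heq (F.mapV u) (ℬ.vc_v1 _)), hId_hP, ← mapVerCell_hP,
    eq_of_heq (F.vC_v1_heq u e), mapVerCell_hId]

/-- The composite double pseudofunctor: first `F`, then `G`. -/
def comp : DoublePsFunctor 𝒜 𝒞 where
  obj A := G.obj (F.obj A)
  mapH f := G.mapH (F.mapH f)
  mapV u := G.mapV (F.mapV u)
  mapSq a := G.mapSq (F.mapSq a)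
  hComp f g := (G.mapHorIso (F.hComp f g)).trans (G.hComp (F.mapH f) (F.mapH g))
  hUnit A := (G.mapHorIso (F.hUnit A)).trans (G.hUnit (F.obj A))
  vComp u v := (G.vComp (F.mapV u) (F.mapV v)).trans (G.mapVerIso (F.vComp u v))
  vUnit A := (G.vUnit (F.obj A)).trans (G.mapVerIso (F.vUnit A))
  hComp_nat {A B C A' B' C' f f' u v w g g'} a b := by
    change vP (vP (G.mapHorCell _) (G.hC _ _ rfl).hom) _ = vP _ (vP (G.mapHorCell _) (G.hC _ _ rfl).hom)
    rw [vP_assoc _ _ _ _ _ _ _ (𝒞.v1_vc _) (𝒞.v1_vc _) (𝒞.v1_vc _) (𝒞.v1_vc _), G.hC_nat _ _ rfl rfl,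
      ← vP_assoc _ _ _ (𝒞.v1_vc _) (𝒞.v1_vc _) (𝒞.vc_v1 _) (𝒞.vc_v1 _), ← G.mapSq_vP_top _ _ (ℬ.v1_vc _) (ℬ.v1_vc _),
      F.hComp_nat, mapSq_vP_bot, vP_assoc _ _ _ _ _ _ _ (𝒞.v1_vc _) (𝒞.v1_vc _)]
  hUnit_nat {A A'} u := by
    change vP (vP (G.mapHorCell _) (G.hUnit _).hom) _ = vP _ (vP (G.mapHorCell _) (G.hUnit _).hom)
    rw [vP_assoc _ _ _ _ _ _ _ (𝒞.v1_vc _) (𝒞.v1_vc _) (𝒞.v1_vc _) (𝒞.v1_vc _), G.hUnit_nat,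
      ← vP_assoc _ _ _ (𝒞.v1_vc _) (𝒞.v1_vc _) (𝒞.vc_v1 _) (𝒞.vc_v1 _), ← G.mapSq_vP_top _ _ (ℬ.v1_vc _) (ℬ.v1_vc _),
      F.hUnit_nat, mapSq_vP_bot, vP_assoc _ _ _ _ _ _ _ (𝒞.v1_vc _) (𝒞.v1_vc _)]
  vComp_nat {A B A' B' A'' B'' f g h u v u' v'} a b := by
    change hP _ (hP (G.vC _ _ rfl).hom (G.mapVerCell _)) = hP (hP (G.vC _ _ rfl).hom (G.mapVerCell _)) _
    rw [← hP_assoc _ _ _ (𝒞.hc_h1 _) (𝒞.hc_h1 _) (𝒞.hc_h1 _) (𝒞.hc_h1 _), G.vC_nat _ _ rfl rfl,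
      hP_assoc _ _ _ _ _ _ _ (𝒞.hc_h1 _) (𝒞.hc_h1 _) (𝒞.h1_hc _) (𝒞.h1_hc _), ← G.mapSq_hP_right _ _ (ℬ.hc_h1 _) (ℬ.hc_h1 _),
      F.vComp_nat, mapSq_hP_left, hP_assoc _ _ _ _ _ _ _ (𝒞.h1_hc _) (𝒞.h1_hc _)]
  vUnit_nat {A B} f := by
    change hP _ (hP (G.vUnit _).hom (G.mapVerCell _)) = hP (hP (G.vUnit _).hom (G.mapVerCell _)) _
    rw [← hP_assoc _ _ _ (𝒞.hc_h1 _) (𝒞.hc_h1 _) (𝒞.hc_h1 _) (𝒞.hc_h1 _), G.vUnit_nat,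
      hP_assoc _ _ _ _ _ _ _ (𝒞.hc_h1 _) (𝒞.hc_h1 _) (𝒞.h1_hc _) (𝒞.h1_hc _), ← G.mapSq_hP_right _ _ (ℬ.hc_h1 _) (ℬ.hc_h1 _),
      F.vUnit_nat, mapSq_hP_left, hP_assoc _ _ _ _ _ _ _ (𝒞.h1_hc _) (𝒞.h1_hc _)]
  hComp_assoc {A B C D} f g h := by
    refine (heq_of_eq ((compH_left F G f g h rfl rfl).trans ?_)).trans
      (?_ : HEq ((compH F G (𝒜.hc f g) h (𝒜.hc_assoc f g h)).hom ▤
        ((compH F G f g rfl).hom ▥ 𝒞.vId (G.mapH (F.mapH h))) : 𝒞.Sq _ (𝒞.v1 _) (𝒞.v1 _)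
          (𝒞.hc (G.mapH (F.mapH f)) (𝒞.hc (G.mapH (F.mapH g)) (G.mapH (F.mapH h))))) _)
    · rw [compH_right F G f g h rfl (𝒜.hc_assoc f g h), F.hC_assoc f g h rfl rfl rfl _,
        G.hC_assoc _ _ _ rfl rfl rfl _]
    · have key : ∀ (k : 𝒜.Hor A D) (e : 𝒜.hc (𝒜.hc f g) h = k)
          (l : 𝒞.Hor (G.obj (F.obj A)) (G.obj (F.obj D)))
          (e' : 𝒞.hc (𝒞.hc (G.mapH (F.mapH f)) (G.mapH (F.mapH g))) (G.mapH (F.mapH h)) = l),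
          HEq ((compH F G (𝒜.hc f g) h e).hom ▤
            (hP (compH F G f g rfl).hom (𝒞.vId (G.mapH (F.mapH h))) rfl e') :
              𝒞.Sq _ (𝒞.v1 _) (𝒞.v1 _) l)
          ((compH F G (𝒜.hc f g) h rfl).hom ▤
            ((compH F G f g rfl).hom ▥ 𝒞.vId (G.mapH (F.mapH h))) : 𝒞.Sq _ (𝒞.v1 _) (𝒞.v1 _)
            (𝒞.hc (𝒞.hc (G.mapH (F.mapH f)) (G.mapH (F.mapH g))) (G.mapH (F.mapH h)))) := by
        intro k e l e'
        subst e e'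
        exact HEq.rfl
      exact key _ _ _ _
  h1_hComp {A B} f := by
    have key : ∀ (k : 𝒜.Hor A B) (e : 𝒜.hc (𝒜.h1 A) f = k),
        HEq ((compH F G (𝒜.h1 A) f rfl).hom ▤ (((G.mapHorIso (F.hUnit A)).trans
            (G.hUnit (F.obj A))).hom ▥ 𝒞.vId (G.mapH (F.mapH f))) :
            𝒞.Sq _ (𝒞.v1 _) (𝒞.v1 _) (G.mapH (F.mapH f)))
          ((compH F G (𝒜.h1 A) f e).hom ▤ (((G.mapHorIso (F.hUnit A)).trans
            (G.hUnit (F.obj A))).hom ▥ 𝒞.vId (G.mapH (F.mapH f))) :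
            𝒞.Sq _ (𝒞.v1 _) (𝒞.v1 _) (G.mapH (F.mapH f))) := by
      intro k e
      subst e
      exact HEq.rfl
    exact (key f (𝒜.h1_hc f)).trans (heq_of_eq (h1_compH F G f _))
  hComp_h1 {A B} f := by
    have key : ∀ (k : 𝒜.Hor A B) (e : 𝒜.hc f (𝒜.h1 B) = k),
        HEq ((compH F G f (𝒜.h1 B) rfl).hom ▤ (𝒞.vId (G.mapH (F.mapH f)) ▥
            ((G.mapHorIso (F.hUnit B)).trans (G.hUnit (F.obj B))).hom) :
            𝒞.Sq _ (𝒞.v1 _) (𝒞.v1 _) (G.mapH (F.mapH f)))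
          ((compH F G f (𝒜.h1 B) e).hom ▤ (𝒞.vId (G.mapH (F.mapH f)) ▥
            ((G.mapHorIso (F.hUnit B)).trans (G.hUnit (F.obj B))).hom) :
            𝒞.Sq _ (𝒞.v1 _) (𝒞.v1 _) (G.mapH (F.mapH f))) := by
      intro k e
      subst e
      exact HEq.rfl
    exact (key f (𝒜.hc_h1 f)).trans (heq_of_eq (compH_h1 F G f _))
  vComp_assoc {A B C D} u v w := by
    refine (heq_of_eq ((compV_left F G u v w rfl rfl).trans ?_)).trans
      (?_ : HEq (((compV F G u v rfl).hom ▤ 𝒞.hId (G.mapV (F.mapV w))) ▥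
        (compV F G (𝒜.vc u v) w (𝒜.vc_assoc u v w)).hom : 𝒞.Sq (𝒞.h1 _)
        (𝒞.vc (G.mapV (F.mapV u)) (𝒞.vc (G.mapV (F.mapV v)) (G.mapV (F.mapV w)))) _ (𝒞.h1 _)) _)
    · rw [compV_right F G u v w rfl (𝒜.vc_assoc u v w), F.vC_assoc u v w rfl rfl rfl _,
        G.vC_assoc _ _ _ rfl rfl rfl _]
    · have key : ∀ (k : 𝒜.Ver A D) (e : 𝒜.vc (𝒜.vc u v) w = k)
          (l : 𝒞.Ver (G.obj (F.obj A)) (G.obj (F.obj D)))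
          (e' : 𝒞.vc (𝒞.vc (G.mapV (F.mapV u)) (G.mapV (F.mapV v))) (G.mapV (F.mapV w)) = l),
          HEq (hP (vP (compV F G u v rfl).hom (𝒞.hId (G.mapV (F.mapV w))) e' rfl)
            (compV F G (𝒜.vc u v) w e).hom : 𝒞.Sq (𝒞.h1 _) l _ (𝒞.h1 _))
          (((compV F G u v rfl).hom ▤ 𝒞.hId (G.mapV (F.mapV w))) ▥
            (compV F G (𝒜.vc u v) w rfl).hom : 𝒞.Sq (𝒞.h1 _)
            (𝒞.vc (𝒞.vc (G.mapV (F.mapV u)) (G.mapV (F.mapV v))) (G.mapV (F.mapV w))) _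
            (𝒞.h1 _)) := by
        intro k e l e'
        subst e e'
        exact HEq.rfl
      exact key _ _ _ _
  v1_vComp {A B} u := by
    have key : ∀ (k : 𝒜.Ver A B) (e : 𝒜.vc (𝒜.v1 A) u = k),
        HEq ((((G.vUnit (F.obj A)).trans (G.mapVerIso (F.vUnit A))).hom ▤
            𝒞.hId (G.mapV (F.mapV u))) ▥ (compV F G (𝒜.v1 A) u rfl).hom :
            𝒞.Sq (𝒞.h1 _) (G.mapV (F.mapV u)) _ (𝒞.h1 _))
          ((((G.vUnit (F.obj A)).trans (G.mapVerIso (F.vUnit A))).hom ▤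
            𝒞.hId (G.mapV (F.mapV u))) ▥ (compV F G (𝒜.v1 A) u e).hom :
            𝒞.Sq (𝒞.h1 _) (G.mapV (F.mapV u)) _ (𝒞.h1 _)) := by
      intro k e
      subst e
      exact HEq.rfl
    exact (key u (𝒜.v1_vc u)).trans (heq_of_eq (v1_compV F G u _))
  vComp_v1 {A B} u := by
    have key : ∀ (k : 𝒜.Ver A B) (e : 𝒜.vc u (𝒜.v1 B) = k),
        HEq ((𝒞.hId (G.mapV (F.mapV u)) ▤
            ((G.vUnit (F.obj B)).trans (G.mapVerIso (F.vUnit B))).hom) ▥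
              (compV F G u (𝒜.v1 B) rfl).hom :
            𝒞.Sq (𝒞.h1 _) (G.mapV (F.mapV u)) _ (𝒞.h1 _))
          ((𝒞.hId (G.mapV (F.mapV u)) ▤
            ((G.vUnit (F.obj B)).trans (G.mapVerIso (F.vUnit B))).hom) ▥
              (compV F G u (𝒜.v1 B) e).hom :
            𝒞.Sq (𝒞.h1 _) (G.mapV (F.mapV u)) _ (𝒞.h1 _)) := by
      intro k e
      subst e
      exact HEq.rfl
    exact (key u (𝒜.vc_v1 u)).trans (heq_of_eq (compV_v1 F G u _))

end DoublePsFunctor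

namespace DoubleCat

/-- Invertibility of a 2-cell with identity left and right sides. -/
def IsHorInvertible {D : DoubleCat.{u, v, w, x}} {A B : D.Obj} {f g : D.Hor A B}
    (s : D.Sq f (D.v1 A) (D.v1 B) g) : Prop :=
  ∃ t : D.Sq g (D.v1 A) (D.v1 B) f, s ▤ t = D.vId f ∧ t ▤ s = D.vId g

/-- Invertibility of a 2-cell with identity top and bottom sides. -/
def IsVerInvertible {D : DoubleCat.{u, v, w, x}} {A B : D.Obj} {u v : D.Ver A B}
    (s : D.Sq (D.h1 A) u v (D.h1 B)) : Prop :=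
  ∃ t : D.Sq (D.h1 A) v u (D.h1 B), s ▥ t = D.hId u ∧ t ▥ s = D.hId v

end DoubleCat

open DoubleCat DoublePsFunctor

/-- The data of a horizontal pseudonatural transformation `F ⇒ G`: components `α(A)`, `α_u` and
`δ_{α,f}`. -/
structure HorTransData {𝒜 ℬ : DoubleCat.{u, v, w, x}} (F G : DoublePsFunctor 𝒜 ℬ) where
  app : (A : 𝒜.Obj) → ℬ.Hor (F.obj A) (G.obj A)
  sq : {A A' : 𝒜.Obj} → (u : 𝒜.Ver A A') → ℬ.Sq (app A) (F.mapV u) (G.mapV u) (app A')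
  δ : {A B : 𝒜.Obj} → (f : 𝒜.Hor A B) →
    ℬ.Sq (ℬ.hc (F.mapH f) (app B)) (ℬ.v1 (F.obj A)) (ℬ.v1 (G.obj B)) (ℬ.hc (app A) (G.mapH f))

/-- The axioms of a horizontal pseudonatural transformation. -/
structure HorTransData.IsPsNat {𝒜 ℬ : DoubleCat.{u, v, w, x}} {F G : DoublePsFunctor 𝒜 ℬ}
    (α : HorTransData F G) : Prop where
  /-- pseudonaturality of 2-cells -/
  nat : ∀ {A B A' B' : 𝒜.Obj} {f : 𝒜.Hor A B} {u : 𝒜.Ver A A'} {v : 𝒜.Ver B B'}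
    {g : 𝒜.Hor A' B'} (a : 𝒜.Sq f u v g),
    ((F.mapSq a ▥ α.sq v) ▤ α.δ g :
        ℬ.Sq (ℬ.hc (F.mapH f) (α.app B)) (F.mapV u) (G.mapV v) (ℬ.hc (α.app A') (G.mapH g))) =
      α.δ f ▤ (α.sq u ▥ G.mapSq a)
  /-- vertical functoriality: composition -/
  sq_vc : ∀ {A A' A'' : 𝒜.Obj} (u : 𝒜.Ver A A') (v : 𝒜.Ver A' A''),
    ((F.vComp u v).hom ▥ α.sq (𝒜.vc u v) :
        ℬ.Sq (α.app A) (ℬ.vc (F.mapV u) (F.mapV v)) (G.mapV (𝒜.vc u v)) (α.app A'')) =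
      (α.sq u ▤ α.sq v) ▥ (G.vComp u v).hom
  /-- vertical functoriality: identities -/
  sq_v1 : ∀ A : 𝒜.Obj,
    ((F.vUnit A).hom ▥ α.sq (𝒜.v1 A) :
        ℬ.Sq (α.app A) (ℬ.v1 (F.obj A)) (G.mapV (𝒜.v1 A)) (α.app A)) =
      ℬ.vId (α.app A) ▥ (G.vUnit A).hom
  /-- horizontal functoriality: composition -/
  δ_hc : ∀ {A B C : 𝒜.Obj} (f : 𝒜.Hor A B) (g : 𝒜.Hor B C),
    α.δ (𝒜.hc f g) =
      ((F.hComp f g).hom ▥ ℬ.vId (α.app C) :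
        ℬ.Sq (ℬ.hc (F.mapH (𝒜.hc f g)) (α.app C)) (ℬ.v1 _) (ℬ.v1 _)
          (ℬ.hc (F.mapH f) (ℬ.hc (F.mapH g) (α.app C)))) ▤
      ((ℬ.vId (F.mapH f) ▥ α.δ g :
        ℬ.Sq (ℬ.hc (F.mapH f) (ℬ.hc (F.mapH g) (α.app C))) (ℬ.v1 _) (ℬ.v1 _)
          (ℬ.hc (F.mapH f) (ℬ.hc (α.app B) (G.mapH g)))) ▤
      ((α.δ f ▥ ℬ.vId (G.mapH g) :
        ℬ.Sq (ℬ.hc (F.mapH f) (ℬ.hc (α.app B) (G.mapH g))) (ℬ.v1 _) (ℬ.v1 _)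
          (ℬ.hc (α.app A) (ℬ.hc (G.mapH f) (G.mapH g)))) ▤
      (ℬ.vId (α.app A) ▥ (G.hComp f g).inv :
        ℬ.Sq (ℬ.hc (α.app A) (ℬ.hc (G.mapH f) (G.mapH g))) (ℬ.v1 _) (ℬ.v1 _)
          (ℬ.hc (α.app A) (G.mapH (𝒜.hc f g)))) :
        ℬ.Sq _ (ℬ.v1 _) (ℬ.v1 _) _) : ℬ.Sq _ (ℬ.v1 _) (ℬ.v1 _) _)
  /-- horizontal functoriality: identities -/
  δ_h1 : ∀ A : 𝒜.Obj,
    ((F.hUnit A).inv ▥ ℬ.vId (α.app A) :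
        ℬ.Sq (α.app A) (ℬ.v1 _) (ℬ.v1 _) (ℬ.hc (F.mapH (𝒜.h1 A)) (α.app A))) ▤
      (α.δ (𝒜.h1 A) ▤
      (ℬ.vId (α.app A) ▥ (G.hUnit A).hom :
        ℬ.Sq (ℬ.hc (α.app A) (G.mapH (𝒜.h1 A))) (ℬ.v1 _) (ℬ.v1 _) (α.app A)) :
        ℬ.Sq _ (ℬ.v1 _) (ℬ.v1 _) _) = ℬ.vId (α.app A)

/-- The data of a vertical pseudonatural transformation `F ⇒ G`: components `α(A)`, `α_f` and
`δ_{α,u}`. -/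
structure VerTransData {𝒜 ℬ : DoubleCat.{u, v, w, x}} (F G : DoublePsFunctor 𝒜 ℬ) where
  app : (A : 𝒜.Obj) → ℬ.Ver (F.obj A) (G.obj A)
  sq : {A B : 𝒜.Obj} → (f : 𝒜.Hor A B) → ℬ.Sq (F.mapH f) (app A) (app B) (G.mapH f)
  δ : {A A' : 𝒜.Obj} → (u : 𝒜.Ver A A') →
    ℬ.Sq (ℬ.h1 (F.obj A)) (ℬ.vc (F.mapV u) (app A')) (ℬ.vc (app A) (G.mapV u)) (ℬ.h1 (G.obj A'))

/-- The axioms of a vertical pseudonatural transformation. -/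
structure VerTransData.IsPsNat {𝒜 ℬ : DoubleCat.{u, v, w, x}} {F G : DoublePsFunctor 𝒜 ℬ}
    (α : VerTransData F G) : Prop where
  /-- pseudonaturality of 2-cells -/
  nat : ∀ {A B A' B' : 𝒜.Obj} {f : 𝒜.Hor A B} {u : 𝒜.Ver A A'} {v : 𝒜.Ver B B'}
    {g : 𝒜.Hor A' B'} (a : 𝒜.Sq f u v g),
    ((F.mapSq a ▤ α.sq g) ▥ α.δ v :
        ℬ.Sq (F.mapH f) (ℬ.vc (F.mapV u) (α.app A')) (ℬ.vc (α.app B) (G.mapV v)) (G.mapH g)) =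
      α.δ u ▥ (α.sq f ▤ G.mapSq a)
  /-- horizontal functoriality: composition -/
  sq_hc : ∀ {A B C : 𝒜.Obj} (f : 𝒜.Hor A B) (g : 𝒜.Hor B C),
    ((F.hComp f g).inv ▤ α.sq (𝒜.hc f g) :
        ℬ.Sq (ℬ.hc (F.mapH f) (F.mapH g)) (α.app A) (α.app C) (G.mapH (𝒜.hc f g))) =
      (α.sq f ▥ α.sq g) ▤ (G.hComp f g).inv
  /-- horizontal functoriality: identities -/
  sq_h1 : ∀ A : 𝒜.Obj,
    ((F.hUnit A).inv ▤ α.sq (𝒜.h1 A) :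
        ℬ.Sq (ℬ.h1 (F.obj A)) (α.app A) (α.app A) (G.mapH (𝒜.h1 A))) =
      ℬ.hId (α.app A) ▤ (G.hUnit A).inv
  /-- vertical functoriality: composition -/
  δ_vc : ∀ {A A' A'' : 𝒜.Obj} (u : 𝒜.Ver A A') (v : 𝒜.Ver A' A''),
    α.δ (𝒜.vc u v) =
      ((F.vComp u v).inv ▤ ℬ.hId (α.app A'') :
        ℬ.Sq (ℬ.h1 _) (ℬ.vc (F.mapV (𝒜.vc u v)) (α.app A''))
          (ℬ.vc (F.mapV u) (ℬ.vc (F.mapV v) (α.app A''))) (ℬ.h1 _)) ▥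
      ((ℬ.hId (F.mapV u) ▤ α.δ v :
        ℬ.Sq (ℬ.h1 _) (ℬ.vc (F.mapV u) (ℬ.vc (F.mapV v) (α.app A'')))
          (ℬ.vc (F.mapV u) (ℬ.vc (α.app A') (G.mapV v))) (ℬ.h1 _)) ▥
      ((α.δ u ▤ ℬ.hId (G.mapV v) :
        ℬ.Sq (ℬ.h1 _) (ℬ.vc (F.mapV u) (ℬ.vc (α.app A') (G.mapV v)))
          (ℬ.vc (α.app A) (ℬ.vc (G.mapV u) (G.mapV v))) (ℬ.h1 _)) ▥
      (ℬ.hId (α.app A) ▤ (G.vComp u v).hom :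
        ℬ.Sq (ℬ.h1 _) (ℬ.vc (α.app A) (ℬ.vc (G.mapV u) (G.mapV v)))
          (ℬ.vc (α.app A) (G.mapV (𝒜.vc u v))) (ℬ.h1 _)) :
        ℬ.Sq (ℬ.h1 _) _ _ (ℬ.h1 _)) : ℬ.Sq (ℬ.h1 _) _ _ (ℬ.h1 _))
  /-- vertical functoriality: identities -/
  δ_v1 : ∀ A : 𝒜.Obj,
    ((F.vUnit A).hom ▤ ℬ.hId (α.app A) :
        ℬ.Sq (ℬ.h1 _) (α.app A) (ℬ.vc (F.mapV (𝒜.v1 A)) (α.app A)) (ℬ.h1 _)) ▥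
      (α.δ (𝒜.v1 A) ▥
      (ℬ.hId (α.app A) ▤ (G.vUnit A).inv :
        ℬ.Sq (ℬ.h1 _) (ℬ.vc (α.app A) (G.mapV (𝒜.v1 A))) (α.app A) (ℬ.h1 _)) :
        ℬ.Sq (ℬ.h1 _) _ _ (ℬ.h1 _)) = ℬ.hId (α.app A)

/-- The data `(α₀, α₁, t, r)` of a double pseudonatural transformation `F ⇒ G`. -/
structure DoubleTransData {𝒜 ℬ : DoubleCat.{u, v, w, x}} (F G : DoublePsFunctor 𝒜 ℬ) where
  /-- `α₀` -/
  ver : VerTransData F G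
  /-- `α₁` -/
  hor : HorTransData F G
  t : {A B : 𝒜.Obj} → (f : 𝒜.Hor A B) →
    ℬ.Sq (ℬ.hc (F.mapH f) (hor.app B)) (ver.app A) (ℬ.v1 (G.obj B)) (G.mapH f)
  r : {A A' : 𝒜.Obj} → (u : 𝒜.Ver A A') →
    ℬ.Sq (hor.app A) (ℬ.vc (F.mapV u) (ver.app A')) (G.mapV u) (ℬ.h1 (G.obj A'))

/-- The axioms (T1), (T2), (T3) of a double pseudonatural transformation.  The 1h-cells occurring
in (T2) are all components `γ(X)` of horizontal pseudonatural transformations `γ` between double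
pseudofunctors into `𝒜`, and similarly for the 1v-cells. -/
structure DoubleTransData.IsDoublePsNat {𝒜 ℬ : DoubleCat.{u, v, w, x}}
    {F G : DoublePsFunctor 𝒜 ℬ} (α : DoubleTransData F G) : Prop where
  T1_ver : α.ver.IsPsNat
  T1_hor : α.hor.IsPsNat
  T2_hor : ∀ {𝒳 : DoubleCat.{u, v, w, x}} {H K : DoublePsFunctor 𝒳 𝒜} (γ : HorTransData H K),
    γ.IsPsNat → ∀ X : 𝒳.Obj, IsHorInvertible (α.hor.δ (γ.app X))
  T2_ver : ∀ {𝒳 : DoubleCat.{u, v, w, x}} {H K : DoublePsFunctor 𝒳 𝒜} (γ : VerTransData H K),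
    γ.IsPsNat → ∀ X : 𝒳.Obj, IsVerInvertible (α.ver.δ (γ.app X))
  T3_1_t : ∀ {A B A' B' : 𝒜.Obj} {f : 𝒜.Hor A B} {u : 𝒜.Ver A A'} {v : 𝒜.Ver B B'}
    {g : 𝒜.Hor A' B'} (a : 𝒜.Sq f u v g),
    ((F.mapSq a ▥ α.hor.sq v) ▤ α.t g :
        ℬ.Sq (ℬ.hc (F.mapH f) (α.hor.app B)) (ℬ.vc (F.mapV u) (α.ver.app A')) (G.mapV v)
          (G.mapH g)) =
      α.ver.δ u ▥ (α.t f ▤ G.mapSq a :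
        ℬ.Sq (ℬ.hc (F.mapH f) (α.hor.app B)) (ℬ.vc (α.ver.app A) (G.mapV u)) (G.mapV v)
          (G.mapH g))
  T3_1_r : ∀ {A B A' B' : 𝒜.Obj} {f : 𝒜.Hor A B} {u : 𝒜.Ver A A'} {v : 𝒜.Ver B B'}
    {g : 𝒜.Hor A' B'} (a : 𝒜.Sq f u v g),
    ((F.mapSq a ▤ α.ver.sq g) ▥ α.r v :
        ℬ.Sq (ℬ.hc (F.mapH f) (α.hor.app B)) (ℬ.vc (F.mapV u) (α.ver.app A')) (G.mapV v)
          (G.mapH g)) =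
      α.hor.δ f ▤ (α.r u ▥ G.mapSq a :
        ℬ.Sq (ℬ.hc (α.hor.app A) (G.mapH f)) (ℬ.vc (F.mapV u) (α.ver.app A')) (G.mapV v)
          (G.mapH g))
  T3_2_t : ∀ {A B C : 𝒜.Obj} (f : 𝒜.Hor A B) (g : 𝒜.Hor B C),
    ((ℬ.vId (F.mapH f) ▥ α.hor.δ g :
        ℬ.Sq (ℬ.hc (F.mapH f) (ℬ.hc (F.mapH g) (α.hor.app C))) (ℬ.v1 _) (ℬ.v1 _)
          (ℬ.hc (F.mapH f) (ℬ.hc (α.hor.app B) (G.mapH g)))) ▤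
      (α.t f ▥ ℬ.vId (G.mapH g)) :
        ℬ.Sq (ℬ.hc (F.mapH f) (ℬ.hc (F.mapH g) (α.hor.app C))) (α.ver.app A) (ℬ.v1 (G.obj C))
          (ℬ.hc (G.mapH f) (G.mapH g))) =
      α.ver.sq f ▥ α.t g
  T3_2_r : ∀ {A A' A'' : 𝒜.Obj} (u : 𝒜.Ver A A') (v : 𝒜.Ver A' A''),
    ((ℬ.hId (F.mapV u) ▤ α.ver.δ v :
        ℬ.Sq (ℬ.h1 _) (ℬ.vc (F.mapV u) (ℬ.vc (F.mapV v) (α.ver.app A'')))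
          (ℬ.vc (F.mapV u) (ℬ.vc (α.ver.app A') (G.mapV v))) (ℬ.h1 _)) ▥
      (α.r u ▤ ℬ.hId (G.mapV v)) :
        ℬ.Sq (α.hor.app A) (ℬ.vc (F.mapV u) (ℬ.vc (F.mapV v) (α.ver.app A'')))
          (ℬ.vc (G.mapV u) (G.mapV v)) (ℬ.h1 (G.obj A''))) =
      α.hor.sq u ▤ α.r v
  T3_3_t : ∀ {A B C : 𝒜.Obj} (f : 𝒜.Hor A B) (g : 𝒜.Hor B C),
    α.t (𝒜.hc f g) =
      ((F.hComp f g).hom ▥ ℬ.vId (α.hor.app C) :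
        ℬ.Sq (ℬ.hc (F.mapH (𝒜.hc f g)) (α.hor.app C)) (ℬ.v1 _) (ℬ.v1 _)
          (ℬ.hc (F.mapH f) (ℬ.hc (F.mapH g) (α.hor.app C)))) ▤
      ((α.ver.sq f ▥ α.t g :
        ℬ.Sq (ℬ.hc (F.mapH f) (ℬ.hc (F.mapH g) (α.hor.app C))) (α.ver.app A) (ℬ.v1 (G.obj C))
          (ℬ.hc (G.mapH f) (G.mapH g))) ▤
      (G.hComp f g).inv :
        ℬ.Sq _ (α.ver.app A) (ℬ.v1 (G.obj C)) (G.mapH (𝒜.hc f g)))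
  T3_3_r : ∀ {A A' A'' : 𝒜.Obj} (u : 𝒜.Ver A A') (v : 𝒜.Ver A' A''),
    α.r (𝒜.vc u v) =
      ((F.vComp u v).inv ▤ ℬ.hId (α.ver.app A'') :
        ℬ.Sq (ℬ.h1 _) (ℬ.vc (F.mapV (𝒜.vc u v)) (α.ver.app A''))
          (ℬ.vc (F.mapV u) (ℬ.vc (F.mapV v) (α.ver.app A''))) (ℬ.h1 _)) ▥
      ((α.hor.sq u ▤ α.r v :
        ℬ.Sq (α.hor.app A) (ℬ.vc (F.mapV u) (ℬ.vc (F.mapV v) (α.ver.app A'')))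
          (ℬ.vc (G.mapV u) (G.mapV v)) (ℬ.h1 (G.obj A''))) ▥
      (G.vComp u v).hom :
        ℬ.Sq (α.hor.app A) _ (G.mapV (𝒜.vc u v)) (ℬ.h1 (G.obj A'')))

section HorizontalComposition

variable {𝒜 ℬ 𝒞 : DoubleCat.{u, v, w, x}} {F G : DoublePsFunctor 𝒜 ℬ}
  {F' G' : DoublePsFunctor ℬ 𝒞}

/-- The 2-cell `δ_{H(α),f}` of the image `H(α)` of a horizontal transformation under a double
pseudofunctor `H`. -/
def HorTransData.imageδ (α : HorTransData F G) (H : DoublePsFunctor ℬ 𝒞) {A B : 𝒜.Obj}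
    (f : 𝒜.Hor A B) :
    𝒞.Sq (𝒞.hc (H.mapH (F.mapH f)) (H.mapH (α.app B))) (𝒞.v1 _) (𝒞.v1 _)
      (𝒞.hc (H.mapH (α.app A)) (H.mapH (G.mapH f))) :=
  (H.hComp (F.mapH f) (α.app B)).inv ▤
    (H.mapHorCell (α.δ f) ▤ (H.hComp (α.app A) (G.mapH f)).hom :
      𝒞.Sq _ (𝒞.v1 _) (𝒞.v1 _) _)

/-- The 2-cell `δ_{H(α),u}` of the image `H(α)` of a vertical transformation under a double
pseudofunctor `H`. -/
def VerTransData.imageδ (α : VerTransData F G) (H : DoublePsFunctor ℬ 𝒞) {A A' : 𝒜.Obj}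
    (u : 𝒜.Ver A A') :
    𝒞.Sq (𝒞.h1 _) (𝒞.vc (H.mapV (F.mapV u)) (H.mapV (α.app A')))
      (𝒞.vc (H.mapV (α.app A)) (H.mapV (G.mapV u))) (𝒞.h1 _) :=
  (H.vComp (F.mapV u) (α.app A')).hom ▥
    (H.mapVerCell (α.δ u) ▥ (H.vComp (α.app A) (G.mapV u)).inv :
      𝒞.Sq (𝒞.h1 _) _ _ (𝒞.h1 _))

/-- The horizontal composite `β₁ ∘ α₁`. -/
def HorTransData.hcomp (α : HorTransData F G) (β : HorTransData F' G') :
    HorTransData (F.comp F') (G.comp G') where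
  app A := 𝒞.hc (F'.mapH (α.app A)) (β.app (G.obj A))
  sq u := F'.mapSq (α.sq u) ▥ β.sq (G.mapV u)
  δ {A B} f :=
    ((α.imageδ F' f ▥ 𝒞.vId (β.app (G.obj B)) :
      𝒞.Sq (𝒞.hc (F'.mapH (F.mapH f)) (𝒞.hc (F'.mapH (α.app B)) (β.app (G.obj B))))
        (𝒞.v1 _) (𝒞.v1 _)
        (𝒞.hc (F'.mapH (α.app A)) (𝒞.hc (F'.mapH (G.mapH f)) (β.app (G.obj B))))) ▤
    (𝒞.vId (F'.mapH (α.app A)) ▥ β.δ (G.mapH f) :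
      𝒞.Sq (𝒞.hc (F'.mapH (α.app A)) (𝒞.hc (F'.mapH (G.mapH f)) (β.app (G.obj B))))
        (𝒞.v1 _) (𝒞.v1 _)
        (𝒞.hc (𝒞.hc (F'.mapH (α.app A)) (β.app (G.obj A))) (G'.mapH (G.mapH f)))) :
      𝒞.Sq (𝒞.hc (F'.mapH (F.mapH f)) (𝒞.hc (F'.mapH (α.app B)) (β.app (G.obj B))))
        (𝒞.v1 (F'.obj (F.obj A))) (𝒞.v1 (G'.obj (G.obj B)))
        (𝒞.hc (𝒞.hc (F'.mapH (α.app A)) (β.app (G.obj A))) (G'.mapH (G.mapH f))))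

/-- The horizontal composite `β₀ ∘ α₀`. -/
def VerTransData.hcomp (α : VerTransData F G) (β : VerTransData F' G') :
    VerTransData (F.comp F') (G.comp G') where
  app A := 𝒞.vc (F'.mapV (α.app A)) (β.app (G.obj A))
  sq f := F'.mapSq (α.sq f) ▤ β.sq (G.mapH f)
  δ {A A'} u :=
    ((α.imageδ F' u ▤ 𝒞.hId (β.app (G.obj A')) :
      𝒞.Sq (𝒞.h1 _)
        (𝒞.vc (F'.mapV (F.mapV u)) (𝒞.vc (F'.mapV (α.app A')) (β.app (G.obj A'))))
        (𝒞.vc (F'.mapV (α.app A)) (𝒞.vc (F'.mapV (G.mapV u)) (β.app (G.obj A'))))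
        (𝒞.h1 _)) ▥
    (𝒞.hId (F'.mapV (α.app A)) ▤ β.δ (G.mapV u) :
      𝒞.Sq (𝒞.h1 _)
        (𝒞.vc (F'.mapV (α.app A)) (𝒞.vc (F'.mapV (G.mapV u)) (β.app (G.obj A'))))
        (𝒞.vc (𝒞.vc (F'.mapV (α.app A)) (β.app (G.obj A))) (G'.mapV (G.mapV u)))
        (𝒞.h1 _)) :
      𝒞.Sq (𝒞.h1 (F'.obj (F.obj A)))
        (𝒞.vc (F'.mapV (F.mapV u)) (𝒞.vc (F'.mapV (α.app A')) (β.app (G.obj A'))))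
        (𝒞.vc (𝒞.vc (F'.mapV (α.app A)) (β.app (G.obj A))) (G'.mapV (G.mapV u)))
        (𝒞.h1 (G'.obj (G.obj A'))))

/-- The horizontal composite `β ∘ α` of double transformations, with its pasted 2-cells
`t^{β∘α}_f` and `r^{β∘α}_u`. -/
def DoubleTransData.hcomp (α : DoubleTransData F G) (β : DoubleTransData F' G') :
    DoubleTransData (F.comp F') (G.comp G') where
  ver := α.ver.hcomp β.ver
  hor := α.hor.hcomp β.hor
  t {A B} f :=
    (β.ver.δ (α.ver.app A) ▥
      ((β.ver.sq (F.mapH f) ▥ β.t (α.hor.app B) :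
          𝒞.Sq (𝒞.hc (F'.mapH (F.mapH f)) (𝒞.hc (F'.mapH (α.hor.app B)) (β.hor.app (G.obj B))))
            (β.ver.app (F.obj A)) (𝒞.v1 (G'.obj (G.obj B)))
            (𝒞.hc (G'.mapH (F.mapH f)) (G'.mapH (α.hor.app B)))) ▤
        ((G'.hComp (F.mapH f) (α.hor.app B)).inv ▤
          (G'.mapSq (α.t f) ▥ (G'.vUnit (G.obj B)).inv :
            𝒞.Sq (G'.mapH (ℬ.hc (F.mapH f) (α.hor.app B))) (G'.mapV (α.ver.app A))
              (𝒞.v1 (G'.obj (G.obj B))) (G'.mapH (G.mapH f))) :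
          𝒞.Sq (𝒞.hc (G'.mapH (F.mapH f)) (G'.mapH (α.hor.app B))) (G'.mapV (α.ver.app A))
            (𝒞.v1 (G'.obj (G.obj B))) (G'.mapH (G.mapH f))) :
        𝒞.Sq (𝒞.hc (F'.mapH (F.mapH f)) (𝒞.hc (F'.mapH (α.hor.app B)) (β.hor.app (G.obj B))))
          (𝒞.vc (β.ver.app (F.obj A)) (G'.mapV (α.ver.app A))) (𝒞.v1 (G'.obj (G.obj B)))
          (G'.mapH (G.mapH f))) :
      𝒞.Sq (𝒞.hc (F'.mapH (F.mapH f)) (𝒞.hc (F'.mapH (α.hor.app B)) (β.hor.app (G.obj B))))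
        (𝒞.vc (F'.mapV (α.ver.app A)) (β.ver.app (G.obj A))) (𝒞.v1 (G'.obj (G.obj B)))
        (G'.mapH (G.mapH f)))
  r {A A'} u :=
    (β.hor.δ (α.hor.app A) ▤
      ((β.hor.sq (F.mapV u) ▤ β.r (α.ver.app A') :
          𝒞.Sq (β.hor.app (F.obj A))
            (𝒞.vc (F'.mapV (F.mapV u)) (𝒞.vc (F'.mapV (α.ver.app A')) (β.ver.app (G.obj A'))))
            (𝒞.vc (G'.mapV (F.mapV u)) (G'.mapV (α.ver.app A')))
            (𝒞.h1 (G'.obj (G.obj A')))) ▥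
        ((G'.vComp (F.mapV u) (α.ver.app A')).hom ▥
          (G'.mapSq (α.r u) ▤ (G'.hUnit (G.obj A')).hom :
            𝒞.Sq (G'.mapH (α.hor.app A)) (G'.mapV (ℬ.vc (F.mapV u) (α.ver.app A')))
              (G'.mapV (G.mapV u)) (𝒞.h1 (G'.obj (G.obj A')))) :
          𝒞.Sq (G'.mapH (α.hor.app A)) (𝒞.vc (G'.mapV (F.mapV u)) (G'.mapV (α.ver.app A')))
            (G'.mapV (G.mapV u)) (𝒞.h1 (G'.obj (G.obj A')))) :
        𝒞.Sq (𝒞.hc (β.hor.app (F.obj A)) (G'.mapH (α.hor.app A)))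
          (𝒞.vc (F'.mapV (F.mapV u)) (𝒞.vc (F'.mapV (α.ver.app A')) (β.ver.app (G.obj A'))))
          (G'.mapV (G.mapV u)) (𝒞.h1 (G'.obj (G.obj A')))) :
      𝒞.Sq (𝒞.hc (F'.mapH (α.hor.app A)) (β.hor.app (G.obj A)))
        (𝒞.vc (F'.mapV (F.mapV u)) (𝒞.vc (F'.mapV (α.ver.app A')) (β.ver.app (G.obj A'))))
        (G'.mapV (G.mapV u)) (𝒞.h1 (G'.obj (G.obj A'))))

end HorizontalComposition

/-! Call a 2-cell globular if two opposite sides of it are identities.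

The transformation `β₁ ∘ α₁` is the image of `α₁` under `F'` followed by the restriction of `β₁`
along `G`. So (T1) follows from three closure properties of horizontal pseudonatural
transformations: under images (`image_isPsNat`), restrictions (`restrict_isPsNat`) and composition
of parallel transformations (`trans_isPsNat`). For (T2), `δ` of the composite at `γ(X)` is pasted
from `F'(δ_{α₁,γ(X)})`, invertible by (T2) for `α`, and from `δ_{β₁}` at `G(γ(X))`. The latter is
invertible by (T2) for `β`, because `G(γ(X))` is a component of the image of `γ` under `G`.

For (T3), `t^{β∘α}_f` consists of `δ_{β₀,α₀(A)}` on the left of a column, with `[(β₀)_{F(f)} |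
t^β_{α₁(B)}]` above the image of `t^α_f` under `G'`. Each axiom is checked layer by layer. The image
of `t^α` inherits the axioms of `t^α` (`splitRightCell_nat`, `splitRightCell_δ`,
`splitRightCell_hc`); the upper layer obeys the axioms of `β`; and the cells of `β` are natural with
respect to the structure 2-cells of `α`. The last point needs naturality for globular 2-cells
between composites of 1-cells (`δ₂_hConj`, `δ_vP_t`), which must be derived: the axioms speak only
of `F'(a)`, whose sides are images of identities rather than identities. The unit laws bridge this
gap.

Coherence of the pseudofunctors enters through one device. A comparison 2-cell is pasted on top of
both sides of an equation and pushed downwards by naturality until it cancels; as it is invertible,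
it may then be removed.

Only the horizontal half and the half about `t` are proved directly. Exchanging the two directions
makes vertical transformations horizontal and swaps `t` with `r`, which gives the other half. -/

namespace DoubleCat

/-! ### Normal forms of composite 1-cells -/

section Normalization

variable {D : DoubleCat.{u, v, w, x}}

/-- `HNorm f g k`: the horizontal 1-cell `k` is the composite of `f` and `g`, found by instance
search as a right-associated composite without units. -/
class HNorm {A B C : D.Obj} (f : D.Hor A B) (g : D.Hor B C) (k : outParam (D.Hor A C)) : Prop where
  eq : D.hc f g = k

/-- `VNorm u v k`: the vertical 1-cell `k` is the composite of `u` and `v`, found by instance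
search as a composite in which `u` and `v` are not units. -/
class VNorm {A B C : D.Obj} (u : D.Ver A B) (v : D.Ver B C) (k : outParam (D.Ver A C)) : Prop where
  eq : D.vc u v = k

instance (priority := 1000) HNorm.one_left {A B : D.Obj} (f : D.Hor A B) : HNorm (D.h1 A) f f :=
  ⟨D.h1_hc f⟩

instance (priority := 900) HNorm.one_right {A B : D.Obj} (f : D.Hor A B) : HNorm f (D.h1 B) f :=
  ⟨D.hc_h1 f⟩

instance (priority := 800) HNorm.assoc {A B C E : D.Obj} (f : D.Hor A B) (g : D.Hor B C)
    (h : D.Hor C E) (gh : D.Hor B E) (k : D.Hor A E) [i : HNorm g h gh] [j : HNorm f gh k] :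
    HNorm (D.hc f g) h k :=
  ⟨by rw [D.hc_assoc, i.eq, j.eq]⟩

-- The low priority makes this a fallback, tried only after the unit laws and the rebracketing.
instance (priority := 100) HNorm.default {A B C : D.Obj} (f : D.Hor A B) (g : D.Hor B C) :
    HNorm f g (D.hc f g) :=
  ⟨rfl⟩

instance (priority := 1000) VNorm.one_left {A B : D.Obj} (f : D.Ver A B) : VNorm (D.v1 A) f f :=
  ⟨D.v1_vc f⟩

instance (priority := 900) VNorm.one_right {A B : D.Obj} (f : D.Ver A B) : VNorm f (D.v1 B) f :=
  ⟨D.vc_v1 f⟩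

instance (priority := 100) VNorm.default {A B C : D.Obj} (f : D.Ver A B) (g : D.Ver B C) :
    VNorm f g (D.vc f g) :=
  ⟨rfl⟩

end Normalization

/-! ### Associativity and interchange for pastings -/

section Pasting

variable {D : DoubleCat.{u, v, w, x}}

/-- The boundary `f₂₃`, `g₂₃` of the new inner pasting does not occur on the left-hand side, so a
rewrite could not guess it; instance search supplies a normal form. The outer boundary equations
then follow from the given ones. The primed variant and the vertical versions serve the same
purpose. -/
theorem hPa {A B C E A' B' C' E' : D.Obj} {f₁ : D.Hor A B} {f₂ : D.Hor B C} {f₃ : D.Hor C E}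
    {u₀ : D.Ver A A'} {u₁ : D.Ver B B'} {u₂ : D.Ver C C'} {u₃ : D.Ver E E'}
    {g₁ : D.Hor A' B'} {g₂ : D.Hor B' C'} {g₃ : D.Hor C' E'}
    {f₁₂ : D.Hor A C} {f₂₃ : D.Hor B E} {f : D.Hor A E}
    {g₁₂ : D.Hor A' C'} {g₂₃ : D.Hor B' E'} {g : D.Hor A' E'}
    (s : D.Sq f₁ u₀ u₁ g₁) (t : D.Sq f₂ u₁ u₂ g₂) (r : D.Sq f₃ u₂ u₃ g₃)
    (h1 : D.hc f₁ f₂ = f₁₂) (h2 : D.hc g₁ g₂ = g₁₂) (h3 : D.hc f₁₂ f₃ = f) (h4 : D.hc g₁₂ g₃ = g)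
    [i : HNorm f₂ f₃ f₂₃] [j : HNorm g₂ g₃ g₂₃] :
    hP (hP s t h1 h2) r h3 h4 = hP s (hP t r i.eq j.eq)
      (by rw [← i.eq, ← D.hc_assoc, h1, h3]) (by rw [← j.eq, ← D.hc_assoc, h2, h4]) :=
  hP_assoc _ _ _ _ _ _ _ _ _ _ _

theorem hPa' {A B C E A' B' C' E' : D.Obj} {f₁ : D.Hor A B} {f₂ : D.Hor B C} {f₃ : D.Hor C E}
    {u₀ : D.Ver A A'} {u₁ : D.Ver B B'} {u₂ : D.Ver C C'} {u₃ : D.Ver E E'}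
    {g₁ : D.Hor A' B'} {g₂ : D.Hor B' C'} {g₃ : D.Hor C' E'}
    {f₁₂ : D.Hor A C} {f₂₃ : D.Hor B E} {f : D.Hor A E}
    {g₁₂ : D.Hor A' C'} {g₂₃ : D.Hor B' E'} {g : D.Hor A' E'}
    (s : D.Sq f₁ u₀ u₁ g₁) (t : D.Sq f₂ u₁ u₂ g₂) (r : D.Sq f₃ u₂ u₃ g₃)
    (h5 : D.hc f₂ f₃ = f₂₃) (h6 : D.hc g₂ g₃ = g₂₃) (h7 : D.hc f₁ f₂₃ = f)
    (h8 : D.hc g₁ g₂₃ = g) [i : HNorm f₁ f₂ f₁₂] [j : HNorm g₁ g₂ g₁₂] :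
    hP s (hP t r h5 h6) h7 h8 = hP (hP s t i.eq j.eq) r
      (by rw [← i.eq, D.hc_assoc, h5, h7]) (by rw [← j.eq, D.hc_assoc, h6, h8]) :=
  (hP_assoc _ _ _ _ _ _ _ _ _ _ _).symm

theorem vPa {A B C E A' B' C' E' : D.Obj} {f₁ : D.Ver A B} {f₂ : D.Ver B C} {f₃ : D.Ver C E}
    {u₀ : D.Hor A A'} {u₁ : D.Hor B B'} {u₂ : D.Hor C C'} {u₃ : D.Hor E E'}
    {g₁ : D.Ver A' B'} {g₂ : D.Ver B' C'} {g₃ : D.Ver C' E'}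
    {f₁₂ : D.Ver A C} {f₂₃ : D.Ver B E} {f : D.Ver A E}
    {g₁₂ : D.Ver A' C'} {g₂₃ : D.Ver B' E'} {g : D.Ver A' E'}
    (s : D.Sq u₀ f₁ g₁ u₁) (t : D.Sq u₁ f₂ g₂ u₂) (r : D.Sq u₂ f₃ g₃ u₃)
    (h1 : D.vc f₁ f₂ = f₁₂) (h2 : D.vc g₁ g₂ = g₁₂) (h3 : D.vc f₁₂ f₃ = f) (h4 : D.vc g₁₂ g₃ = g)
    [i : VNorm f₂ f₃ f₂₃] [j : VNorm g₂ g₃ g₂₃] :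
    vP (vP s t h1 h2) r h3 h4 = vP s (vP t r i.eq j.eq)
      (by rw [← i.eq, ← D.vc_assoc, h1, h3]) (by rw [← j.eq, ← D.vc_assoc, h2, h4]) :=
  vP_assoc _ _ _ _ _ _ _ _ _ _ _

theorem vPa' {A B C E A' B' C' E' : D.Obj} {f₁ : D.Ver A B} {f₂ : D.Ver B C} {f₃ : D.Ver C E}
    {u₀ : D.Hor A A'} {u₁ : D.Hor B B'} {u₂ : D.Hor C C'} {u₃ : D.Hor E E'}
    {g₁ : D.Ver A' B'} {g₂ : D.Ver B' C'} {g₃ : D.Ver C' E'}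
    {f₁₂ : D.Ver A C} {f₂₃ : D.Ver B E} {f : D.Ver A E}
    {g₁₂ : D.Ver A' C'} {g₂₃ : D.Ver B' E'} {g : D.Ver A' E'}
    (s : D.Sq u₀ f₁ g₁ u₁) (t : D.Sq u₁ f₂ g₂ u₂) (r : D.Sq u₂ f₃ g₃ u₃)
    (h5 : D.vc f₂ f₃ = f₂₃) (h6 : D.vc g₂ g₃ = g₂₃) (h7 : D.vc f₁ f₂₃ = f)
    (h8 : D.vc g₁ g₂₃ = g) [i : VNorm f₁ f₂ f₁₂] [j : VNorm g₁ g₂ g₁₂] :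
    vP s (vP t r h5 h6) h7 h8 = vP (vP s t i.eq j.eq) r
      (by rw [← i.eq, D.vc_assoc, h5, h7]) (by rw [← j.eq, D.vc_assoc, h6, h8]) :=
  (vP_assoc _ _ _ _ _ _ _ _ _ _ _).symm

/-- Two rows read as two columns. -/
theorem vP_hP_hP {A B C A' B' C' A'' B'' C'' : D.Obj}
    {f : D.Hor A B} {f' : D.Hor B C} {u : D.Ver A A'} {v : D.Ver B B'} {w : D.Ver C C'}
    {g : D.Hor A' B'} {g' : D.Hor B' C'} {u' : D.Ver A' A''} {v' : D.Ver B' B''}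
    {w' : D.Ver C' C''} {k : D.Hor A'' B''} {k' : D.Hor B'' C''}
    {ff : D.Hor A C} {gg : D.Hor A' C'} {kk : D.Hor A'' C''}
    {uu : D.Ver A A''} {vv : D.Ver B B''} {ww : D.Ver C C''}
    (a : D.Sq f u v g) (b : D.Sq f' v w g') (c : D.Sq g u' v' k) (d : D.Sq g' v' w' k')
    (h1 : D.hc f f' = ff) (h2 h2' : D.hc g g' = gg) (h3 : D.hc k k' = kk)
    (h4 : D.vc u u' = uu) (h6 : D.vc w w' = ww) [i : VNorm v v' vv] :
    vP (hP a b h1 h2) (hP c d h2' h3) h4 h6 = hP (vP a c h4 i.eq) (vP b d i.eq h6) h1 h3 :=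
  interchangeP _ _ _ _ _ _ _ _ _ _

/-- Two columns read as two rows. -/
theorem hP_vP_vP {A B C A' B' C' A'' B'' C'' : D.Obj}
    {f : D.Hor A B} {f' : D.Hor B C} {u : D.Ver A A'} {v : D.Ver B B'} {w : D.Ver C C'}
    {g : D.Hor A' B'} {g' : D.Hor B' C'} {u' : D.Ver A' A''} {v' : D.Ver B' B''}
    {w' : D.Ver C' C''} {k : D.Hor A'' B''} {k' : D.Hor B'' C''}
    {ff : D.Hor A C} {gg : D.Hor A' C'} {kk : D.Hor A'' C''}
    {uu : D.Ver A A''} {vv : D.Ver B B''} {ww : D.Ver C C''}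
    (a : D.Sq f u v g) (b : D.Sq f' v w g') (c : D.Sq g u' v' k) (d : D.Sq g' v' w' k')
    (h1 : D.hc f f' = ff) (h3 : D.hc k k' = kk)
    (h4 : D.vc u u' = uu) (h5 h5' : D.vc v v' = vv) (h6 : D.vc w w' = ww) [i : HNorm g g' gg] :
    hP (vP a c h4 h5) (vP b d h5' h6) h1 h3 = vP (hP a b h1 i.eq) (hP c d i.eq h3) h4 h6 :=
  (interchangeP _ _ _ _ _ _ _ _ _ _).symm

/-- Both pastings are casts of the same `hcomp`, so the names given to the composite boundaries are
irrelevant up to heterogeneous equality. -/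
theorem hP_heq_hP {A B C A' B' C' : D.Obj} {f : D.Hor A B} {f' : D.Hor B C}
    {u : D.Ver A A'} {v : D.Ver B B'} {w : D.Ver C C'} {g : D.Hor A' B'} {g' : D.Hor B' C'}
    {p p' : D.Hor A C} {q q' : D.Hor A' C'} (s : D.Sq f u v g) (t : D.Sq f' v w g')
    (h1 : D.hc f f' = p) (h2 : D.hc g g' = q) (h1' : D.hc f f' = p') (h2' : D.hc g g' = q') :
    HEq (hP s t h1 h2) (hP s t h1' h2') :=
  (hP_heq _ _ _ _).trans (hP_heq _ _ _ _).symm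

theorem vP_heq_vP {A B A' B' A'' B'' : D.Obj} {f f' : D.Hor A B} {g g' : D.Hor A' B'}
    {h h' : D.Hor A'' B''} {u : D.Ver A A'} {v : D.Ver B B'} {u' : D.Ver A' A''}
    {v' : D.Ver B' B''} {p : D.Ver A A''} {q : D.Ver B B''}
    {s : D.Sq f u v g} {t : D.Sq g u' v' h} {s' : D.Sq f' u v g'} {t' : D.Sq g' u' v' h'}
    {h1 h1' : D.vc u u' = p} {h2 h2' : D.vc v v' = q}
    (ef : f = f') (eg : g = g') (eh : h = h') (es : HEq s s') (et : HEq t t') :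
    HEq (vP s t h1 h2) (vP s' t' h1' h2') := by
  subst ef eg eh
  rw [eq_of_heq es, eq_of_heq et]

/-- Makes an equation between pastings of two globular 2-cells applicable at the head of a longer
column bracketed to the bottom. -/
theorem vP_reassoc {A B A' B' : D.Obj} {f g g' h : D.Hor A B} {k : D.Hor A' B'} {p : D.Ver A A'}
    {q : D.Ver B B'} {a : D.Sq f (D.v1 A) (D.v1 B) g} {b : D.Sq g (D.v1 A) (D.v1 B) h}
    {a' : D.Sq f (D.v1 A) (D.v1 B) g'} {b' : D.Sq g' (D.v1 A) (D.v1 B) h}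
    (e : vP a b (D.v1_vc _) (D.v1_vc _) = vP a' b' (D.v1_vc _) (D.v1_vc _)) (s : D.Sq h p q k)
    (h1 h1' : D.vc (D.v1 A) p = p) (h2 h2' : D.vc (D.v1 B) q = q) :
    vP a (vP b s h1 h2) h1' h2' = vP a' (vP b' s h1 h2) h1' h2' := by
  rw [vPa', e, vPa]

end Pasting

end DoubleCat

/-! ### Whiskering and invertible 2-cells -/

namespace DoubleCat

section Pasting

variable {D : DoubleCat.{u, v, w, x}}

/-- Right whiskering by a horizontal 1-cell distributes over vertical pasting. -/
theorem vP_hP_vId {A B C A' A'' : D.Obj} {f : D.Hor A B} {g : D.Hor A' B} {h : D.Hor A'' B}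
    {k : D.Hor B C} {u : D.Ver A A'} {u' : D.Ver A' A''} {uu : D.Ver A A''}
    {ff : D.Hor A C} {gg : D.Hor A' C} {hh : D.Hor A'' C}
    (a : D.Sq f u (D.v1 B) g) (b : D.Sq g u' (D.v1 B) h)
    (h1 : D.hc f k = ff) (h2 h2' : D.hc g k = gg) (h3 : D.hc h k = hh)
    (h4 : D.vc u u' = uu) (h5 : D.vc (D.v1 C) (D.v1 C) = D.v1 C) :
    vP (hP a (D.vId k) h1 h2) (hP b (D.vId k) h2' h3) h4 h5 =
      hP (vP a b h4 (D.v1_vc _)) (D.vId k) h1 h3 := by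
  rw [vP_hP_hP, vId_vP]

/-- Left whiskering by a horizontal 1-cell distributes over vertical pasting. -/
theorem vP_vId_hP {A B C C' C'' : D.Obj} {f : D.Hor B C} {g : D.Hor B C'} {h : D.Hor B C''}
    {k : D.Hor A B} {u : D.Ver C C'} {u' : D.Ver C' C''} {uu : D.Ver C C''}
    {ff : D.Hor A C} {gg : D.Hor A C'} {hh : D.Hor A C''}
    (a : D.Sq f (D.v1 B) u g) (b : D.Sq g (D.v1 B) u' h)
    (h1 : D.hc k f = ff) (h2 h2' : D.hc k g = gg) (h3 : D.hc k h = hh)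
    (h4 : D.vc u u' = uu) (h5 : D.vc (D.v1 A) (D.v1 A) = D.v1 A) :
    vP (hP (D.vId k) a h1 h2) (hP (D.vId k) b h2' h3) h5 h4 =
      hP (D.vId k) (vP a b (D.v1_vc _) h4) h1 h3 := by
  rw [vP_hP_hP, vId_vP]

/-- `vP_hP_vId`, for use as a normalization rule. -/
theorem hP_vId_dist {A B C A' A'' : D.Obj} {f : D.Hor A B} {g : D.Hor A' B} {h : D.Hor A'' B}
    {k : D.Hor B C} {u : D.Ver A A'} {u' : D.Ver A' A''} {uu : D.Ver A A''}
    {ff : D.Hor A C} {gg : D.Hor A' C} {hh : D.Hor A'' C}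
    (a : D.Sq f u (D.v1 B) g) (b : D.Sq g u' (D.v1 B) h)
    (h1 : D.hc f k = ff) (h3 : D.hc h k = hh) (h4 : D.vc u u' = uu)
    (h5 : D.vc (D.v1 B) (D.v1 B) = D.v1 B) [i : HNorm g k gg] :
    hP (vP a b h4 h5) (D.vId k) h1 h3 =
      vP (hP a (D.vId k) h1 i.eq) (hP b (D.vId k) i.eq h3) h4 (D.v1_vc _) :=
  (vP_hP_vId _ _ _ _ _ _ _ _).symm

/-- `vP_vId_hP`, for use as a normalization rule. -/
theorem vId_hP_dist {A B C C' C'' : D.Obj} {f : D.Hor B C} {g : D.Hor B C'} {h : D.Hor B C''}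
    {k : D.Hor A B} {u : D.Ver C C'} {u' : D.Ver C' C''} {uu : D.Ver C C''}
    {ff : D.Hor A C} {gg : D.Hor A C'} {hh : D.Hor A C''}
    (a : D.Sq f (D.v1 B) u g) (b : D.Sq g (D.v1 B) u' h)
    (h1 : D.hc k f = ff) (h3 : D.hc k h = hh) (h4 : D.vc u u' = uu)
    (h5 : D.vc (D.v1 B) (D.v1 B) = D.v1 B) [i : HNorm k g gg] :
    hP (D.vId k) (vP a b h5 h4) h1 h3 =
      vP (hP (D.vId k) a h1 i.eq) (hP (D.vId k) b i.eq h3) (D.v1_vc _) h4 :=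
  (vP_vId_hP _ _ _ _ _ _ _ _).symm

theorem vId_hP_hP {A B C E E' : D.Obj} {f : D.Hor A B} {g : D.Hor B C} {k : D.Hor A C}
    {x : D.Hor C E} {y : D.Hor C E'} {u : D.Ver E E'} {p : D.Hor B E} {q : D.Hor B E'}
    {p' : D.Hor A E} {q' : D.Hor A E'} (s : D.Sq x (D.v1 C) u y)
    (h1 : D.hc g x = p) (h2 : D.hc g y = q) (h3 : D.hc f p = p') (h4 : D.hc f q = q')
    [i : HNorm f g k] :
    hP (D.vId f) (hP (D.vId g) s h1 h2) h3 h4 = hP (D.vId k) s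
      (by rw [← i.eq, D.hc_assoc, h1, h3]) (by rw [← i.eq, D.hc_assoc, h2, h4]) := by
  rw [hPa', vId_hP]

/-- Interchange, with an identity in one of the four places: a whiskered 2-cell is absorbed into one
of the two columns beside it. The next three lemmas treat the other corners. -/
theorem vP_top_left {A B C A' A'' B'' C'' : D.Obj} {f : D.Hor A B} {g : D.Hor A' B}
    {h : D.Hor A'' B''} {k : D.Hor B C} {l : D.Hor B'' C''} {u : D.Ver A A'} {u' : D.Ver A' A''}
    {uu : D.Ver A A''} {v : D.Ver B B''} {w : D.Ver C C''}
    {ff : D.Hor A C} {gg : D.Hor A' C} {hh : D.Hor A'' C''}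
    (a : D.Sq f u (D.v1 B) g) (b : D.Sq g u' v h) (c : D.Sq k v w l)
    (h1 : D.hc f k = ff) (h2 h2' : D.hc g k = gg) (h3 : D.hc h l = hh)
    (h4 : D.vc u u' = uu) (h5 : D.vc (D.v1 C) w = w) :
    vP (hP a (D.vId k) h1 h2) (hP b c h2' h3) h4 h5 = hP (vP a b h4 (D.v1_vc _)) c h1 h3 := by
  rw [vP_hP_hP, vId_vP]

theorem vP_bot_left {A B C A' A'' B'' C'' : D.Obj} {f : D.Hor A'' B} {g : D.Hor A' B}
    {h : D.Hor A B''} {k : D.Hor B C} {l : D.Hor B'' C''} {u : D.Ver A A'} {u' : D.Ver A' A''}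
    {uu : D.Ver A A''} {v : D.Ver B'' B} {w : D.Ver C'' C}
    {ff : D.Hor A'' C} {gg : D.Hor A' C} {hh : D.Hor A C''}
    (a : D.Sq g u' (D.v1 B) f) (b : D.Sq h u v g) (c : D.Sq l v w k)
    (h1 : D.hc f k = ff) (h2 h2' : D.hc g k = gg) (h3 : D.hc h l = hh)
    (h4 : D.vc u u' = uu) (h5 : D.vc w (D.v1 C) = w) :
    vP (hP b c h3 h2') (hP a (D.vId k) h2 h1) h4 h5 = hP (vP b a h4 (D.vc_v1 _)) c h3 h1 := by
  rw [vP_hP_hP, vP_vId]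

theorem vP_top_right {A B C A'' B'' C' C'' : D.Obj} {f : D.Hor B C} {g : D.Hor B C'}
    {h : D.Hor B'' C''} {k : D.Hor A B} {l : D.Hor A'' B''} {u : D.Ver C C'} {u' : D.Ver C' C''}
    {uu : D.Ver C C''} {v : D.Ver B B''} {w : D.Ver A A''}
    {ff : D.Hor A C} {gg : D.Hor A C'} {hh : D.Hor A'' C''}
    (a : D.Sq f (D.v1 B) u g) (b : D.Sq g v u' h) (c : D.Sq k w v l)
    (h1 : D.hc k f = ff) (h2 h2' : D.hc k g = gg) (h3 : D.hc l h = hh)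
    (h4 : D.vc u u' = uu) (h5 : D.vc (D.v1 A) w = w) :
    vP (hP (D.vId k) a h1 h2) (hP c b h2' h3) h5 h4 = hP c (vP a b (D.v1_vc _) h4) h1 h3 := by
  rw [vP_hP_hP, vId_vP]

theorem vP_bot_right {A B C A'' B'' C' C'' : D.Obj} {f : D.Hor B C''} {g : D.Hor B C'}
    {h : D.Hor B'' C} {k : D.Hor A B} {l : D.Hor A'' B''} {u : D.Ver C C'} {u' : D.Ver C' C''}
    {uu : D.Ver C C''} {v : D.Ver B'' B} {w : D.Ver A'' A}
    {ff : D.Hor A C''} {gg : D.Hor A C'} {hh : D.Hor A'' C}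
    (a : D.Sq g (D.v1 B) u' f) (b : D.Sq h v u g) (c : D.Sq l w v k)
    (h1 : D.hc k f = ff) (h2 h2' : D.hc k g = gg) (h3 : D.hc l h = hh)
    (h4 : D.vc u u' = uu) (h5 : D.vc w (D.v1 A) = w) :
    vP (hP c b h3 h2') (hP (D.vId k) a h2 h1) h5 h4 = hP c (vP b a (D.vc_v1 _) h4) h3 h1 := by
  rw [vP_hP_hP, vP_vId]

theorem vP_whisker {A B C A' C' : D.Obj} {f : D.Hor A B} {g : D.Hor A' B} {f' : D.Hor B C}
    {g' : D.Hor B C'} {u : D.Ver A A'} {w : D.Ver C C'}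
    {ff : D.Hor A C} {gg : D.Hor A' C} {hh : D.Hor A' C'}
    (a : D.Sq f u (D.v1 B) g) (b : D.Sq f' (D.v1 B) w g')
    (h1 : D.hc f f' = ff) (h2 h2' : D.hc g f' = gg) (h3 : D.hc g g' = hh)
    (h4 : D.vc u (D.v1 A') = u) (h5 : D.vc (D.v1 C) w = w) :
    vP (hP a (D.vId f') h1 h2) (hP (D.vId g) b h2' h3) h4 h5 = hP a b h1 h3 := by
  rw [vP_hP_hP, vId_vP, vP_vId]

theorem vP_whisker' {A B C A' C' : D.Obj} {f : D.Hor A B} {g : D.Hor A' B} {f' : D.Hor B C}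
    {g' : D.Hor B C'} {u : D.Ver A A'} {w : D.Ver C C'}
    {ff : D.Hor A C} {gg : D.Hor A C'} {hh : D.Hor A' C'}
    (a : D.Sq f u (D.v1 B) g) (b : D.Sq f' (D.v1 B) w g')
    (h1 : D.hc f f' = ff) (h2 h2' : D.hc f g' = gg) (h3 : D.hc g g' = hh)
    (h4 : D.vc (D.v1 A) u = u) (h5 : D.vc w (D.v1 C') = w) :
    vP (hP (D.vId f) b h1 h2) (hP a (D.vId g') h2' h3) h4 h5 = hP a b h1 h3 := by
  rw [vP_hP_hP, vId_vP, vP_vId]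

/-- The 2-cells act on different factors, so their order does not matter: either order yields the
horizontal pasting of `a` and `b`. -/
theorem vP_exchange {A B C : D.Obj} {f g : D.Hor A B} {f' g' : D.Hor B C}
    {ff gg gg' hh : D.Hor A C}
    (a : D.Sq f (D.v1 A) (D.v1 B) g) (b : D.Sq f' (D.v1 B) (D.v1 C) g')
    (h1 : D.hc f f' = ff) (h2 h2' : D.hc g f' = gg) (h3 : D.hc g g' = hh)
    (h4 : D.vc (D.v1 A) (D.v1 A) = D.v1 A) (h5 : D.vc (D.v1 C) (D.v1 C) = D.v1 C)
    [i : HNorm f g' gg'] :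
    vP (hP a (D.vId f') h1 h2) (hP (D.vId g) b h2' h3) h4 h5 =
      vP (hP (D.vId f) b h1 i.eq) (hP a (D.vId g') i.eq h3) h4 h5 := by
  rw [vP_whisker, vP_whisker']

theorem HorIso.hom_inv_vP {A B A' B' : D.Obj} {f g : D.Hor A B} (i : D.HorIso f g)
    {h : D.Hor A' B'} {u : D.Ver A A'} {v : D.Ver B B'} (s : D.Sq f u v h)
    (h1 h3 : D.vc (D.v1 A) u = u) (h2 h4 : D.vc (D.v1 B) v = v) :
    vP i.hom (vP i.inv s h1 h2) h3 h4 = s := by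
  rw [vPa', i.hom_inv, vId_vP]

theorem HorIso.inv_hom_vP {A B A' B' : D.Obj} {f g : D.Hor A B} (i : D.HorIso f g)
    {h : D.Hor A' B'} {u : D.Ver A A'} {v : D.Ver B B'} (s : D.Sq g u v h)
    (h1 h3 : D.vc (D.v1 A) u = u) (h2 h4 : D.vc (D.v1 B) v = v) :
    vP i.inv (vP i.hom s h1 h2) h3 h4 = s := by
  rw [vPa', i.inv_hom, vId_vP]

/-- The cancellation that starts most coherence arguments below, with `i` a comparison 2-cell. -/
theorem HorIso.hom_vP_inj {A B A' B' : D.Obj} {f g : D.Hor A B} (i : D.HorIso f g)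
    {h : D.Hor A' B'} {u : D.Ver A A'} {v : D.Ver B B'} {s t : D.Sq g u v h}
    (h1 : D.vc (D.v1 A) u = u) (h2 : D.vc (D.v1 B) v = v)
    (e : vP i.hom s h1 h2 = vP i.hom t h1 h2) : s = t := by
  rw [← i.inv_hom_vP s h1 h1 h2 h2, e, i.inv_hom_vP]

theorem HorIso.vP_hom_inj {A B A' B' : D.Obj} {f g : D.Hor A' B'} (i : D.HorIso f g)
    {h : D.Hor A B} {u : D.Ver A A'} {v : D.Ver B B'} {s t : D.Sq h u v f}
    (h1 : D.vc u (D.v1 A') = u) (h2 : D.vc v (D.v1 B') = v)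
    (e : vP s i.hom h1 h2 = vP t i.hom h1 h2) : s = t := by
  rw [← vP_vId s h1 h2, ← vP_vId t h1 h2, ← i.hom_inv, vPa', e, vPa]

theorem VerIso.inv_hom_hP {A B A' B' : D.Obj} {f g : D.Ver A B} (i : D.VerIso f g)
    {h : D.Ver A' B'} {u : D.Hor A A'} {v : D.Hor B B'} (s : D.Sq u g h v)
    (h1 h3 : D.hc (D.h1 A) u = u) (h2 h4 : D.hc (D.h1 B) v = v) :
    hP i.inv (hP i.hom s h1 h2) h3 h4 = s := by
  rw [hPa', i.inv_hom, hId_hP]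

theorem VerIso.hP_hom_inv {A B A' B' : D.Obj} {f g : D.Ver A B} (i : D.VerIso f g)
    {h : D.Ver A' B'} {u : D.Hor A' A} {v : D.Hor B' B} (s : D.Sq u h f v)
    (h1 h3 : D.hc u (D.h1 A) = u) (h2 h4 : D.hc v (D.h1 B) = v) :
    hP (hP s i.hom h1 h2) i.inv h3 h4 = s := by
  rw [hPa, i.hom_inv, hP_hId]

/-- The identity of a horizontal 1-cell, as an invertible 2-cell. -/
def HorIso.refl {A B : D.Obj} (f : D.Hor A B) : D.HorIso f f where
  hom := D.vId f
  inv := D.vId f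
  hom_inv := vId_vP _ _ _
  inv_hom := vId_vP _ _ _

/-- The inverse of a vertically invertible 2-cell. -/
def HorIso.symm {A B : D.Obj} {f g : D.Hor A B} (i : D.HorIso f g) : D.HorIso g f where
  hom := i.inv
  inv := i.hom
  hom_inv := i.inv_hom
  inv_hom := i.hom_inv

/-- Horizontal pasting of vertically invertible 2-cells. -/
def HorIso.paste {A B C : D.Obj} {f g : D.Hor A B} {f' g' : D.Hor B C} {p q : D.Hor A C}
    (i : D.HorIso f g) (j : D.HorIso f' g') (top : D.hc f f' = p) (bot : D.hc g g' = q) :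
    D.HorIso p q where
  hom := hP i.hom j.hom top bot
  inv := hP i.inv j.inv bot top
  hom_inv := by rw [vP_hP_hP, i.hom_inv, j.hom_inv, vId_hP]
  inv_hom := by rw [vP_hP_hP, i.inv_hom, j.inv_hom, vId_hP]

end Pasting

end DoubleCat

/-! ### Comparison 2-cells and images of whiskered 2-cells -/

namespace DoublePsFunctor

variable {ℬ 𝒞 : DoubleCat.{u, v, w, x}} (H : DoublePsFunctor ℬ 𝒞)

theorem hComp_vP {A B C A' B' C' : ℬ.Obj} {f : ℬ.Hor A B} {f' : ℬ.Hor B C}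
    {u : ℬ.Ver A A'} {v : ℬ.Ver B B'} {w : ℬ.Ver C C'} {g : ℬ.Hor A' B'} {g' : ℬ.Hor B' C'}
    (a : ℬ.Sq f u v g) (b : ℬ.Sq f' v w g') (e : 𝒞.vc (𝒞.v1 _) (H.mapV u) = H.mapV u)
    (e' : 𝒞.vc (𝒞.v1 _) (H.mapV w) = H.mapV w) :
    vP (H.hComp f f').hom (hP (H.mapSq a) (H.mapSq b) rfl rfl) e e' =
      vP (H.mapSq (hP a b rfl rfl)) (H.hComp g g').hom (𝒞.vc_v1 _) (𝒞.vc_v1 _) :=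
  H.hComp_nat a b

theorem hP_vComp {A B A' B' A'' B'' : ℬ.Obj} {f : ℬ.Hor A B} {g : ℬ.Hor A' B'}
    {h : ℬ.Hor A'' B''} {u : ℬ.Ver A A'} {v : ℬ.Ver B B'} {u' : ℬ.Ver A' A''}
    {v' : ℬ.Ver B' B''} (a : ℬ.Sq f u v g) (b : ℬ.Sq g u' v' h)
    (e : 𝒞.hc (H.mapH f) (𝒞.h1 _) = H.mapH f) (e' : 𝒞.hc (H.mapH h) (𝒞.h1 _) = H.mapH h) :
    hP (vP (H.mapSq a) (H.mapSq b) rfl rfl) (H.vComp v v').hom e e' =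
      hP (H.vComp u u').hom (H.mapSq (vP a b rfl rfl)) (𝒞.h1_hc _) (𝒞.h1_hc _) :=
  H.vComp_nat a b

/-- Naturality of the comparison 2-cells, with one factor an identity 2-cell, which `mapHorCell`
preserves. -/
theorem hC_vP_vId_hP {A B C : ℬ.Obj} {x : ℬ.Hor A B} {y y' : ℬ.Hor B C} {k k' : ℬ.Hor A C}
    (a : ℬ.Sq y (ℬ.v1 B) (ℬ.v1 C) y') (h1 : ℬ.hc x y = k) (h2 : ℬ.hc x y' = k') :
    vP (H.hC x y h1).hom (hP (𝒞.vId (H.mapH x)) (H.mapHorCell a) rfl rfl)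
        (𝒞.v1_vc _) (𝒞.v1_vc _) =
      vP (H.mapHorCell (hP (ℬ.vId x) a h1 h2)) (H.hC x y' h2).hom (𝒞.v1_vc _) (𝒞.v1_vc _) := by
  rw [← mapHorCell_vId]
  exact H.mapHorCell_hP _ _ _ _

theorem hC_vP_hP_vId {A B C : ℬ.Obj} {x x' : ℬ.Hor A B} {y : ℬ.Hor B C} {k k' : ℬ.Hor A C}
    (a : ℬ.Sq x (ℬ.v1 A) (ℬ.v1 B) x') (h1 : ℬ.hc x y = k) (h2 : ℬ.hc x' y = k') :
    vP (H.hC x y h1).hom (hP (H.mapHorCell a) (𝒞.vId (H.mapH y)) rfl rfl)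
        (𝒞.v1_vc _) (𝒞.v1_vc _) =
      vP (H.mapHorCell (hP a (ℬ.vId y) h1 h2)) (H.hC x' y h2).hom (𝒞.v1_vc _) (𝒞.v1_vc _) := by
  rw [← mapHorCell_vId]
  exact H.mapHorCell_hP _ _ _ _

/-- The comparison 2-cell of a triple composite. -/
def hC3 {A B C E : ℬ.Obj} (x : ℬ.Hor A B) (y : ℬ.Hor B C) (z : ℬ.Hor C E) :
    𝒞.HorIso (H.mapH (ℬ.hc x (ℬ.hc y z)))
      (𝒞.hc (H.mapH x) (𝒞.hc (H.mapH y) (H.mapH z))) :=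
  (H.hComp x (ℬ.hc y z)).trans ((HorIso.refl _).paste (H.hComp y z) rfl rfl)

theorem hC3_hom {A B C E : ℬ.Obj} (x : ℬ.Hor A B) (y : ℬ.Hor B C) (z : ℬ.Hor C E) :
    (H.hC3 x y z).hom = vP (H.hComp x (ℬ.hc y z)).hom
      (hP (𝒞.vId (H.mapH x)) (H.hComp y z).hom rfl rfl) (𝒞.v1_vc _) (𝒞.v1_vc _) :=
  rfl

/-- Associativity coherence: a triple composite may be split from either end. The definition suits
2-cells acting on the last two factors, this form those acting on the first two. -/
theorem hC3_hom' {A B C E : ℬ.Obj} (x : ℬ.Hor A B) (y : ℬ.Hor B C) (z : ℬ.Hor C E) :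
    (H.hC3 x y z).hom = vP (H.hC (ℬ.hc x y) z (ℬ.hc_assoc x y z)).hom
      (hP (H.hComp x y).hom (𝒞.vId (H.mapH z)) rfl (𝒞.hc_assoc _ _ _))
      (𝒞.v1_vc _) (𝒞.v1_vc _) :=
  H.hC_assoc x y z rfl rfl rfl _

/-- The image of a 2-cell between composites, with composites as its boundary. -/
def hConj {A B B' C : ℬ.Obj} {x : ℬ.Hor A B} {y : ℬ.Hor B C} {x' : ℬ.Hor A B'} {y' : ℬ.Hor B' C}
    (a : ℬ.Sq (ℬ.hc x y) (ℬ.v1 A) (ℬ.v1 C) (ℬ.hc x' y')) :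
    𝒞.Sq (𝒞.hc (H.mapH x) (H.mapH y)) (𝒞.v1 _) (𝒞.v1 _) (𝒞.hc (H.mapH x') (H.mapH y')) :=
  (H.hComp x y).inv ▤ (H.mapHorCell a ▤ (H.hComp x' y').hom : 𝒞.Sq _ (𝒞.v1 _) (𝒞.v1 _) _)

theorem hComp_vP_hConj {A B B' C : ℬ.Obj} {x : ℬ.Hor A B} {y : ℬ.Hor B C} {x' : ℬ.Hor A B'}
    {y' : ℬ.Hor B' C} (a : ℬ.Sq (ℬ.hc x y) (ℬ.v1 A) (ℬ.v1 C) (ℬ.hc x' y')) :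
    vP (H.hComp x y).hom (H.hConj a) (𝒞.v1_vc _) (𝒞.v1_vc _) =
      vP (H.mapHorCell a) (H.hComp x' y').hom (𝒞.v1_vc _) (𝒞.v1_vc _) :=
  HorIso.hom_inv_vP _ _ _ _ _ _

/-- The inner comparison 2-cell of `hC3` cancels the inverse in `hConj`, and naturality moves the
outer one past the whiskered image. The argument recurs in `hC3_vP_right` on the other side. -/
theorem hC3_vP_left {A B C C' E : ℬ.Obj} (x : ℬ.Hor A B) {y : ℬ.Hor B C} {z : ℬ.Hor C E}
    {y' : ℬ.Hor B C'} {z' : ℬ.Hor C' E}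
    (a : ℬ.Sq (ℬ.hc y z) (ℬ.v1 B) (ℬ.v1 E) (ℬ.hc y' z')) :
    vP (H.hC3 x y z).hom (hP (𝒞.vId (H.mapH x)) (H.hConj a) rfl rfl) (𝒞.v1_vc _) (𝒞.v1_vc _) =
      vP (H.mapHorCell (hP (ℬ.vId x) a rfl rfl)) (H.hC3 x y' z').hom
        (𝒞.v1_vc _) (𝒞.v1_vc _) := by
  rw [hC3_hom, vPa, vP_vId_hP, hComp_vP_hConj, ← vP_vId_hP _ _ _ rfl rfl _ _ (𝒞.v1_vc _), vPa']
  erw [hC_vP_vId_hP _ _ rfl rfl]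
  rw [vPa, hC3_hom]
  rfl

theorem hC3_vP_right {A B B' C E : ℬ.Obj} {x : ℬ.Hor A B} {y : ℬ.Hor B C} {x' : ℬ.Hor A B'}
    {y' : ℬ.Hor B' C} (z : ℬ.Hor C E)
    (a : ℬ.Sq (ℬ.hc x y) (ℬ.v1 A) (ℬ.v1 C) (ℬ.hc x' y')) :
    vP (H.hC3 x y z).hom (hP (H.hConj a) (𝒞.vId (H.mapH z)) (𝒞.hc_assoc _ _ _) (𝒞.hc_assoc _ _ _))
        (𝒞.v1_vc _) (𝒞.v1_vc _) =
      vP (H.mapHorCell (hP a (ℬ.vId z) (ℬ.hc_assoc _ _ _) (ℬ.hc_assoc _ _ _)))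
        (H.hC3 x' y' z).hom (𝒞.v1_vc _) (𝒞.v1_vc _) := by
  rw [hC3_hom', vPa, vP_hP_vId, hComp_vP_hConj, ← vP_hP_vId _ _ _ rfl rfl _ _ (𝒞.v1_vc _), vPa',
    hC_vP_hP_vId _ _ _ (ℬ.hc_assoc _ _ _), vPa, hC3_hom']

/-- Entry to the triple comparison 2-cell, when the first of two factors is split further;
`hC3_vP_merge` is the exit. -/
theorem hC_vP_fork {A B C E : ℬ.Obj} {x : ℬ.Hor A B} {y : ℬ.Hor B C} {k : ℬ.Hor A C}
    (z : ℬ.Hor C E) (a : ℬ.Sq k (ℬ.v1 A) (ℬ.v1 C) (ℬ.hc x y)) :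
    vP (H.hComp k z).hom (hP (vP (H.mapHorCell a) (H.hComp x y).hom (𝒞.v1_vc _) (𝒞.v1_vc _))
        (𝒞.vId (H.mapH z)) rfl (𝒞.hc_assoc _ _ _)) (𝒞.v1_vc _) (𝒞.v1_vc _) =
      vP (H.mapHorCell (hP a (ℬ.vId z) rfl (ℬ.hc_assoc _ _ _)))
        (H.hC3 x y z).hom (𝒞.v1_vc _) (𝒞.v1_vc _) := by
  rw [← vP_hP_vId _ _ _ rfl rfl _ _ (𝒞.v1_vc _), vPa']
  erw [hC_vP_hP_vId _ _ rfl (ℬ.hc_assoc _ _ _)]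
  rw [vPa, hC3_hom']

theorem hC3_vP_merge {A B C E : ℬ.Obj} (x : ℬ.Hor A B) {y : ℬ.Hor B C} {z : ℬ.Hor C E}
    {k : ℬ.Hor B E} (a : ℬ.Sq (ℬ.hc y z) (ℬ.v1 B) (ℬ.v1 E) k) :
    vP (H.hC3 x y z).hom (hP (𝒞.vId (H.mapH x))
        (vP (H.hComp y z).inv (H.mapHorCell a) (𝒞.v1_vc _) (𝒞.v1_vc _)) rfl rfl)
        (𝒞.v1_vc _) (𝒞.v1_vc _) =
      vP (H.mapHorCell (hP (ℬ.vId x) a rfl rfl)) (H.hComp x k).hom (𝒞.v1_vc _) (𝒞.v1_vc _) := by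
  rw [hC3_hom, vPa, vP_vId_hP, HorIso.hom_inv_vP]
  exact hC_vP_vId_hP _ _ rfl rfl

end DoublePsFunctor

/-! ### The image of a horizontal transformation under a double pseudofunctor -/

namespace HorTransData

variable {𝒜 ℬ 𝒞 : DoubleCat.{u, v, w, x}}

/-- The image of a horizontal transformation under a double pseudofunctor. -/
def image {F G : DoublePsFunctor 𝒜 ℬ} (α : HorTransData F G) (H : DoublePsFunctor ℬ 𝒞) :
    HorTransData (F.comp H) (G.comp H) where
  app A := H.mapH (α.app A)
  sq u := H.mapSq (α.sq u)
  δ f := α.imageδ H f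

/-- The restriction of a horizontal transformation along a double pseudofunctor. -/
def restrict (G : DoublePsFunctor 𝒜 ℬ) {F' G' : DoublePsFunctor ℬ 𝒞} (β : HorTransData F' G') :
    HorTransData (G.comp F') (G.comp G') where
  app A := β.app (G.obj A)
  sq u := β.sq (G.mapV u)
  δ f := β.δ (G.mapH f)

/-- The composite of two horizontal transformations between parallel double pseudofunctors. -/
def trans {F G K : DoublePsFunctor 𝒜 ℬ} (α : HorTransData F G) (β : HorTransData G K) :
    HorTransData F K where
  app A := ℬ.hc (α.app A) (β.app A)
  sq u := α.sq u ▥ β.sq u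
  δ {A B} f :=
    ((α.δ f ▥ ℬ.vId (β.app B) :
      ℬ.Sq (ℬ.hc (F.mapH f) (ℬ.hc (α.app B) (β.app B))) (ℬ.v1 _) (ℬ.v1 _)
        (ℬ.hc (α.app A) (ℬ.hc (G.mapH f) (β.app B)))) ▤
    (ℬ.vId (α.app A) ▥ β.δ f :
      ℬ.Sq (ℬ.hc (α.app A) (ℬ.hc (G.mapH f) (β.app B))) (ℬ.v1 _) (ℬ.v1 _)
        (ℬ.hc (ℬ.hc (α.app A) (β.app A)) (K.mapH f))) : ℬ.Sq _ (ℬ.v1 _) (ℬ.v1 _) _)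

theorem image_isPsNat {F G : DoublePsFunctor 𝒜 ℬ} {α : HorTransData F G} (hα : α.IsPsNat)
    (H : DoublePsFunctor ℬ 𝒞) : (α.image H).IsPsNat where
  nat {A B A' B' f u v g} a := by
    dsimp only [image, comp, imageδ]
    generalize_proofs
    refine (H.hComp _ _).hom_vP_inj (𝒞.v1_vc _) (𝒞.v1_vc _) ?_
    rw [vPa', vPa (H.hComp _ _).inv, HorIso.hom_inv_vP]
    rw [hComp_vP, vPa, HorIso.hom_inv_vP, vPa']
    rw [← H.mapSq_vP_bot _ _ (ℬ.vc_v1 _) (ℬ.vc_v1 _), hα.nat a, H.mapSq_vP_top]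
    rw [vPa, vPa, hComp_vP]
  sq_vc {A A' A''} u v := by
    dsimp only [image, comp]
    generalize_proofs
    -- The boundary equations are hypotheses by now, so their types are unfolded together with the
    -- goal.
    dsimp only [image, comp, VerIso.trans, mapVerIso] at *
    rw [hPa, ← H.mapSq_hP_left _ _ (ℬ.h1_hc _) (ℬ.h1_hc _), hα.sq_vc, hPa',
      hP_vComp, hPa, ← H.mapSq_hP_right _ _ (ℬ.hc_h1 _) (ℬ.hc_h1 _)]
  sq_v1 A := by
    dsimp only [image, comp]
    generalize_proofs
    dsimp only [image, comp, VerIso.trans, mapVerIso] at *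
    rw [hPa, ← H.mapSq_hP_left _ _ (ℬ.h1_hc _) (ℬ.h1_hc _), hα.sq_v1, hPa',
      H.vUnit_nat, hPa, ← H.mapSq_hP_right _ _ (ℬ.hc_h1 _) (ℬ.hc_h1 _)]
  δ_hc {A B C} f g := by
    dsimp only [image, comp]
    generalize_proofs
    dsimp only [image, comp, HorIso.trans, mapHorIso] at *
    -- By definition `imageδ` is `hConj` of `δ`. The four factors on the right are passed in turn by
    -- `hC_vP_fork`, `hC3_vP_left`, `hC3_vP_right` and `hC3_vP_merge`; what remains is `mapHorCell`
    -- of the axiom for `α`.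
    change H.hConj _ = vP (hP (vP (H.mapHorCell _) (H.hComp _ _).hom) (𝒞.vId (H.mapH _)))
      (vP (hP (𝒞.vId (H.mapH _)) (H.hConj _)) (vP (hP (H.hConj _) (𝒞.vId (H.mapH _)))
        (hP (𝒞.vId (H.mapH _)) (vP (H.hComp _ _).inv (H.mapHorCell _)))))
    refine (H.hComp _ _).hom_vP_inj (𝒞.v1_vc _) (𝒞.v1_vc _) ?_
    rw [hComp_vP_hConj, vP_reassoc (H.hC_vP_fork _ _), vP_reassoc (H.hC3_vP_left _ _),
      vP_reassoc (H.hC3_vP_right _ _), hC3_vP_merge, hα.δ_hc]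
    simp only [mapHorCell_vP, vPa]
  δ_h1 A := by
    dsimp only [image, comp]
    generalize_proofs
    dsimp only [image, comp, HorIso.trans, mapHorIso] at *
    change vP (hP (vP (H.hUnit _).inv (H.mapHorCell _)) (𝒞.vId (H.mapH _)))
      (vP (H.hConj _) (hP (𝒞.vId (H.mapH _)) (vP (H.mapHorCell _) (H.hUnit _).hom))) =
        𝒞.vId (H.mapH _)
    -- By the unit law of `H`, the whiskered inverse of `H_A` is the comparison 2-cell of an
    -- identity with a component of `α`. It is carried down the column and removed at the bottom by
    -- the other unit law, `hC_h1_heq`.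
    rw [← vP_hP_vId _ _ _ rfl rfl _ _ (𝒞.v1_vc _), H.hUnit_inv_hP _ (ℬ.h1_hc _),
      hC_vP_hP_vId _ _ _ rfl, ← vP_vId_hP _ _ _ rfl rfl _ _ (𝒞.v1_vc _), vPa]
    erw [vP_reassoc (H.hComp_vP_hConj _), vP_reassoc (H.hC_vP_vId_hP _ rfl (ℬ.hc_h1 _))]
    rw [eq_of_heq (H.hC_h1_heq _ _), vP_vId, ← mapHorCell_vP, ← mapHorCell_vP]
    erw [hα.δ_h1 A, mapHorCell_vId]

end HorTransData

/-! ### Naturality of horizontal transformations with respect to globular 2-cells -/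

namespace HorTransData

section Naturality

variable {𝒜 ℬ : DoubleCat.{u, v, w, x}} {F G : DoublePsFunctor 𝒜 ℬ} {α : HorTransData F G}

/-- The unit axiom with `G_A` moved to the other side. -/
theorem IsPsNat.inv_vP_δ_h1 (hα : α.IsPsNat) (A : 𝒜.Obj) :
    vP (hP (F.hUnit A).inv (ℬ.vId (α.app A)) (ℬ.h1_hc _) rfl) (α.δ (𝒜.h1 A))
        (ℬ.v1_vc _) (ℬ.v1_vc _) =
      hP (ℬ.vId (α.app A)) (G.hUnit A).inv (ℬ.hc_h1 _) rfl := by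
  let i := (HorIso.refl (α.app A)).paste (G.hUnit A) rfl (ℬ.hc_h1 _)
  refine i.vP_hom_inj (ℬ.v1_vc _) (ℬ.v1_vc _) ?_
  rw [vPa]
  exact (hα.δ_h1 A).trans i.inv_hom.symm

/-- `mapVerCell z` is the image of `z` between unit comparison 2-cells. The unit axiom trades those
of `F` for those of `G` at the cost of `δ` at an identity, and this `δ` passes through the image of
`z` by the naturality axiom. -/
theorem IsPsNat.sq_mapVerCell (hα : α.IsPsNat) {A B : 𝒜.Obj} {u v : 𝒜.Ver A B}
    (z : 𝒜.Sq (𝒜.h1 A) u v (𝒜.h1 B)) :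
    hP (F.mapVerCell z) (α.sq v) (ℬ.h1_hc _) (ℬ.h1_hc _) =
      hP (α.sq u) (G.mapVerCell z) (ℬ.hc_h1 _) (ℬ.hc_h1 _) := by
  have e1 : hP (F.mapVerCell z) (α.sq v) (ℬ.h1_hc _) (ℬ.h1_hc _) =
      vP (hP (F.hUnit A).inv (ℬ.vId (α.app A)) (ℬ.h1_hc _) rfl)
        (vP (hP (F.mapSq z) (α.sq v) rfl rfl)
          (hP (F.hUnit B).hom (ℬ.vId (α.app B)) rfl (ℬ.h1_hc _)) (ℬ.vc_v1 _) (ℬ.vc_v1 _))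
          (ℬ.v1_vc _) (ℬ.v1_vc _) := by
    rw [vP_hP_hP, vP_hP_hP, vP_vId, vId_vP, mapVerCell, vPa]
  have e2 : hP (α.sq u) (G.mapVerCell z) (ℬ.hc_h1 _) (ℬ.hc_h1 _) =
      vP (hP (ℬ.vId (α.app A)) (G.hUnit A).inv (ℬ.hc_h1 _) rfl)
        (vP (hP (α.sq u) (G.mapSq z) rfl rfl)
          (hP (ℬ.vId (α.app B)) (G.hUnit B).hom rfl (ℬ.hc_h1 _)) (ℬ.vc_v1 _) (ℬ.vc_v1 _))
          (ℬ.v1_vc _) (ℬ.v1_vc _) := by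
    rw [vP_hP_hP, vP_hP_hP, vP_vId, vId_vP, mapVerCell, vPa]
  have d (X : 𝒜.Obj) : hP (F.hUnit X).hom (ℬ.vId (α.app X)) rfl (ℬ.h1_hc _) =
      vP (α.δ (𝒜.h1 X)) (hP (ℬ.vId (α.app X)) (G.hUnit X).hom rfl (ℬ.hc_h1 _))
        (ℬ.v1_vc _) (ℬ.v1_vc _) := by
    have h := hα.δ_h1 X
    let i := (F.hUnit X).paste (HorIso.refl (α.app X)) rfl (ℬ.h1_hc _)
    refine i.symm.hom_vP_inj (ℬ.v1_vc _) (ℬ.v1_vc _) ?_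
    exact i.inv_hom.trans h.symm
  have n := hα.nat z
  rw [e1, e2, d, ← hα.inv_vP_δ_h1, vPa (hP (F.hUnit A).inv _ _ _),
    vPa' (hP (F.mapSq z) (α.sq v) rfl rfl), n, vPa]

theorem IsPsNat.vUnit_inv_hP (hα : α.IsPsNat) (B : 𝒜.Obj) :
    hP (F.vUnit B).inv (ℬ.vId (α.app B)) (ℬ.h1_hc _) (ℬ.h1_hc _) =
      hP (α.sq (𝒜.v1 B)) (G.vUnit B).inv (ℬ.hc_h1 _) (ℬ.hc_h1 _) := by
  have e : hP (α.sq (𝒜.v1 B)) (G.vUnit B).inv (ℬ.hc_h1 _) (ℬ.hc_h1 _) =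
      hP (F.vUnit B).inv (hP (hP (F.vUnit B).hom (α.sq (𝒜.v1 B)) (ℬ.h1_hc _) (ℬ.h1_hc _))
        (G.vUnit B).inv (ℬ.hc_h1 _) (ℬ.hc_h1 _)) (ℬ.h1_hc _) (ℬ.h1_hc _) := by
    rw [hPa, VerIso.inv_hom_hP]
  rw [e, hα.sq_v1, VerIso.hP_hom_inv]

/-- Naturality at `a`, with the comparison 2-cells of the vertical identities on its sides; `sq_v1`
and its inverse form `vUnit_inv_hP` carry them across the components of `α`. -/
theorem IsPsNat.δ_mapHorCell (hα : α.IsPsNat) {A B : 𝒜.Obj} {f g : 𝒜.Hor A B}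
    (a : 𝒜.Sq f (𝒜.v1 A) (𝒜.v1 B) g) :
    vP (hP (F.mapHorCell a) (ℬ.vId (α.app B)) rfl rfl) (α.δ g) (ℬ.v1_vc _) (ℬ.v1_vc _) =
      vP (α.δ f) (hP (ℬ.vId (α.app A)) (G.mapHorCell a) rfl rfl) (ℬ.v1_vc _) (ℬ.v1_vc _) := by
  have n := hα.nat a
  rw [mapHorCell, hPa, hα.vUnit_inv_hP, hPa, hPa' (F.mapSq a), ← hP_vP_of_v1',
    ← vP_hP_of_v1', n, vP_hP_of_v1, hP_vP_of_v1, hPa, hPa', hα.sq_v1, hPa, mapHorCell, hPa]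

end Naturality

/-! ### Restriction and composition of horizontal transformations -/

variable {𝒜 ℬ 𝒞 : DoubleCat.{u, v, w, x}}

/-- A comparison 2-cell of a composite functor is a comparison 2-cell of the outer functor pasted
with the image of one of `G`. The axioms of `β` handle the former, naturality for globular 2-cells
the latter. -/
theorem restrict_isPsNat (G : DoublePsFunctor 𝒜 ℬ) {F' G' : DoublePsFunctor ℬ 𝒞}
    {β : HorTransData F' G'} (hβ : β.IsPsNat) : (β.restrict G).IsPsNat where
  nat a := hβ.nat (G.mapSq a)
  sq_vc {A A' A''} u v := by
    dsimp only [restrict, comp]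
    generalize_proofs
    dsimp only [restrict, comp, VerIso.trans, mapVerIso] at *
    rw [hPa, hβ.sq_mapVerCell, hPa', hβ.sq_vc, hPa]
  sq_v1 A := by
    dsimp only [restrict, comp]
    generalize_proofs
    dsimp only [restrict, comp, VerIso.trans, mapVerIso] at *
    rw [hPa, hβ.sq_mapVerCell, hPa', hβ.sq_v1, hPa]
  δ_hc {A B C} f g := by
    dsimp only [restrict, comp]
    generalize_proofs
    dsimp only [restrict, comp, HorIso.trans, mapHorIso] at *
    -- The comparison 2-cell of `G` is invertible, so `δ` at `G` of a composite is the conjugate of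
    -- `δ` at the composite of the images, to which the composition axiom applies.
    have e : β.δ (G.mapH (𝒜.hc f g)) =
        vP (vP (hP (F'.mapHorCell (G.hComp f g).hom) (𝒞.vId (β.app (G.obj C))) rfl rfl)
          (β.δ _) (𝒞.v1_vc _) (𝒞.v1_vc _))
        (hP (𝒞.vId (β.app (G.obj A))) (G'.mapHorCell (G.hComp f g).inv) rfl rfl)
          (𝒞.v1_vc _) (𝒞.v1_vc _) := by
      rw [hβ.δ_mapHorCell, vPa, vP_vId_hP, ← mapHorCell_vP, HorIso.hom_inv, mapHorCell_vId,
        vId_hP, vP_vId]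
    rw [e, hβ.δ_hc]
    simp only [vPa, vId_hP_dist, hP_vId_dist]
  δ_h1 A := by
    dsimp only [restrict, comp]
    generalize_proofs
    dsimp only [restrict, comp, HorIso.trans, mapHorIso] at *
    simp only [vPa, vId_hP_dist, hP_vId_dist]
    rw [vP_reassoc (hβ.δ_mapHorCell _), vPa' (hP (𝒞.vId (β.app (G.obj A))) _ _ _), vP_vId_hP,
      ← mapHorCell_vP, HorIso.inv_hom, mapHorCell_vId, vId_hP, vId_vP, hβ.δ_h1]

theorem trans_isPsNat {F G K : DoublePsFunctor 𝒜 ℬ} {α : HorTransData F G} (hα : α.IsPsNat)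
    {β : HorTransData G K} (hβ : β.IsPsNat) : (α.trans β).IsPsNat where
  nat {A B A' B' f u v g} a := by
    dsimp only [trans]
    generalize_proofs
    rw [hPa' (F.mapSq a), vPa', vP_bot_left, hα.nat,
      ← vP_top_left _ _ _ _ (ℬ.hc_assoc _ _ _) (ℬ.hc_assoc _ _ _) _ _ (ℬ.v1_vc _), vPa, hPa,
      vP_bot_right, hβ.nat,
      ← vP_top_right _ _ _ _ (ℬ.hc_assoc _ _ _).symm (ℬ.hc_assoc _ _ _).symm _ _ (ℬ.v1_vc _), vPa,
      hPa]
  sq_vc {A A' A''} u v := by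
    dsimp only [trans]
    generalize_proofs
    rw [hPa', hα.sq_vc, hPa, hβ.sq_vc, hPa', vP_hP_hP]
  sq_v1 A := by
    dsimp only [trans]
    generalize_proofs
    rw [hPa', hα.sq_v1, hPa, hβ.sq_v1, hPa', vId_hP]
  δ_hc {A B C} f g := by
    dsimp only [trans]
    generalize_proofs
    rw [hα.δ_hc, hβ.δ_hc]
    simp only [vPa, vId_hP_dist, hP_vId_dist, hPa, vId_hP_hP, vId_hP]
    -- The comparison 2-cell of the middle functor `G` meets its inverse and disappears. Then
    -- `δ_{α,f}` and `δ_{β,g}`, acting on different factors, change places.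
    rw [vPa' (hP (ℬ.vId (α.app A)) _ _ _), vP_vId_hP, vP_hP_vId, HorIso.inv_hom, vId_hP, vId_hP,
      vId_vP, vP_reassoc (vP_exchange (α.δ f) (β.δ g) _ _ _ _ _ _)]
    -- Both sides now paste the same 2-cells in the same order and differ only in the bracketing of
    -- intermediate 1-cells.
    apply eq_of_heq
    repeat' first
      | with_reducible rfl
      | exact hP_heq_hP _ _ _ _ _ _
      | apply vP_heq_vP
      | simp only [ℬ.hc_assoc]
  δ_h1 A := by
    dsimp only [trans]
    generalize_proofs
    have e : ℬ.vId (ℬ.hc (α.app A) (β.app A)) =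
      hP (ℬ.vId (α.app A)) (ℬ.vId (β.app A)) rfl rfl := (vId_hP _ _).symm
    rw [e, vPa (hP (α.δ _) _ _ _), hPa' (F.hUnit A).inv, vPa', vP_hP_vId, hα.inv_vP_δ_h1, hPa,
      hPa (ℬ.vId (α.app A)), vP_vId_hP, vP_vId_hP, hβ.δ_h1]

end HorTransData

/-! ### Transposition -/

namespace DoubleCat

variable {D : DoubleCat.{u, v, w, x}}

/-- The identity of a vertical 1-cell, as an invertible 2-cell. -/
def VerIso.refl {A B : D.Obj} (f : D.Ver A B) : D.VerIso f f where
  hom := D.hId f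
  inv := D.hId f
  hom_inv := hId_hP _ _ _
  inv_hom := hId_hP _ _ _

/-- Vertical pasting of horizontally invertible 2-cells. -/
def VerIso.paste {A B C : D.Obj} {f g : D.Ver A B} {f' g' : D.Ver B C} {p q : D.Ver A C}
    (i : D.VerIso f g) (j : D.VerIso f' g') (left : D.vc f f' = p) (right : D.vc g g' = q) :
    D.VerIso p q where
  hom := vP i.hom j.hom left right
  inv := vP i.inv j.inv right left
  hom_inv := by rw [hP_vP_vP, i.hom_inv, j.hom_inv, hId_vP]
  inv_hom := by rw [hP_vP_vP, i.inv_hom, j.inv_hom, hId_vP]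

/-- Inverses are unique. This turns the heterogeneous coherence laws of a pseudofunctor into laws
for the inverse comparison 2-cells, which are those of the transposed functor. -/
theorem HorIso.inv_heq {A B : D.Obj} {f f' g g' : D.Hor A B} (i : D.HorIso f g)
    (j : D.HorIso f' g') (ef : f = f') (eg : g = g') (e : HEq i.hom j.hom) :
    HEq i.inv j.inv := by
  subst ef eg
  refine heq_of_eq (i.hom_vP_inj (D.v1_vc _) (D.v1_vc _) ?_)
  rw [i.hom_inv, eq_of_heq e, j.hom_inv]

theorem VerIso.inv_heq {A B : D.Obj} {f f' g g' : D.Ver A B} (i : D.VerIso f g)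
    (j : D.VerIso f' g') (ef : f = f') (eg : g = g') (e : HEq i.hom j.hom) :
    HEq i.inv j.inv := by
  subst ef eg
  refine heq_of_eq ?_
  rw [← i.inv_hom_hP j.inv (D.h1_hc _) (D.h1_hc _) (D.h1_hc _) (D.h1_hc _), eq_of_heq e,
    j.hom_inv, hP_hId]

/-- A vertically invertible 2-cell, in the transposed double category. -/
def HorIso.transpose {A B : D.Obj} {f g : D.Hor A B} (i : D.HorIso f g) :
    D.transpose.VerIso g f where
  hom := i.inv
  inv := i.hom
  hom_inv := i.inv_hom
  inv_hom := i.hom_inv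

/-- A horizontally invertible 2-cell, in the transposed double category. -/
def VerIso.transpose {A B : D.Obj} {f g : D.Ver A B} (i : D.VerIso f g) :
    D.transpose.HorIso g f where
  hom := i.inv
  inv := i.hom
  hom_inv := i.inv_hom
  inv_hom := i.hom_inv

end DoubleCat

/-- The double pseudofunctor between the transposed double categories. -/
def DoublePsFunctor.transpose {𝒜 ℬ : DoubleCat.{u, v, w, x}} (F : DoublePsFunctor 𝒜 ℬ) :
    DoublePsFunctor 𝒜.transpose ℬ.transpose where
  obj := F.obj
  mapH := F.mapV
  mapV := F.mapH
  mapSq := F.mapSq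
  -- The comparison 2-cells for 1h-cells split a composite, those for 1v-cells merge one.
  -- Transposition therefore has to replace each of them by its inverse.
  hComp f g := (F.vComp f g).transpose
  hUnit A := (F.vUnit A).transpose
  vComp f g := (F.hComp f g).transpose
  vUnit A := (F.hUnit A).transpose
  hComp_nat {A B C A' B' C' f f' u v w g g'} a b := by
    change hP (F.vComp f f').inv (vP (F.mapSq a) (F.mapSq b) rfl rfl) (ℬ.h1_hc _) (ℬ.h1_hc _) =
      hP (F.mapSq (𝒜.vcomp a b)) (F.vComp g g').inv (ℬ.hc_h1 _) (ℬ.hc_h1 _)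
    have e := F.vComp_nat a b
    rw [← VerIso.inv_hom_hP (F.vComp f f') (F.mapSq (𝒜.vcomp a b)) (ℬ.h1_hc _) (ℬ.h1_hc _)
      (ℬ.h1_hc _) (ℬ.h1_hc _), ← e, hPa, VerIso.hP_hom_inv]
  hUnit_nat {A A'} u := by
    change hP (F.vUnit A).inv (ℬ.vId (F.mapH u)) (ℬ.h1_hc _) (ℬ.h1_hc _) =
      hP (F.mapSq (𝒜.vId u)) (F.vUnit A').inv (ℬ.hc_h1 _) (ℬ.hc_h1 _)
    have e := F.vUnit_nat u
    rw [← VerIso.inv_hom_hP (F.vUnit A) (F.mapSq (𝒜.vId u)) (ℬ.h1_hc _) (ℬ.h1_hc _)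
      (ℬ.h1_hc _) (ℬ.h1_hc _), ← e, hPa, VerIso.hP_hom_inv]
  vComp_nat {A B A' B' A'' B'' f g h u v u' v'} a b := by
    change vP (hP (F.mapSq a) (F.mapSq b) rfl rfl) (F.hComp v v').inv (ℬ.vc_v1 _) (ℬ.vc_v1 _) =
      vP (F.hComp u u').inv (F.mapSq (𝒜.hcomp a b)) (ℬ.v1_vc _) (ℬ.v1_vc _)
    have e := F.hComp_nat a b
    refine (F.hComp u u').hom_vP_inj (ℬ.v1_vc _) (ℬ.v1_vc _) ?_
    rw [HorIso.hom_inv_vP, vPa', e, vPa, HorIso.hom_inv, vP_vId]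
  vUnit_nat {A B} f := by
    change vP (ℬ.hId (F.mapV f)) (F.hUnit B).inv (ℬ.vc_v1 _) (ℬ.vc_v1 _) =
      vP (F.hUnit A).inv (F.mapSq (𝒜.hId f)) (ℬ.v1_vc _) (ℬ.v1_vc _)
    have e := F.hUnit_nat f
    refine (F.hUnit A).hom_vP_inj (ℬ.v1_vc _) (ℬ.v1_vc _) ?_
    rw [HorIso.hom_inv_vP, vPa', e, vPa, HorIso.hom_inv, vP_vId]
  hComp_assoc {A B C D} f g h :=
    VerIso.inv_heq
      (((VerIso.refl (F.mapV f)).paste (F.vComp g h) rfl rfl).trans (F.vComp f (𝒜.vc g h)))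
      (((F.vComp f g).paste (VerIso.refl (F.mapV h)) rfl rfl).trans (F.vComp (𝒜.vc f g) h))
      (ℬ.vc_assoc _ _ _).symm (congrArg F.mapV (𝒜.vc_assoc f g h).symm) (F.vComp_assoc f g h)
  h1_hComp {A B} f :=
    VerIso.inv_heq
      (((F.vUnit A).paste (VerIso.refl (F.mapV f)) (ℬ.v1_vc _) rfl).trans (F.vComp (𝒜.v1 A) f))
      (VerIso.refl (F.mapV f)) rfl (congrArg F.mapV (𝒜.v1_vc f)) (F.v1_vComp f)
  hComp_h1 {A B} f :=
    VerIso.inv_heq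
      (((VerIso.refl (F.mapV f)).paste (F.vUnit B) (ℬ.vc_v1 _) rfl).trans (F.vComp f (𝒜.v1 B)))
      (VerIso.refl (F.mapV f)) rfl (congrArg F.mapV (𝒜.vc_v1 f)) (F.vComp_v1 f)
  vComp_assoc {A B C D} f g h :=
    HorIso.inv_heq
      ((F.hComp f (𝒜.hc g h)).trans ((HorIso.refl (F.mapH f)).paste (F.hComp g h) rfl rfl))
      ((F.hComp (𝒜.hc f g) h).trans ((F.hComp f g).paste (HorIso.refl (F.mapH h)) rfl rfl))
      (congrArg F.mapH (𝒜.hc_assoc f g h).symm) (ℬ.hc_assoc _ _ _).symm (F.hComp_assoc f g h)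
  v1_vComp {A B} f :=
    HorIso.inv_heq
      ((F.hComp (𝒜.h1 A) f).trans ((F.hUnit A).paste (HorIso.refl (F.mapH f)) rfl (ℬ.h1_hc _)))
      (HorIso.refl (F.mapH f)) (congrArg F.mapH (𝒜.h1_hc f)) rfl (F.h1_hComp f)
  vComp_v1 {A B} f :=
    HorIso.inv_heq
      ((F.hComp f (𝒜.h1 B)).trans ((HorIso.refl (F.mapH f)).paste (F.hUnit B) rfl (ℬ.hc_h1 _)))
      (HorIso.refl (F.mapH f)) (congrArg F.mapH (𝒜.hc_h1 f)) rfl (F.hComp_h1 f)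

section Transpose

variable {𝒜 ℬ : DoubleCat.{u, v, w, x}} {F G : DoublePsFunctor 𝒜 ℬ}

/-- A vertical transformation, as a horizontal one between the transposed functors. -/
def VerTransData.transpose (α : VerTransData F G) : HorTransData F.transpose G.transpose where
  app := α.app
  sq := α.sq
  δ := α.δ

/-- A horizontal transformation, as a vertical one between the transposed functors. -/
def HorTransData.transpose (α : HorTransData F G) : VerTransData F.transpose G.transpose where
  app := α.app
  sq := α.sq
  δ := α.δ

theorem VerTransData.IsPsNat.transpose {α : VerTransData F G} (hα : α.IsPsNat) :
    α.transpose.IsPsNat where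
  nat a := hα.nat a
  sq_vc u v := hα.sq_hc u v
  sq_v1 A := hα.sq_h1 A
  δ_hc f g := hα.δ_vc f g
  δ_h1 A := hα.δ_v1 A

theorem VerTransData.IsPsNat.of_transpose {α : VerTransData F G} (hα : α.transpose.IsPsNat) :
    α.IsPsNat where
  nat a := hα.nat a
  sq_hc u v := hα.sq_vc u v
  sq_h1 A := hα.sq_v1 A
  δ_vc f g := hα.δ_hc f g
  δ_v1 A := hα.δ_h1 A

theorem HorTransData.IsPsNat.transpose {α : HorTransData F G} (hα : α.IsPsNat) :
    α.transpose.IsPsNat where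
  nat a := hα.nat a
  sq_hc u v := hα.sq_vc u v
  sq_h1 A := hα.sq_v1 A
  δ_vc f g := hα.δ_hc f g
  δ_v1 A := hα.δ_h1 A

/-- The transpose of a double transformation. -/
def DoubleTransData.transpose (α : DoubleTransData F G) :
    DoubleTransData F.transpose G.transpose where
  ver := α.hor.transpose
  hor := α.ver.transpose
  t := α.r
  r := α.t

/-- All axioms of `α` come in transposed pairs. For (T2) a transformation into the transposed double
category is transposed back; transposing twice gives the original data definitionally. -/
theorem DoubleTransData.IsDoublePsNat.transpose {α : DoubleTransData F G}
    (hα : α.IsDoublePsNat) : α.transpose.IsDoublePsNat where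
  T1_ver := hα.T1_hor.transpose
  T1_hor := hα.T1_ver.transpose
  T2_hor γ hγ X := hα.T2_ver γ.transpose hγ.transpose X
  T2_ver γ hγ X := hα.T2_hor γ.transpose hγ.transpose X
  T3_1_t a := hα.T3_1_r a
  T3_1_r a := hα.T3_1_t a
  T3_2_t f g := hα.T3_2_r f g
  T3_2_r f g := hα.T3_2_t f g
  T3_3_t f g := hα.T3_3_r f g
  T3_3_r f g := hα.T3_3_t f g

end Transpose

/-! ### Axiom (T1) for the composite -/

section Hcomp

variable {𝒜 ℬ 𝒞 : DoubleCat.{u, v, w, x}} {F G : DoublePsFunctor 𝒜 ℬ}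
  {F' G' : DoublePsFunctor ℬ 𝒞}

/-- By definition the composite is the image of `α` under `F'` followed by the restriction of `β`
along `G`. -/
theorem HorTransData.hcomp_isPsNat {α : HorTransData F G} {β : HorTransData F' G'}
    (hα : α.IsPsNat) (hβ : β.IsPsNat) : (α.hcomp β).IsPsNat :=
  trans_isPsNat (image_isPsNat hα F') (restrict_isPsNat G hβ)

theorem VerTransData.hcomp_isPsNat {α : VerTransData F G} {β : VerTransData F' G'}
    (hα : α.IsPsNat) (hβ : β.IsPsNat) : (α.hcomp β).IsPsNat := by
  have h := HorTransData.hcomp_isPsNat hα.transpose hβ.transpose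
  -- Transposing the composite functors and composing the transposed ones agree definitionally; the
  -- axioms are matched one at a time.
  exact .of_transpose ⟨h.nat, h.sq_vc, h.sq_v1, h.δ_hc, h.δ_h1⟩

end Hcomp

/-! ### Images of 2-cells whose right side is an identity -/

namespace DoublePsFunctor

variable {ℬ 𝒞 : DoubleCat.{u, v, w, x}} (H : DoublePsFunctor ℬ 𝒞)

/-- The effect of `H` on 2-cells whose right side is an identity. -/
def mapRightCell {A B A' : ℬ.Obj} {k : ℬ.Hor A B} {p : ℬ.Ver A A'} {l : ℬ.Hor A' B}
    (s : ℬ.Sq k p (ℬ.v1 B) l) : 𝒞.Sq (H.mapH k) (H.mapV p) (𝒞.v1 (H.obj B)) (H.mapH l) :=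
  H.mapSq s ▥ (H.vUnit B).inv

theorem mapRightCell_vP_top {A B A' : ℬ.Obj} {k' k : ℬ.Hor A B} {p : ℬ.Ver A A'}
    {l : ℬ.Hor A' B} (a : ℬ.Sq k' (ℬ.v1 A) (ℬ.v1 B) k) (s : ℬ.Sq k p (ℬ.v1 B) l)
    (h1 : ℬ.vc (ℬ.v1 A) p = p) (h2 : ℬ.vc (ℬ.v1 B) (ℬ.v1 B) = ℬ.v1 B) :
    H.mapRightCell (vP a s h1 h2) =
      vP (H.mapHorCell a) (H.mapRightCell s) (𝒞.v1_vc _) (𝒞.v1_vc _) := by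
  rw [mapRightCell, mapSq_vP_top, vP_hP_of_v1]
  rfl

theorem mapRightCell_vP_bot {A B A' : ℬ.Obj} {k : ℬ.Hor A B} {p : ℬ.Ver A A'}
    {l l' : ℬ.Hor A' B} (s : ℬ.Sq k p (ℬ.v1 B) l) (a : ℬ.Sq l (ℬ.v1 A') (ℬ.v1 B) l')
    (h1 : ℬ.vc p (ℬ.v1 A') = p) (h2 : ℬ.vc (ℬ.v1 B) (ℬ.v1 B) = ℬ.v1 B) :
    H.mapRightCell (vP s a h1 h2) =
      vP (H.mapRightCell s) (H.mapHorCell a) (𝒞.vc_v1 _) (𝒞.vc_v1 _) := by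
  rw [mapRightCell, mapSq_vP_bot, vP_hP_of_v1']
  rfl

/-- The unit comparison 2-cell sits at the far right and does not interfere with naturality of the
comparison 2-cells. -/
theorem hC_vP_hP_mapRightCell {A B C A' B' : ℬ.Obj} {f : ℬ.Hor A B} {g : ℬ.Hor B C}
    {f' : ℬ.Hor A' B'} {g' : ℬ.Hor B' C} {p : ℬ.Ver A A'} {q : ℬ.Ver B B'}
    {k : ℬ.Hor A C} {k' : ℬ.Hor A' C} (a : ℬ.Sq f p q f') (s : ℬ.Sq g q (ℬ.v1 C) g')
    (h1 : ℬ.hc f g = k) (h2 : ℬ.hc f' g' = k') :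
    vP (H.hC f g h1).hom (hP (H.mapSq a) (H.mapRightCell s) rfl rfl)
        (𝒞.v1_vc _) (𝒞.v1_vc _) =
      vP (H.mapRightCell (hP a s h1 h2)) (H.hC f' g' h2).hom (𝒞.vc_v1 _) (𝒞.vc_v1 _) := by
  have e : hP (H.mapSq a) (H.mapRightCell s) rfl rfl =
      hP (hP (H.mapSq a) (H.mapSq s) rfl rfl) (H.vUnit C).inv (𝒞.hc_h1 _) (𝒞.hc_h1 _) := by
    rw [mapRightCell, hPa']
  rw [e, ← vP_hP_of_v1, H.hC_nat a s h1 h2, vP_hP_of_v1']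
  rfl

theorem hC_vP_mapRightCell_hP {A B C A' : ℬ.Obj} {f : ℬ.Hor A B} {g : ℬ.Hor B C}
    {f' : ℬ.Hor A' B} {p : ℬ.Ver A A'} {k : ℬ.Hor A C} {k' : ℬ.Hor A' C}
    (s : ℬ.Sq f p (ℬ.v1 B) f') (h1 : ℬ.hc f g = k) (h2 : ℬ.hc f' g = k') :
    vP (H.hC f g h1).hom (hP (H.mapRightCell s) (𝒞.vId (H.mapH g)) rfl rfl)
        (𝒞.v1_vc _) (𝒞.v1_vc _) =
      vP (H.mapRightCell (hP s (ℬ.vId g) h1 h2)) (H.hC f' g h2).hom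
        (𝒞.vc_v1 _) (𝒞.vc_v1 _) := by
  -- The inverse unit 2-cell slides from the left of `H(g)` to its right, because `mapHorCell`
  -- preserves the identity of `g`. This reduces the claim to the preceding lemma.
  have e : hP (H.mapRightCell s) (𝒞.vId (H.mapH g)) rfl rfl =
      hP (H.mapSq s) (H.mapRightCell (ℬ.vId g)) rfl rfl := by
    have h := H.mapHorCell_vId g
    rw [mapHorCell, hPa] at h
    rw [mapRightCell, hPa]
    congr 1
    rw [← h, VerIso.inv_hom_hP]
    rfl
  rw [e, hC_vP_hP_mapRightCell]

/-- By the unit law, the inverse unit 2-cell below `H(q)` is the comparison 2-cell of `q` with an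
identity, so naturality of the vertical comparison applies. In the next lemma it lies above `H(q)`.
-/
theorem mapSq_vP_mapRightCell {A B A' B' A'' : ℬ.Obj} {f : ℬ.Hor A B} {g : ℬ.Hor A' B'}
    {h : ℬ.Hor A'' B'} {p : ℬ.Ver A A'} {q : ℬ.Ver B B'} {r : ℬ.Ver A' A''}
    (a : ℬ.Sq f p q g) (s : ℬ.Sq g r (ℬ.v1 B') h) (e : ℬ.vc q (ℬ.v1 B') = q) :
    vP (H.mapSq a) (H.mapRightCell s) rfl (𝒞.vc_v1 _) =
      hP (H.vComp p r).hom (H.mapSq (vP a s rfl e)) (𝒞.h1_hc _) (𝒞.h1_hc _) := by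
  have n := H.vC_nat a s rfl e
  rw [← H.vUnit_inv_vP' q e] at n
  erw [← n]
  rw [hP_vP_vP, hP_hId]
  rfl

theorem mapRightCell_vP_mapSq {A B A' B' A'' : ℬ.Obj} {f : ℬ.Hor A B} {g : ℬ.Hor A' B}
    {h : ℬ.Hor A'' B'} {p : ℬ.Ver A A'} {q : ℬ.Ver B B'} {r : ℬ.Ver A' A''}
    (s : ℬ.Sq f p (ℬ.v1 B) g) (a : ℬ.Sq g r q h) (e : ℬ.vc (ℬ.v1 B) q = q) :
    vP (H.mapRightCell s) (H.mapSq a) rfl (𝒞.v1_vc _) =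
      hP (H.vComp p r).hom (H.mapSq (vP s a rfl e)) (𝒞.h1_hc _) (𝒞.h1_hc _) := by
  have n := H.vC_nat s a rfl e
  rw [← H.vUnit_inv_vP q e] at n
  erw [← n]
  rw [hP_vP_vP, hP_hId]
  rfl

/-- The effect of `H` on 2-cells whose top is a composite and whose right side is an identity. -/
def splitRightCell {A B C A' : ℬ.Obj} {f : ℬ.Hor A B} {g : ℬ.Hor B C} {p : ℬ.Ver A A'}
    {l : ℬ.Hor A' C} (s : ℬ.Sq (ℬ.hc f g) p (ℬ.v1 C) l) :
    𝒞.Sq (𝒞.hc (H.mapH f) (H.mapH g)) (H.mapV p) (𝒞.v1 (H.obj C)) (H.mapH l) :=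
  (H.hComp f g).inv ▤ H.mapRightCell s

theorem hComp_vP_splitRightCell {A B C A' : ℬ.Obj} {f : ℬ.Hor A B} {g : ℬ.Hor B C}
    {p : ℬ.Ver A A'} {l : ℬ.Hor A' C} (s : ℬ.Sq (ℬ.hc f g) p (ℬ.v1 C) l) :
    vP (H.hComp f g).hom (H.splitRightCell s) (𝒞.v1_vc _) (𝒞.v1_vc _) = H.mapRightCell s :=
  HorIso.hom_inv_vP _ _ _ _ _ _

theorem hC3_vP_splitRightCell_hP {A B C E A' : ℬ.Obj} {f : ℬ.Hor A B} {g : ℬ.Hor B C}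
    {p : ℬ.Ver A A'} {l : ℬ.Hor A' C} (s : ℬ.Sq (ℬ.hc f g) p (ℬ.v1 C) l) (h : ℬ.Hor C E) :
    vP (H.hC3 f g h).hom (hP (H.splitRightCell s) (𝒞.vId (H.mapH h)) (𝒞.hc_assoc _ _ _) rfl)
        (𝒞.v1_vc _) (𝒞.v1_vc _) =
      vP (H.mapRightCell (hP s (ℬ.vId h) (ℬ.hc_assoc _ _ _) rfl)) (H.hComp l h).hom
        (𝒞.vc_v1 _) (𝒞.vc_v1 _) := by
  rw [hC3_hom', vPa, vP_hP_vId, hComp_vP_splitRightCell]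
  exact H.hC_vP_mapRightCell_hP s _ rfl

theorem hC3_vP_hP_splitRightCell {A B C E A' B' : ℬ.Obj} {f : ℬ.Hor A B} {g : ℬ.Hor B C}
    {h : ℬ.Hor C E} {p : ℬ.Ver A A'} {q : ℬ.Ver B B'} {f' : ℬ.Hor A' B'} {l : ℬ.Hor B' E}
    (a : ℬ.Sq f p q f') (s : ℬ.Sq (ℬ.hc g h) q (ℬ.v1 E) l) :
    vP (H.hC3 f g h).hom (hP (H.mapSq a) (H.splitRightCell s) rfl rfl)
        (𝒞.v1_vc _) (𝒞.v1_vc _) =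
      vP (H.mapRightCell (hP a s rfl rfl)) (H.hComp f' l).hom (𝒞.vc_v1 _) (𝒞.vc_v1 _) := by
  rw [hC3_hom, vPa, vP_top_right, hComp_vP_splitRightCell]
  exact H.hC_vP_hP_mapRightCell a s rfl rfl

end DoublePsFunctor

/-! ### The axioms (T3) for the image of `t` under a double pseudofunctor -/

namespace DoubleTransData

variable {𝒜 ℬ 𝒞 : DoubleCat.{u, v, w, x}} {F G : DoublePsFunctor 𝒜 ℬ} {α : DoubleTransData F G}

namespace IsDoublePsNat

/-- The image under `H` of the first axiom (T3-1). Below the horizontal comparison 2-cell both sides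
become the vertical comparison 2-cell pasted with `H` of one side of that axiom. -/
theorem splitRightCell_nat (hα : α.IsDoublePsNat) (H : DoublePsFunctor ℬ 𝒞)
    {A B A' B' : 𝒜.Obj} {f : 𝒜.Hor A B} {u : 𝒜.Ver A A'} {v : 𝒜.Ver B B'}
    {g : 𝒜.Hor A' B'} (a : 𝒜.Sq f u v g) :
    vP (hP (H.mapSq (F.mapSq a)) (H.mapSq (α.hor.sq v)) rfl rfl) (H.splitRightCell (α.t g))
        rfl (𝒞.vc_v1 _) =
      hP (α.ver.imageδ H u)
        (vP (H.splitRightCell (α.t f)) (H.mapSq (G.mapSq a)) rfl (𝒞.v1_vc _))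
        (𝒞.h1_hc _) (𝒞.h1_hc _) := by
  refine (H.hComp _ _).hom_vP_inj (𝒞.v1_vc _) (𝒞.v1_vc _) ?_
  rw [vP_hP_of_h1, vPa', vPa', hComp_vP, vPa, hComp_vP_splitRightCell,
    hComp_vP_splitRightCell, mapRightCell_vP_mapSq _ _ _ (ℬ.v1_vc _),
    mapSq_vP_mapRightCell _ _ _ (ℬ.vc_v1 _), hα.T3_1_t, VerTransData.imageδ, hPa, hPa,
    VerIso.inv_hom_hP, mapSq_hP_left]

/-- The image under `H` of the first axiom (T3-2), compared below the triple comparison 2-cell. -/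
theorem splitRightCell_δ (hα : α.IsDoublePsNat) (H : DoublePsFunctor ℬ 𝒞) {A B C : 𝒜.Obj}
    (f : 𝒜.Hor A B) (g : 𝒜.Hor B C) :
    vP (hP (𝒞.vId (H.mapH (F.mapH f))) (α.hor.imageδ H g) rfl rfl)
        (hP (H.splitRightCell (α.t f)) (𝒞.vId (H.mapH (G.mapH g))) (𝒞.hc_assoc _ _ _) rfl)
        (𝒞.v1_vc _) (𝒞.v1_vc _) =
      hP (H.mapSq (α.ver.sq f)) (H.splitRightCell (α.t g)) rfl rfl := by
  refine (H.hC3 _ _ _).hom_vP_inj (𝒞.v1_vc _) (𝒞.v1_vc _) ?_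
  erw [vP_reassoc (H.hC3_vP_left _ _)]
  rw [hC3_vP_splitRightCell_hP, hC3_vP_hP_splitRightCell, vPa',
    ← mapRightCell_vP_top _ _ _ (ℬ.v1_vc _) (ℬ.v1_vc _),
    hα.T3_2_t]

/-- The image under `H` of the first axiom (T3-3); the cells around the middle are the comparison
2-cells of the composite functors. -/
theorem splitRightCell_hc (hα : α.IsDoublePsNat) (H : DoublePsFunctor ℬ 𝒞) {A B C : 𝒜.Obj}
    (f : 𝒜.Hor A B) (g : 𝒜.Hor B C) :
    H.splitRightCell (α.t (𝒜.hc f g)) =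
      vP (hP (vP (H.mapHorCell (F.hComp f g).hom) (H.hComp (F.mapH f) (F.mapH g)).hom
            (𝒞.v1_vc _) (𝒞.v1_vc _)) (𝒞.vId (H.mapH (α.hor.app C))) rfl (𝒞.hc_assoc _ _ _))
        (vP (hP (H.mapSq (α.ver.sq f)) (H.splitRightCell (α.t g)) rfl rfl)
          (vP (H.hComp (G.mapH f) (G.mapH g)).inv (H.mapHorCell (G.hComp f g).inv)
            (𝒞.v1_vc _) (𝒞.v1_vc _))
          (𝒞.vc_v1 _) (𝒞.vc_v1 _)) (𝒞.v1_vc _) (𝒞.v1_vc _) := by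
  refine (H.hComp _ _).hom_vP_inj (𝒞.v1_vc _) (𝒞.v1_vc _) ?_
  rw [vP_reassoc (H.hC_vP_fork _ _), vPa' (H.hC3 _ _ _).hom, hC3_vP_hP_splitRightCell, vPa,
    HorIso.hom_inv_vP, hComp_vP_splitRightCell, hα.T3_3_t, mapRightCell_vP_top,
    mapRightCell_vP_bot]

end IsDoublePsNat

end DoubleTransData

/-! ### Sliding 2-cells with identity top and bottom -/

namespace DoubleCat

variable {D : DoubleCat.{u, v, w, x}}

/-- Since `s` has an identity on its right, `z` may be extended upwards by an identity 2-cell; then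
interchange applies. The three lemmas after it are the analogues below and on the left. -/
theorem vP_hP_right {A B A' A'' B' : D.Obj} {f : D.Hor A B} {g : D.Hor A' B} {h : D.Hor A'' B'}
    {p : D.Ver A A'} {p' : D.Ver A' A''} {pp : D.Ver A A''} {q q' : D.Ver B B'}
    (s : D.Sq f p (D.v1 B) g) (t : D.Sq g p' q h) (z : D.Sq (D.h1 B) q q' (D.h1 B'))
    (h1 : D.vc p p' = pp) :
    vP s (hP t z (D.hc_h1 _) (D.hc_h1 _)) h1 (D.v1_vc _) =
      hP (vP s t h1 (D.v1_vc _)) z (D.hc_h1 _) (D.hc_h1 _) := by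
  have e : z = vP (D.hId (D.v1 B)) z (D.v1_vc _) (D.v1_vc _) := by rw [← D.vId_h1, vId_vP]
  conv_rhs => rw [e]
  rw [hP_vP_vP, hP_hId]

theorem hP_vP_right {A B A' A'' B' : D.Obj} {f : D.Hor A B} {g : D.Hor A' B'} {h : D.Hor A'' B'}
    {p : D.Ver A A'} {p' : D.Ver A' A''} {pp : D.Ver A A''} {q q' : D.Ver B B'}
    (s : D.Sq f p q g) (z : D.Sq (D.h1 B) q q' (D.h1 B')) (t : D.Sq g p' (D.v1 B') h)
    (h1 : D.vc p p' = pp) :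
    vP (hP s z (D.hc_h1 _) (D.hc_h1 _)) t h1 (D.vc_v1 _) =
      hP (vP s t h1 (D.vc_v1 _)) z (D.hc_h1 _) (D.hc_h1 _) := by
  have e : z = vP z (D.hId (D.v1 B')) (D.vc_v1 _) (D.vc_v1 _) := by rw [← D.vId_h1, vP_vId]
  conv_rhs => rw [e]
  rw [hP_vP_vP, hP_hId]

theorem hP_vP_left {A B A' B' A'' B'' : D.Obj} {f : D.Hor A B} {g : D.Hor A' B'}
    {h : D.Hor A'' B''} {p p' : D.Ver A A'} {q : D.Ver A' A''} {pp pp' : D.Ver A A''}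
    {r : D.Ver B B'} {r' : D.Ver B' B''} {rr : D.Ver B B''}
    (z : D.Sq (D.h1 A) p p' (D.h1 A')) (s : D.Sq f p' r g) (t : D.Sq g q r' h)
    (h1 : D.vc p q = pp) (h1' : D.vc p' q = pp') (h2 : D.vc r r' = rr) :
    vP (hP z s (D.h1_hc _) (D.h1_hc _)) t h1 h2 =
      hP (vP z (D.hId q) h1 h1') (vP s t h1' h2) (D.h1_hc _) (D.h1_hc _) := by
  rw [hP_vP_vP, hId_hP]

theorem vP_hP_left {A B A' B' A'' B'' : D.Obj} {f : D.Hor A B} {g : D.Hor A' B'}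
    {h : D.Hor A'' B''} {p p' : D.Ver A' A''} {q : D.Ver A A'} {pp pp' : D.Ver A A''}
    {r : D.Ver B B'} {r' : D.Ver B' B''} {rr : D.Ver B B''}
    (z : D.Sq (D.h1 A') p p' (D.h1 A'')) (s : D.Sq f q r g) (t : D.Sq g p' r' h)
    (h1 : D.vc q p = pp) (h1' : D.vc q p' = pp') (h2 : D.vc r r' = rr) :
    vP s (hP z t (D.h1_hc _) (D.h1_hc _)) h1 h2 =
      hP (vP (D.hId q) z h1 h1') (vP s t h1' h2) (D.h1_hc _) (D.h1_hc _) := by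
  rw [hP_vP_vP, hId_hP]

end DoubleCat

/-! ### Naturality of `δ` and `t` for globular 2-cells between composites -/

namespace HorTransData

variable {ℬ 𝒞 : DoubleCat.{u, v, w, x}} {F G : DoublePsFunctor ℬ 𝒞} {β : HorTransData F G}

/-- `δ_{β,gf}` without the comparison 2-cells. -/
def δ₂ (β : HorTransData F G) {A B C : ℬ.Obj} (f : ℬ.Hor A B) (g : ℬ.Hor B C) :
    𝒞.Sq (𝒞.hc (F.mapH f) (𝒞.hc (F.mapH g) (β.app C))) (𝒞.v1 _) (𝒞.v1 _)
      (𝒞.hc (β.app A) (𝒞.hc (G.mapH f) (G.mapH g))) :=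
  vP (hP (𝒞.vId (F.mapH f)) (β.δ g) rfl rfl)
    (hP (β.δ f) (𝒞.vId (G.mapH g)) (𝒞.hc_assoc _ _ _) (𝒞.hc_assoc _ _ _))
    (𝒞.v1_vc _) (𝒞.v1_vc _)

/-- The composition axiom with the comparison 2-cell of `G` moved to the other side. -/
theorem IsPsNat.hComp_vP_δ₂ (hβ : β.IsPsNat) {A B C : ℬ.Obj} (f : ℬ.Hor A B) (g : ℬ.Hor B C) :
    vP (hP (F.hComp f g).hom (𝒞.vId (β.app C)) rfl (𝒞.hc_assoc _ _ _)) (β.δ₂ f g)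
        (𝒞.v1_vc _) (𝒞.v1_vc _) =
      vP (β.δ (ℬ.hc f g)) (hP (𝒞.vId (β.app A)) (G.hComp f g).hom rfl rfl)
        (𝒞.v1_vc _) (𝒞.v1_vc _) := by
  rw [hβ.δ_hc, vPa, vPa, vPa, vP_vId_hP, HorIso.inv_hom, vId_hP, vP_vId, δ₂]

/-- `δ_mapHorCell` transported along the comparison 2-cells of source and target. It is needed in
transposed form, with `a` the 2-cell `δ_{α₀,u}`, whose sides are both composites. -/
theorem IsPsNat.δ₂_hConj (hβ : β.IsPsNat) {A B B' C : ℬ.Obj} {f : ℬ.Hor A B} {g : ℬ.Hor B C}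
    {f' : ℬ.Hor A B'} {g' : ℬ.Hor B' C}
    (a : ℬ.Sq (ℬ.hc f g) (ℬ.v1 A) (ℬ.v1 C) (ℬ.hc f' g')) :
    vP (β.δ₂ f g) (hP (𝒞.vId (β.app A)) (G.hConj a) rfl rfl) (𝒞.v1_vc _) (𝒞.v1_vc _) =
      vP (hP (F.hConj a) (𝒞.vId (β.app C)) (𝒞.hc_assoc _ _ _) (𝒞.hc_assoc _ _ _)) (β.δ₂ f' g')
        (𝒞.v1_vc _) (𝒞.v1_vc _) := by
  refine ((F.hComp f g).paste (HorIso.refl (β.app C)) rfl (𝒞.hc_assoc _ _ _)).hom_vP_inj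
    (𝒞.v1_vc _) (𝒞.v1_vc _) ?_
  dsimp only [HorIso.paste, HorIso.refl]
  rw [vPa', hβ.hComp_vP_δ₂, vPa, vP_vId_hP, hComp_vP_hConj, vPa', vP_hP_vId, hComp_vP_hConj,
    ← vP_hP_vId _ _ _ rfl rfl _ _ (𝒞.v1_vc _), vPa, hβ.hComp_vP_δ₂, vPa', hβ.δ_mapHorCell, vPa,
    vP_vId_hP]

end HorTransData

namespace DoubleTransData

variable {ℬ 𝒞 : DoubleCat.{u, v, w, x}} {F G : DoublePsFunctor ℬ 𝒞} {β : DoubleTransData F G}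

namespace IsDoublePsNat

theorem vUnit_hP_ver_δ_v1 (hβ : β.IsDoublePsNat) (A : ℬ.Obj) :
    hP (vP (F.vUnit A).hom (𝒞.hId (β.ver.app A)) (𝒞.v1_vc _) rfl) (β.ver.δ (ℬ.v1 A))
        (𝒞.h1_hc _) (𝒞.h1_hc _) =
      vP (𝒞.hId (β.ver.app A)) (G.vUnit A).hom (𝒞.vc_v1 _) rfl :=
  hβ.T1_ver.transpose.inv_vP_δ_h1 A

/-- (T3-1) at `a`, with unit comparison 2-cells on both sides: the right one passes through `β₁` by
`vUnit_inv_hP`, the left one absorbs `δ_{β₀}` at the identity. -/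
theorem t_mapHorCell (hβ : β.IsDoublePsNat) {A B : ℬ.Obj} {f g : ℬ.Hor A B}
    (a : ℬ.Sq f (ℬ.v1 A) (ℬ.v1 B) g) :
    vP (hP (F.mapHorCell a) (𝒞.vId (β.hor.app B)) rfl rfl) (β.t g) (𝒞.v1_vc _) (𝒞.v1_vc _) =
      vP (β.t f) (G.mapHorCell a) (𝒞.vc_v1 _) (𝒞.vc_v1 _) := by
  have e : hP (F.mapHorCell a) (𝒞.vId (β.hor.app B)) rfl rfl =
      hP (F.vUnit A).hom (hP (hP (F.mapSq a) (β.hor.sq (ℬ.v1 B)) rfl rfl) (G.vUnit B).inv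
        (𝒞.hc_h1 _) (𝒞.hc_h1 _)) (𝒞.h1_hc _) (𝒞.h1_hc _) := by
    rw [mapHorCell, hPa, hβ.T1_hor.vUnit_inv_hP, hPa, hPa (F.mapSq a)]
  rw [e, hP_vP_left _ _ _ _ rfl, hP_vP_right, hβ.T3_1_t, hPa, hPa', hβ.vUnit_hP_ver_δ_v1,
    ← vP_hP_right, ← vP_hP_left, mapHorCell, hPa]

/-- (T3-3) identifies `[(β₀)_f | t_g]` with `t` of the composite up to comparison 2-cells, which
reduces the claim to `t_mapHorCell`. It will be used with `a` the 2-cell `δ_{α₁,g}`. -/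
theorem δ_vP_t (hβ : β.IsDoublePsNat) {A B B' C : ℬ.Obj} {f : ℬ.Hor A B} {g : ℬ.Hor B C}
    {f' : ℬ.Hor A B'} {g' : ℬ.Hor B' C}
    (a : ℬ.Sq (ℬ.hc f g) (ℬ.v1 A) (ℬ.v1 C) (ℬ.hc f' g')) :
    vP (hP (F.hConj a) (𝒞.vId (β.hor.app C)) (𝒞.hc_assoc _ _ _) (𝒞.hc_assoc _ _ _))
        (hP (β.ver.sq f') (β.t g') rfl rfl) (𝒞.v1_vc _) (𝒞.v1_vc _) =
      vP (hP (β.ver.sq f) (β.t g) rfl rfl) (G.hConj a) (𝒞.vc_v1 _) (𝒞.vc_v1 _) := by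
  have h {A B C : ℬ.Obj} (f : ℬ.Hor A B) (g : ℬ.Hor B C) :
      vP (hP (F.hComp f g).hom (𝒞.vId (β.hor.app C)) rfl (𝒞.hc_assoc _ _ _))
        (hP (β.ver.sq f) (β.t g) rfl rfl) (𝒞.v1_vc _) (𝒞.v1_vc _) =
      vP (β.t (ℬ.hc f g)) (G.hComp f g).hom (𝒞.vc_v1 _) (𝒞.vc_v1 _) := by
    rw [hβ.T3_3_t, vPa, vPa, HorIso.inv_hom, vP_vId]
  refine ((F.hComp f g).paste (HorIso.refl (β.hor.app C)) rfl (𝒞.hc_assoc _ _ _)).hom_vP_inj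
    (𝒞.v1_vc _) (𝒞.v1_vc _) ?_
  dsimp only [HorIso.paste, HorIso.refl]
  rw [vPa', vP_hP_vId, hComp_vP_hConj, ← vP_hP_vId _ _ _ rfl rfl _ _ (𝒞.v1_vc _), vPa, h, vPa',
    hβ.t_mapHorCell, vPa' _ (hP (β.ver.sq f) _ _ _), h, vPa, vPa, hComp_vP_hConj]

end IsDoublePsNat

end DoubleTransData

/-! ### Invertibility, and renaming the boundary between two layers -/

namespace DoubleCat

variable {D : DoubleCat.{u, v, w, x}}

theorem HorIso.isHorInvertible {A B : D.Obj} {f g : D.Hor A B} (i : D.HorIso f g) :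
    IsHorInvertible i.hom :=
  ⟨i.inv, i.hom_inv, i.inv_hom⟩

theorem IsHorInvertible.exists_horIso {A B : D.Obj} {f g : D.Hor A B}
    {s : D.Sq f (D.v1 A) (D.v1 B) g} (h : IsHorInvertible s) : ∃ i : D.HorIso f g, i.hom = s :=
  let ⟨t, h1, h2⟩ := h
  ⟨⟨s, t, h1, h2⟩, rfl⟩

/-- The 1-cell between the rows is just a name for two equal composites. Different lemmas bracket it
differently, and this reconciles them. -/
theorem vP_hP_hP_mid {A B C A' B' C' A'' B'' C'' B₂ : D.Obj}
    {f : D.Hor A B} {f' : D.Hor B C} {u : D.Ver A A'} {v : D.Ver B B'} {w : D.Ver C C'}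
    {g : D.Hor A' B'} {g' : D.Hor B' C'} {l : D.Hor A' B₂} {l' : D.Hor B₂ C'}
    {u' : D.Ver A' A''} {v' : D.Ver B₂ B''} {w' : D.Ver C' C''} {k : D.Hor A'' B''}
    {k' : D.Hor B'' C''} {ff : D.Hor A C} {m m' : D.Hor A' C'} {kk : D.Hor A'' C''}
    {uu : D.Ver A A''} {ww : D.Ver C C''}
    (a : D.Sq f u v g) (b : D.Sq f' v w g') (c : D.Sq l u' v' k) (d : D.Sq l' v' w' k')
    (h1 : D.hc f f' = ff) (h2 : D.hc g g' = m) (h2' : D.hc l l' = m) (h3 : D.hc k k' = kk)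
    (h4 : D.vc u u' = uu) (h5 : D.vc w w' = ww) (h6 : D.hc g g' = m') (h6' : D.hc l l' = m') :
    vP (hP a b h1 h2) (hP c d h2' h3) h4 h5 = vP (hP a b h1 h6) (hP c d h6' h3) h4 h5 := by
  subst h2 h6
  rfl

theorem hP_vP_vP_mid {A B C A' B' C' A'' B'' C'' B₂ : D.Obj}
    {f : D.Ver A B} {f' : D.Ver B C} {u : D.Hor A A'} {v : D.Hor B B'} {w : D.Hor C C'}
    {g : D.Ver A' B'} {g' : D.Ver B' C'} {l : D.Ver A' B₂} {l' : D.Ver B₂ C'}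
    {u' : D.Hor A' A''} {v' : D.Hor B₂ B''} {w' : D.Hor C' C''} {k : D.Ver A'' B''}
    {k' : D.Ver B'' C''} {ff : D.Ver A C} {m m' : D.Ver A' C'} {kk : D.Ver A'' C''}
    {uu : D.Hor A A''} {ww : D.Hor C C''}
    (a : D.Sq u f g v) (b : D.Sq v f' g' w) (c : D.Sq u' l k v') (d : D.Sq v' l' k' w')
    (h1 : D.vc f f' = ff) (h2 : D.vc g g' = m) (h2' : D.vc l l' = m) (h3 : D.vc k k' = kk)
    (h4 : D.hc u u' = uu) (h5 : D.hc w w' = ww) (h6 : D.vc g g' = m') (h6' : D.vc l l' = m') :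
    hP (vP a b h1 h2) (vP c d h2' h3) h4 h5 = hP (vP a b h1 h6) (vP c d h6' h3) h4 h5 :=
  vP_hP_hP_mid (D := D.transpose) a b c d h1 h2 h2' h3 h4 h5 h6 h6'

end DoubleCat

/-! ### The 2-cells of the composite -/

namespace DoubleTransData

variable {𝒜 ℬ 𝒞 : DoubleCat.{u, v, w, x}} {F G : DoublePsFunctor 𝒜 ℬ}
  {F' G' : DoublePsFunctor ℬ 𝒞}

/-- The 2-cell `t^{β∘α}_f`. -/
def hcompT (α : DoubleTransData F G) (β : DoubleTransData F' G') {A B : 𝒜.Obj} (f : 𝒜.Hor A B) :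
    𝒞.Sq (𝒞.hc (F'.mapH (F.mapH f)) (𝒞.hc (F'.mapH (α.hor.app B)) (β.hor.app (G.obj B))))
      (𝒞.vc (F'.mapV (α.ver.app A)) (β.ver.app (G.obj A))) (𝒞.v1 (G'.obj (G.obj B)))
      (G'.mapH (G.mapH f)) :=
  hP (β.ver.δ (α.ver.app A)) (vP (hP (β.ver.sq (F.mapH f)) (β.t (α.hor.app B)) rfl rfl)
    (G'.splitRightCell (α.t f)) rfl (𝒞.v1_vc _)) (𝒞.h1_hc _) (𝒞.h1_hc _)

/-- The 2-cell `δ_{β₁∘α₁,f}`. -/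
def hcompδ (α : DoubleTransData F G) (β : DoubleTransData F' G') {A B : 𝒜.Obj} (f : 𝒜.Hor A B) :
    𝒞.Sq (𝒞.hc (F'.mapH (F.mapH f)) (𝒞.hc (F'.mapH (α.hor.app B)) (β.hor.app (G.obj B))))
      (𝒞.v1 (F'.obj (F.obj A))) (𝒞.v1 (G'.obj (G.obj B)))
      (𝒞.hc (𝒞.hc (F'.mapH (α.hor.app A)) (β.hor.app (G.obj A))) (G'.mapH (G.mapH f))) :=
  vP (hP (α.hor.imageδ F' f) (𝒞.vId (β.hor.app (G.obj B))) (𝒞.hc_assoc _ _ _) (𝒞.hc_assoc _ _ _))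
    (hP (𝒞.vId (F'.mapH (α.hor.app A))) (β.hor.δ (G.mapH f)) rfl (𝒞.hc_assoc _ _ _).symm)
    (𝒞.v1_vc _) (𝒞.v1_vc _)

/-- The 2-cell `δ_{β₀∘α₀,u}`. -/
def hcompVerδ (α : DoubleTransData F G) (β : DoubleTransData F' G') {A A' : 𝒜.Obj}
    (u : 𝒜.Ver A A') :
    𝒞.Sq (𝒞.h1 (F'.obj (F.obj A)))
      (𝒞.vc (F'.mapV (F.mapV u)) (𝒞.vc (F'.mapV (α.ver.app A')) (β.ver.app (G.obj A'))))
      (𝒞.vc (𝒞.vc (F'.mapV (α.ver.app A)) (β.ver.app (G.obj A))) (G'.mapV (G.mapV u)))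
      (𝒞.h1 (G'.obj (G.obj A'))) :=
  hP (vP (α.ver.imageδ F' u) (𝒞.hId (β.ver.app (G.obj A'))) (𝒞.vc_assoc _ _ _) (𝒞.vc_assoc _ _ _))
    (vP (𝒞.hId (F'.mapV (α.ver.app A))) (β.ver.δ (G.mapV u)) rfl (𝒞.vc_assoc _ _ _).symm)
    (𝒞.h1_hc _) (𝒞.h1_hc _)

end DoubleTransData

/-! ### Axioms (T2) and (T3) for the composite -/

namespace DoubleTransData.IsDoublePsNat

variable {𝒜 ℬ 𝒞 : DoubleCat.{u, v, w, x}} {F G : DoublePsFunctor 𝒜 ℬ}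
  {F' G' : DoublePsFunctor ℬ 𝒞} {α : DoubleTransData F G} {β : DoubleTransData F' G'}

theorem hcomp_T2_hor (hα : α.IsDoublePsNat) (hβ : β.IsDoublePsNat) {𝒳 : DoubleCat.{u, v, w, x}}
    {H K : DoublePsFunctor 𝒳 𝒜} (γ : HorTransData H K) (hγ : γ.IsPsNat) (X : 𝒳.Obj) :
    IsHorInvertible ((α.hcomp β).hor.δ (γ.app X)) := by
  obtain ⟨i, hi⟩ := (hα.T2_hor γ hγ X).exists_horIso
  obtain ⟨j, hj⟩ :=
    (hβ.T2_hor (γ.image G) (HorTransData.image_isPsNat hγ G) X).exists_horIso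
  -- `k` is `imageδ` of `α₁` under `F'` as an invertible 2-cell, and `j` is `δ_{β₁}` at the
  -- component `G(γ(X))` of the image of `γ`.
  let k := (F'.hComp _ _).symm.trans ((F'.mapHorIso i).trans (F'.hComp _ _))
  have h := ((k.paste (HorIso.refl (β.hor.app _)) (𝒞.hc_assoc _ _ _) (𝒞.hc_assoc _ _ _)).trans
    ((HorIso.refl _).paste j rfl (𝒞.hc_assoc _ _ _).symm)).isHorInvertible
  dsimp only [k, HorIso.trans, HorIso.paste, HorIso.refl, HorIso.symm, mapHorIso] at h
  rw [hi, hj] at h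
  exact h

/-- Naturality of `β₀` with respect to the 2-cell `δ_{α₀,u}`: an instance of the transposed
`δ₂_hConj` after rebracketing. -/
theorem ver_δ_imageδ (hβ : β.IsDoublePsNat) {A A' : 𝒜.Obj} (u : 𝒜.Ver A A') :
    hP (vP (𝒞.hId (F'.mapV (F.mapV u))) (β.ver.δ (α.ver.app A')) rfl rfl)
      (hP (vP (β.ver.δ (F.mapV u)) (𝒞.hId (G'.mapV (α.ver.app A')))
          (𝒞.vc_assoc _ _ _) (𝒞.vc_assoc _ _ _))
        (vP (𝒞.hId (β.ver.app (F.obj A))) (α.ver.imageδ G' u) rfl rfl)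
          (𝒞.h1_hc _) (𝒞.h1_hc _)) (𝒞.h1_hc _) (𝒞.h1_hc _) =
    hP (vP (α.ver.imageδ F' u) (𝒞.hId (β.ver.app (G.obj A'))) (𝒞.vc_assoc _ _ _)
        (𝒞.vc_assoc _ _ _))
      (hP (vP (𝒞.hId (F'.mapV (α.ver.app A))) (β.ver.δ (G.mapV u)) rfl
          (𝒞.vc_assoc _ _ _).symm)
        (vP (β.ver.δ (α.ver.app A)) (𝒞.hId (G'.mapV (G.mapV u))) rfl (𝒞.vc_assoc _ _ _))
          (𝒞.h1_hc _) (𝒞.h1_hc _)) (𝒞.h1_hc _) (𝒞.h1_hc _) := by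
  rw [hPa', hP_vP_vP_mid (𝒞.hId (F'.mapV (α.ver.app A))) _ _ _ _ _ _ _ _ _ rfl
    (𝒞.vc_assoc _ _ _)]
  exact hβ.T1_ver.transpose.δ₂_hConj (α.ver.δ u)

theorem hcomp_T3_1_t (hα : α.IsDoublePsNat) (hβ : β.IsDoublePsNat) {A B A' B' : 𝒜.Obj}
    {f : 𝒜.Hor A B} {u : 𝒜.Ver A A'} {v : 𝒜.Ver B B'} {g : 𝒜.Hor A' B'} (a : 𝒜.Sq f u v g) :
    vP (hP (F'.mapSq (F.mapSq a)) (hP (F'.mapSq (α.hor.sq v)) (β.hor.sq (G.mapV v)) rfl rfl)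
        rfl rfl) (hcompT α β g) rfl (𝒞.vc_v1 _) =
      hP (hcompVerδ α β u)
        (vP (hcompT α β f) (G'.mapSq (G.mapSq a)) rfl (𝒞.v1_vc _))
        (𝒞.h1_hc _) (𝒞.h1_hc _) := by
  -- The layer belonging to `β`: (T3-1) at the square `(α₁)_v`, then naturality of `β₀` at `F(a)`.
  -- The layer below is `splitRightCell_nat`, and `ver_δ_imageδ` rearranges the `δ`-cells
  -- accumulated on the left.
  have e : vP (hP (F'.mapSq (F.mapSq a)) (hP (F'.mapSq (α.hor.sq v)) (β.hor.sq (G.mapV v))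
        rfl rfl) rfl rfl) (hP (β.ver.sq (F.mapH g)) (β.t (α.hor.app B')) rfl rfl)
        rfl (𝒞.vc_v1 _) =
      hP (β.ver.δ (F.mapV u)) (vP (hP (β.ver.sq (F.mapH f)) (β.t (α.hor.app B)) rfl rfl)
        (hP (G'.mapSq (F.mapSq a)) (G'.mapSq (α.hor.sq v)) rfl rfl) rfl (𝒞.v1_vc _))
        (𝒞.h1_hc _) (𝒞.h1_hc _) := by
    rw [vP_hP_hP, hβ.T3_1_t, hPa', hβ.T1_ver.nat, vP_hP_hP, hPa]
  rw [hcompT, hcompT, hcompVerδ, vP_hP_left _ _ _ _ rfl, vPa', e,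
    hP_vP_left _ _ _ _ (𝒞.vc_assoc _ _ _), vPa,
    hα.splitRightCell_nat, vP_hP_left _ _ _ _ rfl,
    hPa' (vP (β.ver.δ (F.mapV u)) _ _ _), hPa' (vP (𝒞.hId _) (β.ver.δ (α.ver.app A')) _ _),
    hβ.ver_δ_imageδ (α := α) u, hP_vP_left (β.ver.δ (α.ver.app A)) _ _ _ (𝒞.vc_assoc _ _ _), vPa,
    hPa, hPa, hPa]

/-- (T3-2) for `β` at `α₁(B)` and `G(g)` absorbs the lower half of `δ_{β₁∘α₁,g}`; the upper half,
the image of `δ_{α₁,g}` under `F'`, passes down by `δ_vP_t` and becomes its image under `G'`. -/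
theorem hcomp_δ_vP_t (hβ : β.IsDoublePsNat) {B C : 𝒜.Obj} (g : 𝒜.Hor B C) :
    vP (hcompδ α β g) (hP (β.t (α.hor.app B)) (𝒞.vId (G'.mapH (G.mapH g)))
        rfl rfl) (𝒞.v1_vc _) (𝒞.v1_vc _) =
      vP (hP (β.ver.sq (F.mapH g)) (β.t (α.hor.app C)) rfl rfl) (α.hor.imageδ G' g)
        (𝒞.vc_v1 _) (𝒞.vc_v1 _) := by
  have h := hβ.T3_2_t (α.hor.app B) (G.mapH g)
  have h' := hβ.δ_vP_t (α.hor.δ g)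
  rw [← h] at h'
  refine .trans ?_ h'
  rw [hcompδ, vPa, vP_hP_hP_mid _ _ _ _ _ _ _ _ _ _ rfl (𝒞.hc_assoc _ _ _)]
  rfl

/-- Naturality of `β₀` at the square `(α₀)_f` replaces `δ_{β₀,α₀(B)}` inside by `δ_{β₀,α₀(A)}` on
the far left, where it can be cancelled against that of `t^{β∘α}_f`. -/
theorem ver_sq_hP_hcompT (hβ : β.IsDoublePsNat) {A B C : 𝒜.Obj} (f : 𝒜.Hor A B)
    (g : 𝒜.Hor B C) :
    hP (vP (F'.mapSq (α.ver.sq f)) (β.ver.sq (G.mapH f)) rfl rfl) (hcompT α β g) rfl rfl =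
      hP (β.ver.δ (α.ver.app A)) (vP (hP (β.ver.sq (F.mapH f))
          (hP (β.ver.sq (F.mapH g)) (β.t (α.hor.app C)) rfl rfl) rfl rfl)
        (hP (G'.mapSq (α.ver.sq f)) (G'.splitRightCell (α.t g)) rfl rfl) rfl (𝒞.v1_vc _))
        (𝒞.h1_hc _) (𝒞.h1_hc _) := by
  rw [hcompT, hPa', hβ.T1_ver.nat, hPa, hP_vP_vP]

theorem hcomp_T3_2_t (hα : α.IsDoublePsNat) (hβ : β.IsDoublePsNat) {A B C : 𝒜.Obj}
    (f : 𝒜.Hor A B) (g : 𝒜.Hor B C) :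
    vP (hP (𝒞.vId (F'.mapH (F.mapH f))) (hcompδ α β g) rfl rfl)
        (hP (hcompT α β f) (𝒞.vId (G'.mapH (G.mapH g)))
          (𝒞.hc_assoc _ _ _) rfl) (𝒞.v1_vc _) (𝒞.v1_vc _) =
      hP (vP (F'.mapSq (α.ver.sq f)) (β.ver.sq (G.mapH f)) rfl rfl) (hcompT α β g) rfl rfl := by
  rw [hβ.ver_sq_hP_hcompT, hcompT,
    hP_assoc _ _ _ _ _ _ _ (𝒞.hc_assoc _ _ _) rfl (𝒞.h1_hc _) (𝒞.h1_hc _),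
    vP_hP_of_h1]
  -- Both sides begin with `δ_{β₀,α₀(A)}`; only the columns to its right are compared.
  congr 1
  rw [← hα.splitRightCell_δ, vPa' (hP (β.ver.sq _) _ _ _), vP_bot_right,
    ← hβ.hcomp_δ_vP_t, ← vP_hP_vId _ _ _ (𝒞.hc_assoc _ _ _) (𝒞.hc_assoc _ _ _) _ _ (𝒞.v1_vc _),
    vPa', hP_assoc (β.ver.sq (F.mapH f)) _ _ _ _ _ _ rfl rfl rfl rfl]
  congr 1
  rw [← vP_top_right _ _ _ _ rfl rfl _ _ (𝒞.v1_vc _)]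

/-- Naturality of a vertical transformation with respect to the comparison 2-cells of a composite
double pseudofunctor. -/
theorem ver_sq_comp_hComp (hβ : β.IsDoublePsNat) (F : DoublePsFunctor 𝒜 ℬ) {A B C : 𝒜.Obj}
    (f : 𝒜.Hor A B) (g : 𝒜.Hor B C) :
    vP (vP (F'.mapHorCell (F.hComp f g).hom) (F'.hComp (F.mapH f) (F.mapH g)).hom
        (𝒞.v1_vc _) (𝒞.v1_vc _))
      (hP (β.ver.sq (F.mapH f)) (β.ver.sq (F.mapH g)) rfl rfl) (𝒞.v1_vc _) (𝒞.v1_vc _) =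
    vP (β.ver.sq (F.mapH (𝒜.hc f g)))
      (vP (G'.mapHorCell (F.hComp f g).hom) (G'.hComp (F.mapH f) (F.mapH g)).hom
        (𝒞.v1_vc _) (𝒞.v1_vc _)) (𝒞.vc_v1 _) (𝒞.vc_v1 _) := by
  have h {A B : ℬ.Obj} {f g : ℬ.Hor A B} (a : ℬ.Sq f (ℬ.v1 A) (ℬ.v1 B) g) :
      vP (F'.mapHorCell a) (β.ver.sq g) (𝒞.v1_vc _) (𝒞.v1_vc _) =
        vP (β.ver.sq f) (G'.mapHorCell a) (𝒞.vc_v1 _) (𝒞.vc_v1 _) :=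
    hβ.T1_ver.transpose.sq_mapVerCell a
  have h' {A B C : ℬ.Obj} (f : ℬ.Hor A B) (g : ℬ.Hor B C) :
      vP (F'.hComp f g).hom (hP (β.ver.sq f) (β.ver.sq g) rfl rfl) (𝒞.v1_vc _) (𝒞.v1_vc _) =
        vP (β.ver.sq (ℬ.hc f g)) (G'.hComp f g).hom (𝒞.vc_v1 _) (𝒞.vc_v1 _) := by
    refine (F'.hComp f g).symm.hom_vP_inj (𝒞.v1_vc _) (𝒞.v1_vc _) ?_
    dsimp only [HorIso.symm]
    rw [HorIso.inv_hom_vP, vPa', hβ.T1_ver.sq_hc, vPa, HorIso.inv_hom, vP_vId]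
  rw [vPa, h', vPa', h, vPa]

theorem hcomp_T3_3_t (hα : α.IsDoublePsNat) (hβ : β.IsDoublePsNat) {A B C : 𝒜.Obj}
    (f : 𝒜.Hor A B) (g : 𝒜.Hor B C) :
    hcompT α β (𝒜.hc f g) =
      vP (hP (vP (F'.mapHorCell (F.hComp f g).hom) (F'.hComp (F.mapH f) (F.mapH g)).hom
            (𝒞.v1_vc _) (𝒞.v1_vc _))
          (𝒞.vId (𝒞.hc (F'.mapH (α.hor.app C)) (β.hor.app (G.obj C)))) rfl (𝒞.hc_assoc _ _ _))
        (vP (hP (vP (F'.mapSq (α.ver.sq f)) (β.ver.sq (G.mapH f)) rfl rfl) (hcompT α β g) rfl rfl)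
          (vP (G'.hComp (G.mapH f) (G.mapH g)).inv (G'.mapHorCell (G.hComp f g).inv)
            (𝒞.v1_vc _) (𝒞.v1_vc _)) (𝒞.vc_v1 _) (𝒞.vc_v1 _)) (𝒞.v1_vc _) (𝒞.v1_vc _) := by
  rw [hβ.ver_sq_hP_hcompT, hP_vP_of_h1, vP_hP_of_h1, hcompT]
  congr 1
  -- The comparison 2-cell of `G'F` that the image of `t^α` produces lies below `β₀`; naturality of
  -- `β₀` lifts it to the top, where it is that of `F'F`.
  rw [hα.splitRightCell_hc, vPa' (hP (β.ver.sq _) _ _ _), vP_bot_left, ← hβ.ver_sq_comp_hComp,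
    ← vP_top_left _ _ _ rfl (𝒞.hc_assoc _ _ _) (𝒞.hc_assoc _ _ _) _ _ (𝒞.v1_vc _),
    hP_assoc _ _ _ _ _ _ _ rfl rfl rfl rfl, vPa, vPa]

end DoubleTransData.IsDoublePsNat

theorem mainTheorem10 {𝒜 ℬ 𝒞 : DoubleCat.{u, v, w, x}} {F G : DoublePsFunctor 𝒜 ℬ}
    {F' G' : DoublePsFunctor ℬ 𝒞} (α : DoubleTransData F G) (β : DoubleTransData F' G')
    (hα : α.IsDoublePsNat) (hβ : β.IsDoublePsNat) :
    (α.hcomp β).IsDoublePsNat where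
  T1_ver := VerTransData.hcomp_isPsNat hα.T1_ver hβ.T1_ver
  T1_hor := HorTransData.hcomp_isPsNat hα.T1_hor hβ.T1_hor
  T2_hor := hα.hcomp_T2_hor hβ
  -- The remaining halves are those already proved, read for the transposes of `α` and `β`; the
  -- composite data agree definitionally.
  T2_ver γ hγ X := hα.transpose.hcomp_T2_hor hβ.transpose γ.transpose hγ.transpose X
  T3_1_t a := hα.hcomp_T3_1_t hβ a
  T3_1_r a := hα.transpose.hcomp_T3_1_t hβ.transpose a
  T3_2_t f g := hα.hcomp_T3_2_t hβ f g
  T3_2_r f g := hα.transpose.hcomp_T3_2_t hβ.transpose f g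
  T3_3_t f g := hα.hcomp_T3_3_t hβ f g
  T3_3_r f g := hα.transpose.hcomp_T3_3_t hβ.transpose f g
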